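/- Let $q\in\mathbb C^\times$ be not a root of unity. Put $$R(u,v)=(u-v)\sum_{i\ne j}E_{ii}\otimes E_{jj}+(q^{-1}u-qv)\sum_iE_{ii}\otimes E_{ii}+(q^{-1}-q)u\sum_{i>j}E_{ij}\otimes E_{ji}+(q^{-1}-q)v\sum_{i<j}E_{ij}\otimes E_{ji}$$ and let $R^t(u,v)$ be its transpose in the first tensor factor. Write $s_{ij}(u)=\sum_{r\ge 0}s^{(r)}_{ij}u^{-r}$ and $S(u)=(s_{ij}(u))$. The twisted $q$-Yangian $\mathrm Y^{\mathrm{tw}}_q(\mathfrak o_N)$ is the unital associative $\mathbb C$-algebra with generators $s_{ij}^{(r)}$ ($1\le i,j\le N$, $r\ge0$) and the relations $s^{(0)}_{ij}=0$ for $i<j$, $s^{(0)}_{ii}=1$, and the reflection relation $$R(u,v)S_1(u)R^t(u^{-1}v^{-1},1)S_2(v)=S_2(v)R^t(u^{-1}v^{-1},1)S_1(u)R(u,v).$$ For $N$ even put $i'=i+1$ for $i$ odd. Then $\mathrm Y^{\mathrm{tw}}_q(\mathfrak{sp}_N)$ is generated by $s_{ij}^{(r)}$ and $(s_{ii'}^{(0)})^{-1}$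 ($i=1,3,\dots,N-1$) with the reflection relation, the relations $s_{ij}^{(0)}=0$ for $i<j$ unless $i$ is odd and $j=i'$, and, for $i$ odd, $s^{(0)}_{ii'}(s_{ii'}^{(0)})^{-1}=(s_{ii'}^{(0)})^{-1}s^{(0)}_{ii'}=1$ and $s^{(0)}_{i'i'}s^{(0)}_{ii}-q^2s^{(0)}_{i'i}s^{(0)}_{ii'}=q^3$. Let $P^q=\sum_iE_{ii}\otimes E_{ii}+q\sum_{i>j}E_{ij}\otimes E_{ji}+q^{-1}\sum_{i<j}E_{ij}\otimes E_{ji}$, let $\sigma\mapsto P^q_\sigma$ be the action of $\mathfrak S_m$ on $(\mathbb C^N)^{\otimes m}$ in which the transposition $(k,k+1)$ acts as $P^q_{k,k+1}$, and put $A^q_m=\frac1{m!}\sum_\sigma\operatorname{sgn}\sigma\,P^q_\sigma$. Let $\overline R(x)=R(x,1)/(x-1)$, $u_a=q^{-2a+2}u$, and, with $\overline R^t_{ab}=\overline R^t_{ab}(u_a^{-1}u_b^{-1})$ expanded in powers of $u^{-1}$, $$\langle S_1,\dots,S_m\rangle=S_1(u_1)(\overline R^t_{12}\cdots\overline R^t_{1m})S_2(u_2)(\overline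 R^t_{23}\cdots\overline R^t_{2m})\cdots S_m(u_m).$$ The Sklyanin minors of a matrix $S(u)$ of series in $u^{-1}$ are defined by $A^q_m\langle S_1,\dots,S_m\rangle=\frac1{m!}\sum s^{i_1\cdots i_m}_{j_1\cdots j_m}(u)\otimes E_{i_1j_1}\otimes\cdots\otimes E_{i_mj_m}$, and the Sklyanin determinant of an $N\times N$ matrix is $\mathrm{sdet}_q S(u)=s^{1\cdots N}_{1\cdots N}(u)$. **Theorem (Sylvester's theorem for the Sklyanin determinant).** Let $N,M\ge1$, let $\mathfrak g$ be $\mathfrak o$ or $\mathfrak{sp}$, with $N$ and $M$ even in the second case, and let $S(u)$ be the generator matrix of $\mathrm Y^{\mathrm{tw}}_q(\mathfrak g_{N+M})$. Put $J=\{N+1,\dots,N+M\}$, let $S_J(u)$ be the submatrix of $S(u)$ with rows and columns in $J$, and let $\widetilde S(u)=(\widetilde s_{ij}(u))_{1\le i,j\le N}$ with $$\widetilde s_{ij}(u)=s^{i,N+1,\dots,N+M}_{j,N+1,\dots,N+M}(q^Mu).$$ Put $\kappa_M=1$ in the orthogonal case and $\kappa_M=q^{3M/2}$ in the symplectic case.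 Then there is a unique homomorphism of unital $\mathbb C$-algebras $\mathrm Y^{\mathrm{tw}}_q(\mathfrak g_N)\to\mathrm Y^{\mathrm{tw}}_q(\mathfrak g_{N+M})$ with $s_{ij}(u)\mapsto\kappa_M^{-1}\,\widetilde s_{ij}(u)$ for all $i,j$. Moreover $$\mathrm{sdet}_q\widetilde S(u)=\prod_{i=1}^{N-1}\mathrm{sdet}_q S_J(q^{M-2i}u)\cdot\mathrm{sdet}_qS(q^Mu).$$ -/

import Mathlib

noncomputable section

namespace TwistedYangian

/-! Every formal series in `u⁻¹` with coefficients in `A` is an element of `PowerSeries A`, the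
variable `PowerSeries.X` being `u⁻¹`. Series in `u⁻¹` and `v⁻¹` are elements of
`PowerSeries (PowerSeries A)`, the inner variable being `u⁻¹` and the outer one `v⁻¹`.
An operator on `(ℂ^N)^{⊗ m}` with coefficients in `B` is a matrix with entries in `B`, indexed by
`Fin m → Fin N`: the index `i` stands for `e_{i 0} ⊗ ⋯ ⊗ e_{i (m-1)}`. All indices start at `0`. -/

/-! ### The R-matrix -/

/-- The trigonometric R-matrix
`R(u,v) = (u-v) ∑_{i≠j} E_ii ⊗ E_jj + (q⁻¹u - qv) ∑_i E_ii ⊗ E_ii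
  + (q⁻¹-q) u ∑_{i>j} E_ij ⊗ E_ji + (q⁻¹-q) v ∑_{i<j} E_ij ⊗ E_ji`.
The entry at row `(i,k)` and column `(j,l)` is the coefficient of `E_ij ⊗ E_kl`. -/
def RMatrix {B : Type*} [CommRing B] [Algebra ℂ B] (q : ℂ) (N : ℕ) (u v : B) :
    Matrix (Fin N × Fin N) (Fin N × Fin N) B := fun r c =>
  if r = c then
    if r.1 = r.2 then q⁻¹ • u - q • v else u - v
  else if r.1 = c.2 ∧ r.2 = c.1 then
    if r.2 < r.1 then (q⁻¹ - q) • u else (q⁻¹ - q) • v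
  else 0

/-- Transposition in the first tensor factor, `E_ij ⊗ E_kl ↦ E_ji ⊗ E_kl`. -/
def transposeFirst {B : Type*} {N : ℕ} (T : Matrix (Fin N × Fin N) (Fin N × Fin N) B) :
    Matrix (Fin N × Fin N) (Fin N × Fin N) B := fun r c => T (c.1, r.2) (r.1, c.2)

/-- The operator `T_a` acting as `T` on the `a`-th tensor factor and as the identity elsewhere. -/
def onFactor {B : Type*} [Zero B] {N m : ℕ} (a : Fin m) (T : Matrix (Fin N) (Fin N) B) :
    Matrix (Fin m → Fin N) (Fin m → Fin N) B := fun i j =>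
  open Classical in if ∀ k, k ≠ a → i k = j k then T (i a) (j a) else 0

/-- The operator `T_{ab}` acting as `T` on the `a`-th and `b`-th tensor factors (`a ≠ b`) and as the
identity elsewhere. -/
def onFactors {B : Type*} [Zero B] {N m : ℕ} (a b : Fin m)
    (T : Matrix (Fin N × Fin N) (Fin N × Fin N) B) :
    Matrix (Fin m → Fin N) (Fin m → Fin N) B := fun i j =>
  open Classical in
    if ∀ k, k ≠ a → k ≠ b → i k = j k then T (i a, i b) (j a, j b) else 0

/-! ### Twisted q-Yangians -/

section Reflection

variable {A : Type*} [Ring A] [Algebra ℂ A]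

/-- `R(u,v)` divided by `uv`, which is `R(v⁻¹,u⁻¹)`, on two tensor factors. -/
def reflR (A : Type*) [Ring A] [Algebra ℂ A] (q : ℂ) (N : ℕ) :
    Matrix (Fin 2 → Fin N) (Fin 2 → Fin N) (PowerSeries (PowerSeries A)) :=
  onFactors 0 1 ((RMatrix q N (PowerSeries.X : PowerSeries (PowerSeries ℂ))
    (PowerSeries.C PowerSeries.X)).map (PowerSeries.map (PowerSeries.map (algebraMap ℂ A))))

/-- `R^t(u⁻¹v⁻¹, 1)` on two tensor factors. -/
def reflRt (A : Type*) [Ring A] [Algebra ℂ A] (q : ℂ) (N : ℕ) :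
    Matrix (Fin 2 → Fin N) (Fin 2 → Fin N) (PowerSeries (PowerSeries A)) :=
  onFactors 0 1 ((transposeFirst (RMatrix q N
    (PowerSeries.C PowerSeries.X * PowerSeries.X : PowerSeries (PowerSeries ℂ)) 1)).map
      (PowerSeries.map (PowerSeries.map (algebraMap ℂ A))))

/-- `S_1(u)` on two tensor factors. -/
def reflS₁ {N : ℕ} (S : Matrix (Fin N) (Fin N) (PowerSeries A)) :
    Matrix (Fin 2 → Fin N) (Fin 2 → Fin N) (PowerSeries (PowerSeries A)) :=
  onFactor 0 (S.map (PowerSeries.C (R := PowerSeries A)))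

/-- `S_2(v)` on two tensor factors. -/
def reflS₂ {N : ℕ} (S : Matrix (Fin N) (Fin N) (PowerSeries A)) :
    Matrix (Fin 2 → Fin N) (Fin 2 → Fin N) (PowerSeries (PowerSeries A)) :=
  onFactor 1 (S.map (PowerSeries.map (PowerSeries.C (R := A))))

/-- The left-hand side `R(u/v) S_1(u) R^t(1/uv) S_2(v)` of the reflection relation. The scalar
normalizing factors of the R-matrices, which are the same invertible scalar series on both sides,
are omitted. -/
def reflLeft (q : ℂ) {N : ℕ} (S : Matrix (Fin N) (Fin N) (PowerSeries A)) :
    Matrix (Fin 2 → Fin N) (Fin 2 → Fin N) (PowerSeries (PowerSeries A)) :=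
  reflR A q N * reflS₁ S * reflRt A q N * reflS₂ S

/-- The right-hand side `S_2(v) R^t(1/uv) S_1(u) R(u/v)` of the reflection relation, in the same
normalization. -/
def reflRight (q : ℂ) {N : ℕ} (S : Matrix (Fin N) (Fin N) (PowerSeries A)) :
    Matrix (Fin 2 → Fin N) (Fin 2 → Fin N) (PowerSeries (PowerSeries A)) :=
  reflS₂ S * reflRt A q N * reflS₁ S * reflR A q N

end Reflection

/-- The generators `s_ij^{(r)}`, `r ≥ 0`, of the orthogonal twisted q-Yangian. -/
abbrev OGen (N : ℕ) : Type := Fin N × Fin N × ℕ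

/-- The matrix of the series `s_ij(u) = ∑_r s_ij^{(r)} u^{-r}` in the free algebra. -/
def freeO (N : ℕ) : Matrix (Fin N) (Fin N) (PowerSeries (FreeAlgebra ℂ (OGen N))) :=
  fun i j => PowerSeries.mk fun r => FreeAlgebra.ι ℂ (i, j, r)

/-- The defining relations of the orthogonal twisted q-Yangian. -/
inductive ORel (q : ℂ) (N : ℕ) : FreeAlgebra ℂ (OGen N) → FreeAlgebra ℂ (OGen N) → Prop
  | upper (i j : Fin N) (h : i < j) : ORel q N (FreeAlgebra.ι ℂ (i, j, 0)) 0
  | diag (i : Fin N) : ORel q N (FreeAlgebra.ι ℂ (i, i, 0)) 1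
  | reflection (i j : Fin 2 → Fin N) (a b : ℕ) :
      ORel q N (PowerSeries.coeff a (PowerSeries.coeff b (reflLeft q (freeO N) i j)))
        (PowerSeries.coeff a (PowerSeries.coeff b (reflRight q (freeO N) i j)))

/-- The orthogonal twisted q-Yangian `Y_q^tw(o_N)`. -/
abbrev YO (q : ℂ) (N : ℕ) : Type := RingQuot (ORel q N)

/-- The generator matrix `S(u)` of `Y_q^tw(o_N)`. -/
def SO (q : ℂ) (N : ℕ) : Matrix (Fin N) (Fin N) (PowerSeries (YO q N)) :=
  fun i j => PowerSeries.mk fun r => RingQuot.mkAlgHom ℂ (ORel q N) (FreeAlgebra.ι ℂ (i, j, r))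

/-- `IsPair i j` says that, in one-based numbering, `i` is odd and `j = i' = i + 1`. -/
def IsPair {N : ℕ} (i j : Fin N) : Prop := Even i.val ∧ j.val = i.val + 1

/-- The generators `s_ij^{(r)}`, `r ≥ 0`, and `(s_ii'^{(0)})⁻¹`, `i = 1, 3, …` in one-based
numbering, of the symplectic twisted q-Yangian. -/
abbrev SpGen (N : ℕ) : Type := (Fin N × Fin N × ℕ) ⊕ {i : Fin N // Even i.val}

/-- The matrix of the series `s_ij(u) = ∑_r s_ij^{(r)} u^{-r}` in the free algebra. -/
def freeSp (N : ℕ) : Matrix (Fin N) (Fin N) (PowerSeries (FreeAlgebra ℂ (SpGen N))) :=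
  fun i j => PowerSeries.mk fun r => FreeAlgebra.ι ℂ (Sum.inl (i, j, r))

/-- The element `s_ij^{(0)}` of the free algebra. -/
def freeSp₀ {N : ℕ} (i j : Fin N) : FreeAlgebra ℂ (SpGen N) :=
  FreeAlgebra.ι ℂ (Sum.inl (i, j, 0))

/-- The defining relations of the symplectic twisted q-Yangian (`N` even). -/
inductive SpRel (q : ℂ) (N : ℕ) : FreeAlgebra ℂ (SpGen N) → FreeAlgebra ℂ (SpGen N) → Prop
  | upper (i j : Fin N) (h : i < j) (h' : ¬ IsPair i j) : SpRel q N (freeSp₀ i j) 0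
  | det (i j : Fin N) (h : IsPair i j) :
      SpRel q N (freeSp₀ j j * freeSp₀ i i - q ^ 2 • (freeSp₀ j i * freeSp₀ i j))
        (algebraMap ℂ _ (q ^ 3))
  | mul_inv (i j : Fin N) (h : IsPair i j) :
      SpRel q N (freeSp₀ i j * FreeAlgebra.ι ℂ (Sum.inr ⟨i, h.1⟩)) 1
  | inv_mul (i j : Fin N) (h : IsPair i j) :
      SpRel q N (FreeAlgebra.ι ℂ (Sum.inr ⟨i, h.1⟩) * freeSp₀ i j) 1
  | reflection (i j : Fin 2 → Fin N) (a b : ℕ) :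
      SpRel q N (PowerSeries.coeff a (PowerSeries.coeff b (reflLeft q (freeSp N) i j)))
        (PowerSeries.coeff a (PowerSeries.coeff b (reflRight q (freeSp N) i j)))

/-- The symplectic twisted q-Yangian `Y_q^tw(sp_N)` (`N` even). -/
abbrev YSp (q : ℂ) (N : ℕ) : Type := RingQuot (SpRel q N)

/-- The generator matrix `S(u)` of `Y_q^tw(sp_N)`. -/
def SSp (q : ℂ) (N : ℕ) : Matrix (Fin N) (Fin N) (PowerSeries (YSp q N)) :=
  fun i j => PowerSeries.mk fun r =>
    RingQuot.mkAlgHom ℂ (SpRel q N) (FreeAlgebra.ι ℂ (Sum.inl (i, j, r)))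

/-! ### The q-antisymmetrizer -/

/-- The number of inversions of a finite sequence. -/
def inversions {N m : ℕ} (i : Fin m → Fin N) : ℕ :=
  (Finset.univ.filter fun p : Fin m × Fin m => p.1 < p.2 ∧ i p.2 < i p.1).card

/-- The q-permutation operator
`P^q = ∑_i E_ii ⊗ E_ii + q ∑_{i>j} E_ij ⊗ E_ji + q⁻¹ ∑_{i<j} E_ij ⊗ E_ji`. -/
def PMatrix (q : ℂ) (N : ℕ) : Matrix (Fin N × Fin N) (Fin N × Fin N) ℂ := fun r c =>
  if r.1 = c.2 ∧ r.2 = c.1 then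
    if r.1 = r.2 then 1 else if r.2 < r.1 then q else q⁻¹
  else 0

/-- The operator `P_σ^q`, written in closed form:
`P_σ^q (e_{j 0} ⊗ ⋯) = q ^ (inversions (j ∘ σ⁻¹) - inversions j) (e_{(j ∘ σ⁻¹) 0} ⊗ ⋯)`.
By `qPerm_mul` and `qPerm_swap` below it is the product `P_{s_{i_1}}^q ⋯ P_{s_{i_l}}^q` along every
decomposition `σ = s_{i_1} ⋯ s_{i_l}` into adjacent transpositions. -/
def qPerm (q : ℂ) (N : ℕ) {m : ℕ} (σ : Equiv.Perm (Fin m)) :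
    Matrix (Fin m → Fin N) (Fin m → Fin N) ℂ := fun i j =>
  if i = j ∘ σ.symm then q ^ ((inversions i : ℤ) - inversions j) else 0

theorem qPerm_mul {q : ℂ} (hq : q ≠ 0) (N : ℕ) {m : ℕ} (σ τ : Equiv.Perm (Fin m)) :
    qPerm q N (σ * τ) = qPerm q N σ * qPerm q N τ := by
  ext i j
  rw [Matrix.mul_apply, Finset.sum_eq_single (j ∘ τ.symm)]
  · have h : j ∘ (σ * τ).symm = (j ∘ τ.symm) ∘ σ.symm := rfl
    simp only [qPerm, h, if_true]
    split_ifs with h1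
    · rw [← zpow_add₀ hq]
      congr 1
      ring
    · simp
  · intro k _ hk
    simp [qPerm, hk]
  · simp

theorem inversions_eq {N m : ℕ} (i : Fin m → Fin N) {a b : Fin m} (hab : b.val = a.val + 1) :
    inversions i = (Finset.univ.filter fun p : Fin m × Fin m =>
      (p.1 < p.2 ∧ i p.2 < i p.1) ∧ p ≠ (a, b)).card + if i b < i a then 1 else 0 := by
  have hlt : a < b := by
    rw [Fin.lt_def]
    omega
  rw [inversions, ← Finset.card_filter_add_card_filter_not (fun p => p ≠ (a, b)),
    Finset.filter_filter]
  congr 1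
  rw [Finset.filter_filter]
  split_ifs with h
  · rw [Finset.card_eq_one]
    refine ⟨(a, b), ?_⟩
    ext p
    simp only [Finset.mem_filter, Finset.mem_univ, true_and, Finset.mem_singleton, not_not]
    constructor
    · exact fun h => h.2
    · rintro rfl
      exact ⟨⟨hlt, h⟩, rfl⟩
  · rw [Finset.card_eq_zero]
    ext p
    simp only [Finset.mem_filter, Finset.mem_univ, true_and, not_not, Finset.notMem_empty,
      iff_false]
    rintro ⟨⟨_, h2⟩, rfl⟩
    exact h h2

theorem inversions_swap {N m : ℕ} (i : Fin m → Fin N) {a b : Fin m} (hab : b.val = a.val + 1) :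
    inversions i + (if i a < i b then 1 else 0) =
      inversions (i ∘ Equiv.swap a b) + if i b < i a then 1 else 0 := by
  have hab' : a ≠ b := by
    rintro rfl
    omega
  rw [inversions_eq i hab, inversions_eq (i ∘ Equiv.swap a b) hab]
  have key : ∀ x y : Fin m, x < y → (x, y) ≠ (a, b) →
      Equiv.swap a b x < Equiv.swap a b y ∧ (Equiv.swap a b x, Equiv.swap a b y) ≠ (a, b) := by
    intro x y hxy hne
    simp only [ne_eq, Prod.mk.injEq, Equiv.swap_apply_def, Fin.lt_def, Fin.ext_iff] at *
    split_ifs <;> omega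
  have hcard : (Finset.univ.filter fun p : Fin m × Fin m =>
      (p.1 < p.2 ∧ i p.2 < i p.1) ∧ p ≠ (a, b)).card =
    (Finset.univ.filter fun p : Fin m × Fin m =>
      (p.1 < p.2 ∧ (i ∘ Equiv.swap a b) p.2 < (i ∘ Equiv.swap a b) p.1) ∧ p ≠ (a, b)).card := by
    refine Finset.card_bij' (fun p _ => (Equiv.swap a b p.1, Equiv.swap a b p.2))
      (fun p _ => (Equiv.swap a b p.1, Equiv.swap a b p.2)) ?_ ?_ ?_ ?_
    · rintro ⟨x, y⟩ h
      simp only [Finset.mem_filter, Finset.mem_univ, true_and] at h ⊢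
      have := key x y h.1.1 h.2
      refine ⟨⟨this.1, ?_⟩, this.2⟩
      simpa using h.1.2
    · rintro ⟨x, y⟩ h
      simp only [Finset.mem_filter, Finset.mem_univ, true_and] at h ⊢
      have := key x y h.1.1 h.2
      exact ⟨⟨this.1, h.1.2⟩, this.2⟩
    · rintro ⟨x, y⟩ _
      simp
    · rintro ⟨x, y⟩ _
      simp
  rw [hcard]
  simp only [Function.comp_apply, Equiv.swap_apply_left, Equiv.swap_apply_right]
  ring

theorem qPerm_swap (q : ℂ) (N : ℕ) {m : ℕ} {a b : Fin m}
    (hab : b.val = a.val + 1) :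
    qPerm q N (Equiv.swap a b) = onFactors a b (PMatrix q N) := by
  have hne : a ≠ b := by
    rintro rfl
    omega
  ext i j
  have hiff : i = j ∘ (Equiv.swap a b).symm ↔
      (∀ k, k ≠ a → k ≠ b → i k = j k) ∧ i a = j b ∧ i b = j a := by
    constructor
    · rintro rfl
      refine ⟨fun k hka hkb => ?_, ?_, ?_⟩
      · simp [Equiv.swap_apply_of_ne_of_ne hka hkb]
      · simp
      · simp
    · rintro ⟨h1, h2, h3⟩
      funext k
      by_cases hka : k = a
      · subst hka
        simp [h2]
      · by_cases hkb : k = b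
        · subst hkb
          simp [h3]
        · simp [Equiv.swap_apply_of_ne_of_ne hka hkb, h1 k hka hkb]
  by_cases hi : i = j ∘ (Equiv.swap a b).symm
  · obtain ⟨h1, h2, h3⟩ := hiff.1 hi
    have hinv := inversions_swap i hab
    have hj : i ∘ Equiv.swap a b = j := by
      funext k
      simp [hi]
    rw [hj] at hinv
    have hL : qPerm q N (Equiv.swap a b) i j = q ^ ((inversions i : ℤ) - inversions j) :=
      if_pos hi
    have hR : onFactors a b (PMatrix q N) i j =
        if i a = i b then 1 else if i b < i a then q else q⁻¹ := by
      simp only [onFactors, if_pos h1, PMatrix, h2, h3, and_self, if_true]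
    rw [hL, hR]
    rcases lt_trichotomy (i a) (i b) with h | h | h
    · rw [if_pos h, if_neg h.not_gt] at hinv
      rw [if_neg h.ne, if_neg h.not_gt, ← zpow_neg_one]
      congr 1
      omega
    · rw [if_neg h.not_lt, if_neg h.not_gt] at hinv
      rw [if_pos h, show ((inversions i : ℤ) - inversions j) = 0 by omega, zpow_zero]
    · rw [if_neg h.not_gt, if_pos h] at hinv
      rw [if_neg h.ne', if_pos h, show ((inversions i : ℤ) - inversions j) = 1 by omega, zpow_one]
  · have hL : qPerm q N (Equiv.swap a b) i j = 0 := if_neg hi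
    rw [hL]
    simp only [onFactors, PMatrix]
    split_ifs with h1 h2 <;> first | rfl | exact absurd (hiff.2 ⟨h1, h2⟩) hi

/-- The q-antisymmetrizer `A_m^q = (1/m!) ∑_σ sgn σ · P_σ^q`. -/
def qAntisymmetrizer (q : ℂ) (N m : ℕ) : Matrix (Fin m → Fin N) (Fin m → Fin N) ℂ :=
  (m.factorial : ℂ)⁻¹ • ∑ σ : Equiv.Perm (Fin m), ((Equiv.Perm.sign σ : ℤ) : ℂ) • qPerm q N σ

/-! ### Sklyanin minors and determinants -/

section Minors

variable {A : Type*} [Ring A] [Algebra ℂ A]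

/-- The series `f(cu)`, for a nonzero scalar `c`. -/
def scaleVar (c : ℂ) (f : PowerSeries A) : PowerSeries A :=
  PowerSeries.mk fun r => (c⁻¹) ^ r • PowerSeries.coeff r f

/-- `R̄^t(x)`, the transpose in the first factor of `R̄(x) = R(x,1)/(x-1)`, expanded as a series
in `u⁻¹`. -/
def RBarT (q : ℂ) (N : ℕ) (x : PowerSeries ℂ) :
    Matrix (Fin N × Fin N) (Fin N × Fin N) (PowerSeries ℂ) :=
  (x - 1)⁻¹ • transposeFirst (RMatrix q N x 1)

/-- The factor `S_a(u_a) R̄^t_{a,a+1} ⋯ R̄^t_{a,m-1}` with `u_a = q^{-2a} u`, where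
`R̄^t_{ab} = R̄^t_{ab}(u_a⁻¹ u_b⁻¹)`. -/
def bracketFactor (q : ℂ) {N : ℕ} (S : Matrix (Fin N) (Fin N) (PowerSeries A)) {m : ℕ}
    (a : Fin m) : Matrix (Fin m → Fin N) (Fin m → Fin N) (PowerSeries A) :=
  onFactor a (S.map (scaleVar (q ^ (-2 * (a.val : ℤ))))) *
    (((List.finRange m).filter fun b => a < b).map fun b =>
      onFactors a b ((RBarT q N
        (PowerSeries.C (q ^ (2 * a.val + 2 * b.val)) * PowerSeries.X ^ 2)).map
          (PowerSeries.map (algebraMap ℂ A)))).prod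

/-- `⟨S_1, …, S_m⟩` at `u_a = q^{-2a} u`, `a = 0, …, m-1`. -/
def bracket (q : ℂ) {N : ℕ} (S : Matrix (Fin N) (Fin N) (PowerSeries A)) (m : ℕ) :
    Matrix (Fin m → Fin N) (Fin m → Fin N) (PowerSeries A) :=
  ((List.finRange m).map fun a => bracketFactor q S a).prod

/-- The Sklyanin minor `s^{i_1 ⋯ i_m}_{j_1 ⋯ j_m}(u)`, defined by
`A_m^q ⟨S_1, …, S_m⟩ = (1/m!) ∑ s^{i_1 ⋯ i_m}_{j_1 ⋯ j_m}(u) ⊗ E_{i_1 j_1} ⊗ ⋯ ⊗ E_{i_m j_m}`. -/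
def sklyaninMinor (q : ℂ) {N : ℕ} (S : Matrix (Fin N) (Fin N) (PowerSeries A)) {m : ℕ}
    (i j : Fin m → Fin N) : PowerSeries A :=
  m.factorial • (((qAntisymmetrizer q N m).map
    (algebraMap ℂ (PowerSeries A)) * bracket q S m) i j)

/-- The Sklyanin determinant `sdet_q S(u) = s^{1 ⋯ N}_{1 ⋯ N}(u)`. -/
def sdet (q : ℂ) {N : ℕ} (S : Matrix (Fin N) (Fin N) (PowerSeries A)) : PowerSeries A :=
  sklyaninMinor q S (id : Fin N → Fin N) id

/-- The sequence `i, N+1, …, N+M` (one-based numbering). -/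
def bordered {N : ℕ} (M : ℕ) (i : Fin N) : Fin (M + 1) → Fin (N + M) :=
  Fin.cons (Fin.castAdd M i) (Fin.natAdd N)

/-- The `N × N` matrix `S̃(u)` with entries `s^{i,N+1,…,N+M}_{j,N+1,…,N+M}(q^M u)`. -/
def tildeS (q : ℂ) {N M : ℕ} (S : Matrix (Fin (N + M)) (Fin (N + M)) (PowerSeries A)) :
    Matrix (Fin N) (Fin N) (PowerSeries A) := fun i j =>
  scaleVar (q ^ M) (sklyaninMinor q S (bordered M i) (bordered M j))

/-- The submatrix `S_J(u)` with rows and columns in `J = {N+1, …, N+M}` (one-based numbering). -/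
def subJ {N M : ℕ} (S : Matrix (Fin (N + M)) (Fin (N + M)) (PowerSeries A)) :
    Matrix (Fin M) (Fin M) (PowerSeries A) := S.submatrix (Fin.natAdd N) (Fin.natAdd N)

/-- `∏_{i=1}^{N-1} sdet_q S_J(q^{M-2i} u) · sdet_q S(q^M u)`. -/
def sylvesterProduct (q : ℂ) {N M : ℕ}
    (S : Matrix (Fin (N + M)) (Fin (N + M)) (PowerSeries A)) : PowerSeries A :=
  ((List.range (N - 1)).map fun k =>
    scaleVar (q ^ ((M : ℤ) - 2 * ((k : ℤ) + 1))) (sdet q (subJ S))).prod *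
      scaleVar (q ^ M) (sdet q S)

end Minors

end TwistedYangian

end

/-! Let I be the first N indices, J the last M, and let S°(u) be the Schur complement S_II − S_IJ
S_JJ⁻¹ S_JI taken at q^{-M}u (`scaledSchur`). Both parts of the theorem come from the factorizations
S̃(u) = d(u) S°(u) (`tildeS_eq`) and sdet S(q^M u) = d(u) sdet S°(u) (`scaleVar_sdet`), where d(u) =
sdet S_J(q^M u). They are the cases k = 1 and k = N of `minor_append`: a minor with k rows and
columns in I followed by all of J is the minor of S_J times a k-minor of the Schur complement.

The factorization is column elimination. A minor is right linear in its last column, through the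
expansion `minor_succ`, and q-antisymmetric in its columns, `antiOn_minor`. So right multiples of
the J-columns may be subtracted from the last column, and they can be chosen to kill its J-rows.
Column antisymmetry comes from fusion: R(q²,1) is proportional to 1 − P^q, and the Yang–Baxter
equation and the reflection relation carry it from the rows of ⟨S_1, …, S_m⟩ to the columns
(`exists_rop_brk`).

S° again satisfies the reflection relation (`seriesReflects_schur`). The inverse of S satisfies a
reflection relation with R^t inverted, this relation restricts to the indices in I, and the I-block
of S⁻¹ is the inverse of the Schur complement. The I-block of the inverse of R^t(x,1) is
proportional to the inverse of R^t(q^{-2M}x,1), which explains the shift by q^{-M}.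

Multiplying S° by d preserves the relation, because the coefficients of d commute with each other
and with S°. The first fact is the centrality of the Sklyanin determinant in the algebra generated
by S_J (`commute_minor_entry`): moving one more matrix through ⟨S_1, …, S_N⟩ produces products of
R-matrices which act on q-antisymmetric functions by scalars. The second holds because entries of
S⁻¹ with indices in I commute with entries of S with indices in J (`commute_schur`).

It remains to compare constant terms. The leading matrix is block lower triangular, so S° has the
leading terms of S_II, while d has leading term 1 in the orthogonal case and q^{3M/2} in the
symplectic one. Hence κ_M⁻¹ S̃ satisfies all defining relations, and the homomorphism exists and is
unique by the universal property. Finally sdet(d S°) = d(u) d(q^{-2}u) ⋯ d(q^{-2N+2}u) sdet S°(u),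
and the first factor combines with sdet S° into sdet S(q^M u).

Throughout, operators on tensor powers are replaced by functions of row and column indices, on which
R-matrices act by exchanging two indices. -/

namespace TwistedYangian

/-! ### R-matrices acting on functions of indices, and the Yang–Baxter equation -/

section Exchange

variable {ι L K E : Type*} [DecidableEq ι] [CommRing K] [AddCommGroup E] [Module K E]

/-- The operator `g ↦ A(i_a, i_b) g(i) + B(i_a, i_b) g(i ∘ (a b))` on functions of a family of
indices. -/
def exchange (A B : L → L → K) (a b : ι) : ((ι → L) → E) →ₗ[K] ((ι → L) → E) where
  toFun g i := A (i a) (i b) • g i + B (i a) (i b) • g (i ∘ Equiv.swap a b)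
  map_add' g h := by
    funext i
    simp only [Pi.add_apply, smul_add]
    abel
  map_smul' c g := by
    funext i
    simp only [Pi.smul_apply, smul_add, RingHom.id_apply, smul_comm c]

theorem exchange_apply (A B : L → L → K) (a b : ι) (g : (ι → L) → E) (i : ι → L) :
    exchange A B a b g i = A (i a) (i b) • g i + B (i a) (i b) • g (i ∘ Equiv.swap a b) := rfl

theorem exchange_comm (A B A' B' : L → L → K) {a b c d : ι} (hac : a ≠ c) (had : a ≠ d)
    (hbc : b ≠ c) (hbd : b ≠ d) (g : (ι → L) → E) :
    exchange A B a b (exchange A' B' c d g) = exchange A' B' c d (exchange A B a b g) := by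
  funext i
  have h : (i ∘ Equiv.swap a b) ∘ Equiv.swap c d = (i ∘ Equiv.swap c d) ∘ Equiv.swap a b := by
    funext n
    simp only [Function.comp_apply, Equiv.swap_apply_def]
    grind
  have h₁ : Equiv.swap a b c = c := Equiv.swap_apply_of_ne_of_ne hac.symm hbc.symm
  have h₂ : Equiv.swap a b d = d := Equiv.swap_apply_of_ne_of_ne had.symm hbd.symm
  have h₃ : Equiv.swap c d a = a := Equiv.swap_apply_of_ne_of_ne hac had
  have h₄ : Equiv.swap c d b = b := Equiv.swap_apply_of_ne_of_ne hbc hbd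
  simp only [exchange_apply, Function.comp_apply, h₁, h₂, h₃, h₄, h]
  module

variable [LinearOrder L] [Algebra ℂ K]

/-- The coefficient of `E_ii ⊗ E_jj` in `R(u,v)`. -/
noncomputable def diagCoeff (q : ℂ) (u v : K) (i j : L) : K :=
  if i = j then algebraMap ℂ K q⁻¹ * u - algebraMap ℂ K q * v else u - v

/-- The coefficient of `E_ij ⊗ E_ji`, `i ≠ j`, in `R(u,v)`. -/
noncomputable def swapCoeff (q : ℂ) (u v : K) (i j : L) : K :=
  if j < i then (algebraMap ℂ K q⁻¹ - algebraMap ℂ K q) * u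
  else if i < j then (algebraMap ℂ K q⁻¹ - algebraMap ℂ K q) * v else 0

/-- The action of `R_{ab}(u,v)` on functions of a family of indices. -/
noncomputable def rop (q : ℂ) (a b : ι) (u v : K) : ((ι → L) → E) →ₗ[K] ((ι → L) → E) :=
  exchange (diagCoeff q u v) (swapCoeff q u v) a b

theorem rop_apply (q : ℂ) (a b : ι) (u v : K) (g : (ι → L) → E) (i : ι → L) :
    rop q a b u v g i = diagCoeff q u v (i a) (i b) • g i +
      swapCoeff q u v (i a) (i b) • g (i ∘ Equiv.swap a b) := rfl

/-- The family `i` with the values at `a`, `b`, `c` replaced. -/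
def place (a b c : ι) (i : ι → L) (x y z : L) : ι → L :=
  fun n => if n = a then x else if n = b then y else if n = c then z else i n

-- The condition on the parameters is (u₁/v₁)(u₃/v₃) = u₂/v₂ without denominators, so that the
-- parameters may be arbitrary series. All operators only rearrange the values at a, b, c, so the
-- identity is checked for each of the thirteen relative orders of three values, ties included.
set_option linter.unusedSimpArgs false in
set_option maxHeartbeats 1000000 in
theorem yang_baxter {q : ℂ} (hq : q ≠ 0) {a b c : ι} (hab : a ≠ b) (hac : a ≠ c) (hbc : b ≠ c)
    (u₁ v₁ u₂ v₂ u₃ v₃ : K) (h : u₁ * u₃ * v₂ = v₁ * v₃ * u₂) (g : (ι → L) → E) :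
    rop q a b u₁ v₁ (rop q a c u₂ v₂ (rop q b c u₃ v₃ g)) =
      rop q b c u₃ v₃ (rop q a c u₂ v₂ (rop q a b u₁ v₁ g)) := by
  funext i
  have hi : i = place a b c i (i a) (i b) (i c) := by
    funext n
    simp only [place]
    split_ifs <;> simp_all
  have ha : ∀ x y z, place a b c i x y z a = x := fun x y z => by simp [place]
  have hb : ∀ x y z, place a b c i x y z b = y := fun x y z => by simp [place, hab.symm]
  have hc : ∀ x y z, place a b c i x y z c = z := fun x y z => by
    simp [place, hac.symm, hbc.symm]
  have h1 : ∀ x y z, place a b c i x y z ∘ Equiv.swap a b = place a b c i y x z := by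
    intro x y z
    funext n
    simp only [place, Function.comp_apply, Equiv.swap_apply_def]
    grind
  have h2 : ∀ x y z, place a b c i x y z ∘ Equiv.swap a c = place a b c i z y x := by
    intro x y z
    funext n
    simp only [place, Function.comp_apply, Equiv.swap_apply_def]
    grind
  have h3 : ∀ x y z, place a b c i x y z ∘ Equiv.swap b c = place a b c i x z y := by
    intro x y z
    funext n
    simp only [place, Function.comp_apply, Equiv.swap_apply_def]
    grind
  rw [hi]
  generalize i a = x
  generalize i b = y
  generalize i c = z
  simp only [rop_apply, ha, hb, hc, h1, h2, h3]
  generalize place a b c i = G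
  have hps : algebraMap ℂ K q⁻¹ * algebraMap ℂ K q = 1 := by
    rw [← map_mul, inv_mul_cancel₀ hq, map_one]
  simp only [diagCoeff, swapCoeff]
  generalize algebraMap ℂ K q⁻¹ = p at *
  generalize algebraMap ℂ K q = s at *
  clear h1 h2 h3 ha hb hc hi
  rcases lt_trichotomy x y with h1 | rfl | h1
  · rcases lt_trichotomy y z with h2 | rfl | h2
    · have h3 := h1.trans h2
      simp only [h1, h1.ne, h1.ne', h1.not_gt, h2, h2.ne, h2.ne', h2.not_gt, h3, h3.ne, h3.ne', h3.not_gt, lt_irrefl, if_true, if_false, zero_smul, add_zero]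
      match_scalars <;> grind
    · simp only [h1, h1.ne, h1.ne', h1.not_gt, lt_irrefl, if_true, if_false, zero_smul, add_zero]
      match_scalars <;> grind
    · rcases lt_trichotomy x z with h3 | rfl | h3
      · simp only [h1, h1.ne, h1.ne', h1.not_gt, h2, h2.ne, h2.ne', h2.not_gt, h3, h3.ne, h3.ne', h3.not_gt, lt_irrefl, if_true, if_false, zero_smul, add_zero]
        match_scalars <;> grind
      · simp only [h1, h1.ne, h1.ne', h1.not_gt, lt_irrefl, if_true, if_false, zero_smul, add_zero]
        match_scalars <;> grind
      · simp only [h1, h1.ne, h1.ne', h1.not_gt, h2, h2.ne, h2.ne', h2.not_gt, h3, h3.ne, h3.ne', h3.not_gt, lt_irrefl, if_true, if_false, zero_smul, add_zero]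
        match_scalars <;> grind
  · rcases lt_trichotomy x z with h1 | rfl | h1
    · simp only [h1, h1.ne, h1.ne', h1.not_gt, lt_irrefl, if_true, if_false, zero_smul, add_zero]
      match_scalars <;> grind
    · simp only [lt_irrefl, if_true, if_false, zero_smul, add_zero]
      match_scalars <;> grind
    · simp only [h1, h1.ne, h1.ne', h1.not_gt, lt_irrefl, if_true, if_false, zero_smul, add_zero]
      match_scalars <;> grind
  · rcases lt_trichotomy y z with h2 | rfl | h2
    · rcases lt_trichotomy x z with h3 | rfl | h3
      · simp only [h1, h1.ne, h1.ne', h1.not_gt, h2, h2.ne, h2.ne', h2.not_gt, h3, h3.ne, h3.ne', h3.not_gt, lt_irrefl, if_true, if_false, zero_smul, add_zero]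
        match_scalars <;> grind
      · simp only [h1, h1.ne, h1.ne', h1.not_gt, lt_irrefl, if_true, if_false, zero_smul, add_zero]
        match_scalars <;> grind
      · simp only [h1, h1.ne, h1.ne', h1.not_gt, h2, h2.ne, h2.ne', h2.not_gt, h3, h3.ne, h3.ne', h3.not_gt, lt_irrefl, if_true, if_false, zero_smul, add_zero]
        match_scalars <;> grind
    · simp only [h1, h1.ne, h1.ne', h1.not_gt, lt_irrefl, if_true, if_false, zero_smul, add_zero]
      match_scalars <;> grind
    · have h3 := h2.trans h1
      simp only [h1, h1.ne, h1.ne', h1.not_gt, h2, h2.ne, h2.ne', h2.not_gt, h3, h3.ne, h3.ne', h3.not_gt, lt_irrefl, if_true, if_false, zero_smul, add_zero]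
      match_scalars <;> grind

theorem rop_comm (q : ℂ) (u v u' v' : K) {a b c d : ι} (hac : a ≠ c) (had : a ≠ d)
    (hbc : b ≠ c) (hbd : b ≠ d) (g : (ι → L) → E) :
    rop q a b u v (rop q c d u' v' g) = rop q c d u' v' (rop q a b u v g) :=
  exchange_comm _ _ _ _ hac had hbc hbd g

end Exchange

/-! ### Exchange operators and products of functions of disjoint sets of indices -/

section ExchangeMul

variable {ι L K E : Type*} [DecidableEq ι] [CommRing K] [Ring E] [Algebra K E]

theorem comp_swap_eq {f : (ι → L) → E} {s : Set ι} (hf : DependsOn f s) {a b : ι} (ha : a ∉ s)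
    (hb : b ∉ s) (i : ι → L) : f (i ∘ Equiv.swap a b) = f i :=
  hf fun n hn => by
    rw [Function.comp_apply, Equiv.swap_apply_of_ne_of_ne] <;> rintro rfl <;> contradiction

theorem exchange_mul_right (A B : L → L → K) {a b : ι} (g : (ι → L) → E) {f : (ι → L) → E}
    {s : Set ι} (hf : DependsOn f s) (ha : a ∉ s) (hb : b ∉ s) :
    exchange A B a b (g * f) = exchange A B a b g * f := by
  funext i
  simp only [exchange_apply, Pi.mul_apply, comp_swap_eq hf ha hb, add_mul, smul_mul_assoc]

theorem exchange_mul_left (A B : L → L → K) {a b : ι} {f : (ι → L) → E} (g : (ι → L) → E)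
    {s : Set ι} (hf : DependsOn f s) (ha : a ∉ s) (hb : b ∉ s) :
    exchange A B a b (f * g) = f * exchange A B a b g := by
  funext i
  simp only [exchange_apply, Pi.mul_apply, comp_swap_eq hf ha hb, mul_add, mul_smul_comm]

theorem dependsOn_exchange (A B : L → L → K) {a b : ι} {g : (ι → L) → E} {s : Set ι}
    (hg : DependsOn g s) (ha : a ∈ s) (hb : b ∈ s) : DependsOn (exchange A B a b g) s := by
  intro i j h
  rw [exchange_apply, exchange_apply, h a ha, h b hb, hg h, hg (x := i ∘ Equiv.swap a b)
    (y := j ∘ Equiv.swap a b)]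
  intro n hn
  refine h _ ?_
  rw [Equiv.swap_apply_def]
  split_ifs <;> assumption

theorem dependsOn_mul {f g : (ι → L) → E} {s : Set ι} (hf : DependsOn f s) (hg : DependsOn g s) :
    DependsOn (f * g) s := fun i j h => by
  rw [Pi.mul_apply, Pi.mul_apply, hf h, hg h]

end ExchangeMul
end TwistedYangian

namespace TwistedYangian

/-! ### The products ⟨S_0, …, S_{m-1}⟩ and the passage of R-matrices through them -/

section Bracket

open Sum

variable {L K E : Type*} [LinearOrder L] [CommRing K] [Algebra ℂ K] [Ring E] [Algebra K E]

/-- The function `s_{r_a c_a}` given by the `a`-th matrix of the sequence `S`, the position `inl a`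
being its row and `inr a` its column. -/
def entry (S : ℕ → L → L → E) (a : ℕ) : (ℕ ⊕ ℕ → L) → E := fun i => S a (i (inl a)) (i (inr a))

/-- The positions of the tensor factors before the `m`-th. -/
def before (m : ℕ) : Set (ℕ ⊕ ℕ) := {p | Sum.elim (· < m) (· < m) p}

@[simp] theorem inl_mem_before {n m : ℕ} : (inl n : ℕ ⊕ ℕ) ∈ before m ↔ n < m := Iff.rfl

@[simp] theorem inr_mem_before {n m : ℕ} : (inr n : ℕ ⊕ ℕ) ∈ before m ↔ n < m := Iff.rfl

theorem dependsOn_entry (S : ℕ → L → L → E) (a : ℕ) :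
    DependsOn (entry S a) ({inl a, inr a} : Set (ℕ ⊕ ℕ)) := fun i j h => by
  rw [entry, entry, h (inl a) (by simp), h (inr a) (by simp)]

/-- The action of `R̄_{ab}^t = w_{ab} R_{ab}^t(x_{ab}, 1)` placed between the `a`-th and the `b`-th
matrix of a product. -/
noncomputable def rbar (q : ℂ) (x w : ℕ → ℕ → K) (a b : ℕ) :
    ((ℕ ⊕ ℕ → L) → E) →ₗ[K] ((ℕ ⊕ ℕ → L) → E) :=
  w a b • rop q (inr a) (inl b) (x a b) 1

/-- The product `R̄_{0b}^t ⋯ R̄_{k-1,b}^t`. -/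
noncomputable def trans (q : ℂ) (x w : ℕ → ℕ → K) (b : ℕ) :
    ℕ → ((ℕ ⊕ ℕ → L) → E) →ₗ[K] ((ℕ ⊕ ℕ → L) → E)
  | 0 => LinearMap.id
  | k + 1 => trans q x w b k ∘ₗ rbar q x w k b

/-- The entries of `⟨S_0, …, S_{m-1}⟩`. -/
noncomputable def brk (q : ℂ) (x w : ℕ → ℕ → K) (S : ℕ → L → L → E) : ℕ → (ℕ ⊕ ℕ → L) → E
  | 0 => 1
  | m + 1 => trans q x w m m (brk q x w S m * entry S m)

variable {q : ℂ} {x w : ℕ → ℕ → K} {S : ℕ → L → L → E}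

theorem trans_zero (b : ℕ) (g : (ℕ ⊕ ℕ → L) → E) : trans q x w b 0 g = g := rfl

theorem trans_succ (b k : ℕ) (g : (ℕ ⊕ ℕ → L) → E) :
    trans q x w b (k + 1) g = trans q x w b k (rbar q x w k b g) := rfl

theorem rbar_eq (a b : ℕ) (g : (ℕ ⊕ ℕ → L) → E) :
    rbar q x w a b g = w a b • rop q (inr a) (inl b) (x a b) 1 g := rfl

theorem rop_trans_comm (u v : K) {a b : ℕ ⊕ ℕ} {n k : ℕ} (ha : a ≠ inl n) (hb : b ≠ inl n)
    (ha' : ∀ c < k, a ≠ inr c) (hb' : ∀ c < k, b ≠ inr c) (g : (ℕ ⊕ ℕ → L) → E) :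
    rop q a b u v (trans q x w n k g) = trans q x w n k (rop q a b u v g) := by
  induction k generalizing g with
  | zero => rfl
  | succ k ih =>
    rw [trans_succ, ih (fun c hc => ha' c (hc.trans k.lt_succ_self))
      (fun c hc => hb' c (hc.trans k.lt_succ_self)), trans_succ, rbar_eq, rbar_eq, map_smul,
      rop_comm q _ _ _ _ (ha' k k.lt_succ_self) ha (hb' k k.lt_succ_self) hb]

theorem rbar_trans_comm {a b n k : ℕ} (hbn : b ≠ n) (hak : k ≤ a) (g : (ℕ ⊕ ℕ → L) → E) :
    rbar q x w a b (trans q x w n k g) = trans q x w n k (rbar q x w a b g) := by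
  rw [rbar_eq, rop_trans_comm, ← map_smul, ← rbar_eq]
  · simp
  · simpa using hbn
  · intro c hc h
    have := inr.inj h
    omega
  · simp

theorem trans_mul_right {n k : ℕ} (g : (ℕ ⊕ ℕ → L) → E) {f : (ℕ ⊕ ℕ → L) → E} {s : Set (ℕ ⊕ ℕ)}
    (hf : DependsOn f s) (hn : inl n ∉ s) (hk : ∀ c < k, inr c ∉ s) :
    trans q x w n k (g * f) = trans q x w n k g * f := by
  induction k generalizing g with
  | zero => rfl
  | succ k ih =>
    rw [trans_succ, trans_succ, ← ih _ fun c hc => hk c (hc.trans k.lt_succ_self), rbar_eq, rop,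
      exchange_mul_right _ _ _ hf (hk k k.lt_succ_self) hn, ← smul_mul_assoc]
    rfl

theorem dependsOn_trans {n k : ℕ} {g : (ℕ ⊕ ℕ → L) → E} {s : Set (ℕ ⊕ ℕ)}
    (hg : DependsOn g s) (hn : inl n ∈ s) (hk : ∀ c < k, inr c ∈ s) :
    DependsOn (trans q x w n k g) s := by
  induction k generalizing g with
  | zero => exact hg
  | succ k ih =>
    rw [trans_succ]
    refine ih ?_ fun c hc => hk c (hc.trans k.lt_succ_self)
    have := dependsOn_exchange (diagCoeff q (x k n) 1) (swapCoeff q (x k n) 1) hg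
      (hk k k.lt_succ_self) hn
    intro i j h
    rw [rbar_eq, Pi.smul_apply, Pi.smul_apply, rop, this h]

theorem brk_succ (m : ℕ) :
    brk q x w S (m + 1) = trans q x w m m (brk q x w S m * entry S m) := rfl

theorem dependsOn_brk (m : ℕ) : DependsOn (brk q x w S m) (before m) := by
  induction m with
  | zero => exact fun i j _ => rfl
  | succ m ih =>
    rw [brk_succ]
    refine dependsOn_trans (dependsOn_mul (fun i j h => ih fun n hn => h n ?_)
      fun i j h => dependsOn_entry S m fun n hn => h n ?_) ?_ ?_
    · rcases n with n | n <;> simp at hn ⊢ <;> omega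
    · rcases n with n | n <;> simp at hn ⊢ <;> omega
    · simp
    · intro c hc
      simp
      omega

/-- Each step is the Yang–Baxter equation at the column of c and the rows of a and b, with `hx` as
its compatibility condition. -/
theorem rop_trans_trans (hq : q ≠ 0) {a b k : ℕ} (hab : a ≠ b) (U V : K)
    (hx : ∀ c < k, x c a * U = V * x c b) (g : (ℕ ⊕ ℕ → L) → E) :
    rop q (inl a) (inl b) U V (trans q x w b k (trans q x w a k g)) =
      trans q x w a k (trans q x w b k (rop q (inl a) (inl b) U V g)) := by
  induction k generalizing g with
  | zero => rfl
  | succ k ih =>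
    rw [trans_succ, trans_succ, rbar_trans_comm hab.symm le_rfl,
      ih fun c hc => hx c (hc.trans k.lt_succ_self), trans_succ, trans_succ,
      rbar_trans_comm hab le_rfl]
    congr 2
    simp only [rbar_eq, map_smul]
    rw [yang_baxter hq (by simp) (by simp) (by simpa using hab) _ _ _ _ _ _
      (by simpa using hx k k.lt_succ_self), smul_comm]

/-- The row operator passes all operators that link a and b to earlier factors and meets S_a
R̄^t_{ab} S_b alone, where the reflection relation can be applied. -/
theorem rop_trans_brk (hq : q ≠ 0) {a b : ℕ} (hab : a < b) (U V : K)
    (hx : ∀ c < a, x c a * U = V * x c b) :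
    rop q (inl a) (inl b) U V
        (trans q x w b (a + 1) (brk q x w S (a + 1) * entry S b)) =
      trans q x w a a (trans q x w b a (brk q x w S a *
        rop q (inl a) (inl b) U V (rbar q x w a b (entry S a * entry S b)))) := by
  have h₁ : rbar q x w a b (brk q x w S (a + 1) * entry S b) =
      trans q x w a a (brk q x w S a * rbar q x w a b (entry S a * entry S b)) := by
    rw [brk_succ, ← trans_mul_right _ (dependsOn_entry S b), rbar_trans_comm hab.ne' le_rfl,
      mul_assoc, rbar_eq, rop, exchange_mul_left _ _ _ (dependsOn_brk a), ← mul_smul_comm]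
    · rfl
    · simp
    · simpa using hab.le
    · simpa using hab.ne
    · intro c hc
      simp
      omega
  rw [trans_succ, h₁, rop_trans_trans hq hab.ne _ _ hx]
  congr 2
  rw [rop, exchange_mul_left _ _ _ (dependsOn_brk a)]
  · simp
  · simpa using hab.le

/-- Yang–Baxter moves the column operator out past the two operators R̄^t joining k and k+1 to the
factor m; the others act elsewhere. Only membership in the image of the operator is recorded, since
antisymmetry needs no more. -/
theorem exists_trans_rop (hq : q ≠ 0) {k m j : ℕ} (U V : K)
    (hx : U * x k m = V * x (k + 1) m) (hj : k + 2 ≤ j) (g : (ℕ ⊕ ℕ → L) → E) :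
    ∃ g' : (ℕ ⊕ ℕ → L) → E, trans q x w m j (rop q (inr (k + 1)) (inr k) U V g) =
      rop q (inr (k + 1)) (inr k) U V g' := by
  induction j, hj using Nat.le_induction generalizing g with
  | base =>
    rw [trans_succ, trans_succ]
    simp only [rbar_eq, map_smul]
    rw [← yang_baxter hq (by simp) (by simp) (by simp) _ _ _ _ _ _
      (by simpa using hx), ← rop_trans_comm, ← map_smul, ← map_smul]
    · exact ⟨_, rfl⟩
    · simp
    · simp
    · intro c hc h
      have := inr.inj h
      omega
    · intro c hc h
      have := inr.inj h
      omega
  | succ j hj ih =>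
    rw [trans_succ, rbar_eq, rop_comm, ← map_smul]
    · exact ih _
    · intro h
      have := inr.inj h
      omega
    · intro h
      have := inr.inj h
      omega
    · simp
    · simp

/-- Fusion. The row operator reaches the neighbours k and k+1 by Yang–Baxter, becomes a column
operator by the reflection relation `hS`, and then survives the multiplication by every later
factor. -/
theorem exists_rop_brk (hq : q ≠ 0) {k : ℕ} (U V : K) (hx : ∀ c < k, x c k * U = V * x c (k + 1))
    (hx' : ∀ b, k + 1 < b → U * x k b = V * x (k + 1) b) {H : (ℕ ⊕ ℕ → L) → E}
    (hS : rop q (inl k) (inl (k + 1)) U V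
      (rbar q x w k (k + 1) (entry S k * entry S (k + 1))) = rop q (inr (k + 1)) (inr k) U V H)
    {m : ℕ} (hm : k + 2 ≤ m) :
    ∃ g : (ℕ ⊕ ℕ → L) → E, rop q (inl k) (inl (k + 1)) U V (brk q x w S m) =
      rop q (inr (k + 1)) (inr k) U V g := by
  induction m, hm using Nat.le_induction with
  | base =>
    rw [brk_succ, rop_trans_brk hq k.lt_succ_self U V hx, hS, rop,
      ← exchange_mul_left _ _ _ (dependsOn_brk k), ← rop, ← rop_trans_comm, ← rop_trans_comm]
    · exact ⟨_, rfl⟩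
    all_goals first
      | (intro c hc h
         have := inr.inj h
         omega)
      | simp
  | succ m hm ih =>
    obtain ⟨g, hg⟩ := ih
    rw [brk_succ, rop_trans_comm, rop, exchange_mul_right _ _ _ (dependsOn_entry S m), ← rop, hg,
      rop, ← exchange_mul_right _ _ _ (dependsOn_entry S m), ← rop]
    · exact exists_trans_rop hq U V (hx' m hm) hm _
    all_goals first
      | simp; done
      | (simp
         omega)

/-- The product `R_{0n} ⋯ R_{m-1,n}` acting on rows. -/
noncomputable def rowOps (q : ℂ) (U V : ℕ → K) (n : ℕ) :
    ℕ → ((ℕ ⊕ ℕ → L) → E) →ₗ[K] ((ℕ ⊕ ℕ → L) → E)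
  | 0 => LinearMap.id
  | m + 1 => rowOps q U V n m ∘ₗ rop q (inl m) (inl n) (U m) (V m)

/-- The product `R_{0n} ⋯ R_{m-1,n}` acting on columns. -/
noncomputable def colOps (q : ℂ) (U V : ℕ → K) (n : ℕ) :
    ℕ → ((ℕ ⊕ ℕ → L) → E) →ₗ[K] ((ℕ ⊕ ℕ → L) → E)
  | 0 => LinearMap.id
  | m + 1 => rop q (inr n) (inr m) (U m) (V m) ∘ₗ colOps q U V n m

/-- The product `R̄^t_{0n} ⋯ R̄^t_{m-1,n}` placed between the `n`-th matrix and the ones before. -/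
noncomputable def leftTrans (q : ℂ) (x w : ℕ → ℕ → K) (n : ℕ) :
    ℕ → ((ℕ ⊕ ℕ → L) → E) →ₗ[K] ((ℕ ⊕ ℕ → L) → E)
  | 0 => LinearMap.id
  | m + 1 => (w m n • rop q (inr n) (inl m) (x m n) 1) ∘ₗ leftTrans q x w n m

variable {U V : ℕ → K}

theorem rop_rowOps_comm (u v : K) {a b : ℕ ⊕ ℕ} {n m : ℕ} (ha : a ≠ inl n) (hb : b ≠ inl n)
    (ha' : ∀ c < m, a ≠ inl c) (hb' : ∀ c < m, b ≠ inl c) (g : (ℕ ⊕ ℕ → L) → E) :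
    rop q a b u v (rowOps q U V n m g) = rowOps q U V n m (rop q a b u v g) := by
  induction m generalizing g with
  | zero => rfl
  | succ m ih =>
    rw [rowOps, LinearMap.comp_apply, ih (fun c hc => ha' c (hc.trans m.lt_succ_self))
      (fun c hc => hb' c (hc.trans m.lt_succ_self)), LinearMap.comp_apply,
      rop_comm q _ _ _ _ (ha' m m.lt_succ_self) ha (hb' m m.lt_succ_self) hb]

theorem trans_rowOps_comm {n b m k : ℕ} (hbn : b ≠ n) (hm : m ≤ b) (g : (ℕ ⊕ ℕ → L) → E) :
    trans q x w b k (rowOps q U V n m g) = rowOps q U V n m (trans q x w b k g) := by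
  induction k generalizing g with
  | zero => rfl
  | succ k ih =>
    rw [trans_succ, trans_succ, ← ih, rbar_eq, rbar_eq, rop_rowOps_comm, map_smul (rowOps _ _ _ _ _)]
    · simp
    · simpa using hbn
    · simp
    · intro c hc h
      have := inl.inj h
      omega

theorem rop_colOps_comm (u v : K) {a b : ℕ ⊕ ℕ} {n m : ℕ} (ha : a ≠ inr n) (hb : b ≠ inr n)
    (ha' : ∀ c < m, a ≠ inr c) (hb' : ∀ c < m, b ≠ inr c) (g : (ℕ ⊕ ℕ → L) → E) :
    rop q a b u v (colOps q U V n m g) = colOps q U V n m (rop q a b u v g) := by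
  induction m generalizing g with
  | zero => rfl
  | succ m ih =>
    rw [colOps, LinearMap.comp_apply, LinearMap.comp_apply,
      rop_comm q _ _ _ _ ha (ha' m m.lt_succ_self) hb (hb' m m.lt_succ_self),
      ih (fun c hc => ha' c (hc.trans m.lt_succ_self))
      (fun c hc => hb' c (hc.trans m.lt_succ_self))]

theorem rop_leftTrans_comm (u v : K) {a b : ℕ ⊕ ℕ} {n m : ℕ} (ha : a ≠ inr n) (hb : b ≠ inr n)
    (ha' : ∀ c < m, a ≠ inl c) (hb' : ∀ c < m, b ≠ inl c) (g : (ℕ ⊕ ℕ → L) → E) :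
    rop q a b u v (leftTrans q x w n m g) = leftTrans q x w n m (rop q a b u v g) := by
  induction m generalizing g with
  | zero => rfl
  | succ m ih =>
    rw [leftTrans, LinearMap.comp_apply, LinearMap.comp_apply, LinearMap.smul_apply, map_smul,
      rop_comm q _ _ _ _ ha (ha' m m.lt_succ_self) hb (hb' m m.lt_succ_self),
      ih (fun c hc => ha' c (hc.trans m.lt_succ_self))
      (fun c hc => hb' c (hc.trans m.lt_succ_self))]
    rfl

theorem trans_leftTrans_comm {n b m k : ℕ} (hk : k ≤ n) (hm : m ≤ b) (g : (ℕ ⊕ ℕ → L) → E) :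
    trans q x w b k (leftTrans q x w n m g) = leftTrans q x w n m (trans q x w b k g) := by
  induction k generalizing g with
  | zero => rfl
  | succ k ih =>
    rw [trans_succ, trans_succ, ← ih (by omega), rbar_eq, rbar_eq, rop_leftTrans_comm,
      map_smul (leftTrans _ _ _ _ _)]
    · intro h
      have := inr.inj h
      omega
    · simp
    · simp
    · intro c hc h
      have := inl.inj h
      omega

theorem rowOps_mul_right {n m : ℕ} (g : (ℕ ⊕ ℕ → L) → E) {f : (ℕ ⊕ ℕ → L) → E} {s : Set (ℕ ⊕ ℕ)}
    (hf : DependsOn f s) (hn : inl n ∉ s) (hm : ∀ c < m, inl c ∉ s) :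
    rowOps q U V n m (g * f) = rowOps q U V n m g * f := by
  induction m generalizing g with
  | zero => rfl
  | succ m ih =>
    rw [rowOps, LinearMap.comp_apply, LinearMap.comp_apply,
      ← ih _ fun c hc => hm c (hc.trans m.lt_succ_self), rop,
      exchange_mul_right _ _ _ hf (hm m m.lt_succ_self) hn]

theorem colOps_mul_right {n m : ℕ} (g : (ℕ ⊕ ℕ → L) → E) {f : (ℕ ⊕ ℕ → L) → E} {s : Set (ℕ ⊕ ℕ)}
    (hf : DependsOn f s) (hn : inr n ∉ s) (hm : ∀ c < m, inr c ∉ s) :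
    colOps q U V n m (g * f) = colOps q U V n m g * f := by
  induction m generalizing g with
  | zero => rfl
  | succ m ih =>
    rw [colOps, LinearMap.comp_apply, LinearMap.comp_apply,
      ih _ fun c hc => hm c (hc.trans m.lt_succ_self), rop,
      exchange_mul_right _ _ _ hf hn (hm m m.lt_succ_self)]

theorem leftTrans_mul_right {n m : ℕ} (g : (ℕ ⊕ ℕ → L) → E) {f : (ℕ ⊕ ℕ → L) → E}
    {s : Set (ℕ ⊕ ℕ)} (hf : DependsOn f s) (hn : inr n ∉ s) (hm : ∀ c < m, inl c ∉ s) :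
    leftTrans q x w n m (g * f) = leftTrans q x w n m g * f := by
  induction m generalizing g with
  | zero => rfl
  | succ m ih =>
    rw [leftTrans, LinearMap.comp_apply, LinearMap.comp_apply,
      ih _ fun c hc => hm c (hc.trans m.lt_succ_self), rop, LinearMap.smul_apply,
      exchange_mul_right _ _ _ hf hn (hm m m.lt_succ_self), ← smul_mul_assoc]
    rfl

theorem trans_mul_left {n k : ℕ} {f : (ℕ ⊕ ℕ → L) → E} (g : (ℕ ⊕ ℕ → L) → E) {s : Set (ℕ ⊕ ℕ)}
    (hf : DependsOn f s) (hn : inl n ∉ s) (hk : ∀ c < k, inr c ∉ s) :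
    trans q x w n k (f * g) = f * trans q x w n k g := by
  induction k generalizing g with
  | zero => rfl
  | succ k ih =>
    rw [trans_succ, trans_succ, ← ih _ fun c hc => hk c (hc.trans k.lt_succ_self), rbar_eq, rop,
      exchange_mul_left _ _ _ hf (hk k k.lt_succ_self) hn, ← mul_smul_comm]
    rfl

theorem trans_colOps (hq : q ≠ 0) {n m k : ℕ} (hmn : m < n) (hk : k ≤ m)
    (hx : ∀ c < k, U c * x c m = V c * x m n) (g : (ℕ ⊕ ℕ → L) → E) :
    trans q x w m k (rop q (inr n) (inl m) (x m n) 1 (colOps q U V n k g)) =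
      colOps q U V n k (rop q (inr n) (inl m) (x m n) 1 (trans q x w m k g)) := by
  induction k generalizing g with
  | zero => rfl
  | succ k ih =>
    have hkn : k ≠ n := by omega
    rw [trans_succ, trans_succ, colOps, LinearMap.comp_apply, LinearMap.comp_apply,
      ← ih (by omega) fun c hc => hx c (hc.trans k.lt_succ_self), rbar_eq, rbar_eq,
      ← yang_baxter hq (by simpa using hkn.symm) (by simp) (by simp) _ _ _ _ _ _
      (by simpa using hx k k.lt_succ_self), rop_trans_comm, rop_colOps_comm]
    · simp only [map_smul]
    all_goals first
      | (intro c hc h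
         first
         | (have := inr.inj h
            omega)
         | (have := inl.inj h
            omega)
         | simp at h)
      | (simp
         try omega)

/-- The matrix S_n is carried from the right of ⟨S_0, …, S_{m-1}⟩ to its left. Each step applies the
reflection relation to one pair and collects the R-matrices on the outside by Yang–Baxter.
Antisymmetrizing this identity yields the centrality of the Sklyanin determinant. -/
theorem rowOps_trans (hq : q ≠ 0) {n m : ℕ} (hm : m ≤ n)
    (hx : ∀ a < n, ∀ c < a, x c a * U a = V a * x c n)
    (hx' : ∀ a < n, ∀ c < a, U c * x c a = V c * x a n)
    (hS : ∀ a < n, rop q (inl a) (inl n) (U a) (V a) (rbar q x w a n (entry S a * entry S n)) =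
      rop q (inr n) (inr a) (U a) (V a)
        (w a n • rop q (inr n) (inl a) (x a n) 1 (entry S n * entry S a))) :
    rowOps q U V n m (trans q x w n m (brk q x w S m * entry S n)) =
      colOps q U V n m (leftTrans q x w n m (entry S n * brk q x w S m)) := by
  induction m with
  | zero =>
    change brk q x w S 0 * entry S n = entry S n * brk q x w S 0
    rw [brk, one_mul, mul_one]
  | succ m ih =>
    have hmn : m < n := hm
    have h₁ : brk q x w S m * rop q (inr n) (inr m) (U m) (V m)
        (w m n • rop q (inr n) (inl m) (x m n) 1 (entry S n * entry S m)) =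
        rop q (inr n) (inr m) (U m) (V m)
        (w m n • rop q (inr n) (inl m) (x m n) 1 (brk q x w S m * entry S n * entry S m)) := by
      rw [mul_assoc, rop, rop, exchange_mul_left _ _ _ (dependsOn_brk m), ← mul_smul_comm,
        exchange_mul_left _ _ _ (dependsOn_brk m)]
      all_goals simp
      all_goals omega
    -- Once the pair (m, n) is reflected, the expression inside contains the left-hand side for m,
    -- to which the induction hypothesis applies.
    have h₂ : rowOps q U V n (m + 1) (trans q x w n (m + 1) (brk q x w S (m + 1) * entry S n)) =
        rop q (inr n) (inr m) (U m) (V m) (w m n • trans q x w m m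
        (rop q (inr n) (inl m) (x m n) 1
          (rowOps q U V n m (trans q x w n m (brk q x w S m * entry S n)) * entry S m))) := by
      rw [rowOps, LinearMap.comp_apply, rop_trans_brk hq hmn _ _ (hx m hmn), hS m hmn, h₁]
      simp only [map_smul]
      congr 1
      rw [← rop_trans_comm (n := n), ← rop_trans_comm (n := m) (a := inr n) (b := inr m),
        ← rop_trans_comm (n := n), trans_mul_right _ (dependsOn_entry S m), ← rop_rowOps_comm,
        ← trans_rowOps_comm hmn.ne le_rfl, ← rop_rowOps_comm,
        rowOps_mul_right _ (dependsOn_entry S m)]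
      all_goals first
        | (intro c hc
           simp
           omega)
        | (simp
           try omega)
    have h₃ : leftTrans q x w n m (entry S n * brk q x w S m) * entry S m = 
        leftTrans q x w n m (entry S n * (brk q x w S m * entry S m)) := by
      rw [← leftTrans_mul_right _ (dependsOn_entry S m), mul_assoc]
      all_goals first
        | (intro c hc
           simp
           omega)
        | (simp
           try omega)
    rw [h₂, ih hmn.le, ← colOps_mul_right _ (dependsOn_entry S m), h₃,
      trans_colOps hq hmn le_rfl (hx' m hmn), trans_leftTrans_comm hmn.le le_rfl, 
      trans_mul_left _ (dependsOn_entry S n), colOps, leftTrans, LinearMap.comp_apply,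
      LinearMap.comp_apply, LinearMap.smul_apply, map_smul (colOps _ _ _ _ _), brk_succ]
    all_goals first
      | (intro c hc
         simp
         omega)
      | (simp
         try omega)

end Bracket
end TwistedYangian

namespace TwistedYangian

/-! ### Row antisymmetrization and the q-antisymmetry of minors in their columns -/

section Minor

open Sum

variable {N : ℕ} {K E : Type*} [CommRing K] [Algebra ℂ K] [Ring E] [Algebra K E]

/-- The first `m` terms of the sequence `R`, permuted by `σ`. -/
def permute {L : Type*} {m : ℕ} (R : ℕ → L) (σ : Equiv.Perm (Fin m)) : ℕ → L := fun n =>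
  if h : n < m then R (σ ⟨n, h⟩) else R n

theorem permute_fin {L : Type*} {m : ℕ} (R : ℕ → L) (σ : Equiv.Perm (Fin m)) :
    (fun a : Fin m => permute R σ a) = (fun a : Fin m => R a) ∘ σ := by
  funext a
  simp [permute]

/-- The number of inversions among the first `m` terms of a sequence. -/
def seqInv (m : ℕ) (R : ℕ → Fin N) : ℕ := inversions fun a : Fin m => R a

/-- The coefficient of `h(R ∘ σ)` in the q-antisymmetrization of `h`. -/
noncomputable def altCoeff (q : ℂ) {m : ℕ} (R : ℕ → Fin N) (σ : Equiv.Perm (Fin m)) : ℂ :=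
  ((Equiv.Perm.sign σ : ℤ) : ℂ) * (q ^ seqInv m (permute R σ))⁻¹

/-- The q-antisymmetrization of `h` over the first `m` rows. -/
noncomputable def rowAlt (K : Type*) [CommRing K] [Algebra ℂ K] [Algebra K E] (q : ℂ) (m : ℕ)
    (h : (ℕ ⊕ ℕ → Fin N) → E) (R C : ℕ → Fin N) : E :=
  ∑ σ : Equiv.Perm (Fin m), algebraMap ℂ K (altCoeff q R σ) • h (Sum.elim (permute R σ) C)

/-- The coefficient of the q-permutation operator. -/
noncomputable def permCoeff (q : ℂ) (a b : Fin N) : ℂ := if a = b then 1 else if b < a then q else q⁻¹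

/-- At the ratio q² of its arguments the R-matrix degenerates to (q² − 1)(1 − P^q). This is the link
between R-matrices and q-antisymmetry. -/
theorem rop_sq {ι : Type*} [DecidableEq ι] {q : ℂ} (hq : q ≠ 0) (a b : ι)
    (g : (ι → Fin N) → E) (i : ι → Fin N) :
    rop q a b (algebraMap ℂ K (q ^ 2)) 1 g i = algebraMap ℂ K (q ^ 2 - 1) •
      (g i - algebraMap ℂ K (permCoeff q (i a) (i b)) • g (i ∘ Equiv.swap a b)) := by
  rw [rop_apply, diagCoeff, swapCoeff, permCoeff]
  have h1 : q⁻¹ * q ^ 2 = q := by field_simp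
  have h2 : (q⁻¹ - q) * q ^ 2 = - ((q ^ 2 - 1) * q) := by
    field_simp
    ring
  have h3 : (q⁻¹ - q) = - ((q ^ 2 - 1) * q⁻¹) := by
    field_simp
    ring
  rcases lt_trichotomy (i a) (i b) with h | h | h
  · simp only [h.ne, h.not_gt, h, if_true, if_false, mul_one, ← map_sub, ← map_mul, h3, smul_sub,
      smul_smul]
    rw [← map_one (algebraMap ℂ K), ← map_sub, map_neg]
    module
  · have hi : i ∘ Equiv.swap a b = i := by
      funext n
      rw [Function.comp_apply, Equiv.swap_apply_def]
      split_ifs <;> simp_all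
    simp only [h, lt_irrefl, if_true, if_false, mul_one, ← map_sub, ← map_mul, h1, hi]
    simp
  · simp only [h.ne', h.not_gt, h, if_true, if_false, mul_one, ← map_sub, ← map_mul, h2, smul_sub,
      smul_smul]
    rw [← map_one (algebraMap ℂ K), ← map_sub, map_neg]
    module

theorem permute_mul_swap {L : Type*} {m k : ℕ} (hk : k + 1 < m) (R : ℕ → L)
    (σ : Equiv.Perm (Fin m)) :
    permute R (σ * Equiv.swap ⟨k, by omega⟩ ⟨k + 1, hk⟩) = permute R σ ∘ Equiv.swap k (k + 1) := by
  funext n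
  by_cases hn : n < m
  · have h : Equiv.swap k (k + 1) n < m := by
      rw [Equiv.swap_apply_def]
      split_ifs <;> omega
    rw [Function.comp_apply, permute, permute, dif_pos hn, dif_pos h, Equiv.Perm.mul_apply]
    congr 3
    rw [Equiv.swap_apply_def, Fin.ext_iff]
    simp only [Fin.ext_iff, Equiv.swap_apply_def]
    split_ifs <;> simp
  · have h : Equiv.swap k (k + 1) n = n := Equiv.swap_apply_of_ne_of_ne (by omega) (by omega)
    rw [Function.comp_apply, permute, h, permute, dif_neg hn, dif_neg hn]

theorem seqInv_swap {m k : ℕ} (hk : k + 1 < m) (R : ℕ → Fin N) :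
    seqInv m R + (if R k < R (k + 1) then 1 else 0) =
      seqInv m (R ∘ Equiv.swap k (k + 1)) + if R (k + 1) < R k then 1 else 0 := by
  have h := inversions_swap (fun a : Fin m => R a) (a := ⟨k, by omega⟩) (b := ⟨k + 1, hk⟩) rfl
  have h' : (fun a : Fin m => (R ∘ Equiv.swap k (k + 1)) a) =
      (fun a : Fin m => R a) ∘ Equiv.swap (⟨k, by omega⟩ : Fin m) ⟨k + 1, hk⟩ := by
    funext a
    simp only [Function.comp_apply, Equiv.swap_apply_def, Fin.ext_iff]
    split_ifs <;> rfl
  rw [seqInv, seqInv, h', h]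

theorem elim_comp_swap_inl {L : Type*} (R C : ℕ → L) (a b : ℕ) :
    Sum.elim R C ∘ Equiv.swap (inl a) (inl b) = Sum.elim (R ∘ Equiv.swap a b) C := by
  funext n
  rcases n with n | n <;> simp only [Function.comp_apply, Equiv.swap_apply_def] <;> simp
  split_ifs <;> simp_all [Equiv.swap_apply_def]

theorem elim_comp_swap_inr {L : Type*} (R C : ℕ → L) (a b : ℕ) :
    Sum.elim R C ∘ Equiv.swap (inr a) (inr b) = Sum.elim R (C ∘ Equiv.swap a b) := by
  funext n
  rcases n with n | n <;> simp only [Function.comp_apply, Equiv.swap_apply_def] <;> simp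
  split_ifs <;> simp_all [Equiv.swap_apply_def]

/-- Reindexing the sum by σ ↦ σ·(k k+1) shows that P^q acts as −1 after antisymmetrization, so 1 −
P^q acts as 2. The powers of q match by the change of the inversion number under an adjacent swap.
-/
theorem rowAlt_rop_row {q : ℂ} (hq : q ≠ 0) {m k : ℕ} (hk : k + 1 < m)
    (h : (ℕ ⊕ ℕ → Fin N) → E) (R C : ℕ → Fin N) :
    rowAlt K q m (rop q (inl k) (inl (k + 1)) (algebraMap ℂ K (q ^ 2)) 1 h) R C =
      algebraMap ℂ K (2 * (q ^ 2 - 1)) • rowAlt K q m h R C := by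
  have key : ∑ σ : Equiv.Perm (Fin m), algebraMap ℂ K (altCoeff q R σ) •
      algebraMap ℂ K (permCoeff q (permute R σ k) (permute R σ (k + 1))) •
        h (Sum.elim (permute R σ ∘ Equiv.swap k (k + 1)) C) = - rowAlt K q m h R C := by
    rw [rowAlt, ← Finset.sum_neg_distrib]
    refine Fintype.sum_equiv (Equiv.mulRight (Equiv.swap ⟨k, by omega⟩ ⟨k + 1, hk⟩)) _ _ fun σ => ?_
    rw [Equiv.coe_mulRight, permute_mul_swap hk, smul_smul, ← map_mul, ← neg_smul, ← map_neg]
    congr 2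
    rw [altCoeff, altCoeff, permute_mul_swap hk, Equiv.Perm.sign_mul,
      Equiv.Perm.sign_swap (by simp [Fin.ext_iff])]
    have hs := seqInv_swap hk (permute R σ)
    rw [permCoeff]
    generalize permute R σ k = x at *
    generalize permute R σ (k + 1) = y at *
    rcases lt_trichotomy x y with h | h | h
    · simp only [h, h.ne, h.not_gt, if_true, if_false, add_zero] at hs ⊢
      rw [← hs, pow_succ]
      push_cast
      rw [mul_inv]
      ring
    · simp only [h, lt_irrefl, if_true, if_false, add_zero] at hs ⊢
      rw [← hs]
      push_cast
      ring
    · simp only [h, h.ne', h.not_gt, if_true, if_false, add_zero] at hs ⊢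
      rw [hs, pow_succ]
      push_cast
      rw [mul_inv]
      field_simp
  simp only [rowAlt, rop_sq hq, elim_comp_swap_inl, Sum.elim_inl, smul_sub, Finset.sum_sub_distrib]
  simp only [smul_comm (algebraMap ℂ K (altCoeff _ _ _)) (algebraMap ℂ K (q ^ 2 - 1)),
    ← Finset.smul_sum]
  rw [key, rowAlt, map_mul, map_ofNat]
  module

theorem rowAlt_rop_column {q : ℂ} (hq : q ≠ 0) {m a b : ℕ}
    (h : (ℕ ⊕ ℕ → Fin N) → E) (R C : ℕ → Fin N) :
    rowAlt K q m (rop q (inr a) (inr b) (algebraMap ℂ K (q ^ 2)) 1 h) R C =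
      rop q a b (algebraMap ℂ K (q ^ 2)) 1 (rowAlt K q m h R) C := by
  simp only [rowAlt, rop_sq hq, elim_comp_swap_inr, Sum.elim_inr, smul_sub, Finset.sum_sub_distrib,
    Finset.smul_sum]
  simp only [smul_comm (algebraMap ℂ K (altCoeff _ _ _))]

/-- The function `g` is q-antisymmetric in the indices `p 0, …, p (m-1)`. -/
def AntiOn (K : Type*) [CommRing K] [Algebra ℂ K] [Algebra K E] {ι : Type*} [DecidableEq ι] (q : ℂ)
    (p : ℕ → ι) (m : ℕ) (g : (ι → Fin N) → E) : Prop :=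
  ∀ k, k + 1 < m → ∀ i, (i (p k) = i (p (k + 1)) → g i = 0) ∧ (i (p k) < i (p (k + 1)) →
    g (i ∘ Equiv.swap (p k) (p (k + 1))) = - algebraMap ℂ K q⁻¹ • g i)

theorem sq_sub_one_ne_zero {q : ℂ} (hq : ∀ k : ℕ, 0 < k → q ^ k ≠ 1) : q ^ 2 - 1 ≠ 0 :=
  sub_ne_zero.2 (hq 2 two_pos)

theorem algebraMap_smul_left_injective {c : ℂ} (hc : c ≠ 0) {y z : E}
    (h : algebraMap ℂ K c • y = algebraMap ℂ K c • z) : y = z := by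
  have := congrArg (algebraMap ℂ K c⁻¹ • ·) h
  simpa only [smul_smul, ← map_mul, inv_mul_cancel₀ hc, map_one, one_smul] using this

/-- Since (P^q)² = 1, everything in the image of 1 − P^q is q-antisymmetric. -/
theorem anti_of_rop {ι : Type*} [DecidableEq ι] {q : ℂ} (hq0 : q ≠ 0)
    {a b : ι} {g g' : (ι → Fin N) → E} {c : ℂ} (hc : c ≠ 0)
    (h : algebraMap ℂ K c • g = rop q b a (algebraMap ℂ K (q ^ 2)) 1 g') (i : ι → Fin N) :
    (i a = i b → g i = 0) ∧
      (i a < i b → g (i ∘ Equiv.swap a b) = - algebraMap ℂ K q⁻¹ • g i) := by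
  have hi := fun i => congrFun h i
  simp only [Pi.smul_apply, rop_sq hq0, permCoeff, Equiv.swap_comm b a] at hi
  constructor
  · intro hab
    apply algebraMap_smul_left_injective (K := K) hc
    have hs : i ∘ Equiv.swap a b = i := by
      funext n
      rw [Function.comp_apply, Equiv.swap_apply_def]
      split_ifs <;> simp_all
    rw [hi, if_pos hab.symm, hs, map_one, one_smul, sub_self, smul_zero, smul_zero]
  · intro hab
    apply algebraMap_smul_left_injective (K := K) hc
    rw [neg_smul, smul_neg, smul_comm, hi, hi]
    have hs : (i ∘ Equiv.swap a b) ∘ Equiv.swap a b = i := by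
      funext n
      simp
    simp only [hs, Function.comp_apply, Equiv.swap_apply_left, Equiv.swap_apply_right, hab, hab.ne,
      hab.ne', hab.not_gt, if_true, if_false]
    have : algebraMap ℂ K q⁻¹ * algebraMap ℂ K q = 1 := by
      rw [← map_mul, inv_mul_cancel₀ hq0, map_one]
    match_scalars <;> grind

/-- The relations between the parameters of `⟨S_0, S_1, …⟩` needed for its antisymmetrization. -/
structure Fusion (q : ℂ) (x w : ℕ → ℕ → K) (S : ℕ → Fin N → Fin N → E) : Prop where
  left : ∀ k, ∀ c < k, x c k * algebraMap ℂ K (q ^ 2) = x c (k + 1)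
  right : ∀ k b, k + 1 < b → algebraMap ℂ K (q ^ 2) * x k b = x (k + 1) b
  refl : ∀ k, ∃ H : (ℕ ⊕ ℕ → Fin N) → E, rop q (inl k) (inl (k + 1)) (algebraMap ℂ K (q ^ 2)) 1
      (rbar q x w k (k + 1) (entry S k * entry S (k + 1))) =
        rop q (inr (k + 1)) (inr k) (algebraMap ℂ K (q ^ 2)) 1 H

variable {q : ℂ} {x w : ℕ → ℕ → K} {S : ℕ → Fin N → Fin N → E}

/-- The Sklyanin minor, divided by a power of `q`. -/
noncomputable def minor (q : ℂ) (x w : ℕ → ℕ → K) (S : ℕ → Fin N → Fin N → E) (m : ℕ)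
    (R C : ℕ → Fin N) : E := rowAlt K q m (brk q x w S m) R C

/-- R(q²,1) on two adjacent rows multiplies the minor by the nonzero number 2(q² − 1), and by fusion
it also equals R(q²,1) applied to the columns of something. -/
theorem antiOn_minor (hq0 : q ≠ 0) (hq : ∀ k : ℕ, 0 < k → q ^ k ≠ 1) (hS : Fusion q x w S) (m : ℕ)
    (R : ℕ → Fin N) : AntiOn K q id m (minor q x w S m R) := by
  intro k hk i
  obtain ⟨H, hH⟩ := hS.refl k
  obtain ⟨g, hg⟩ := exists_rop_brk hq0 _ _
    (fun c hc => (hS.left k c hc).trans (one_mul _).symm)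
    (fun b hb => (hS.right k b hb).trans (one_mul _).symm) hH (m := m) (by omega)
  refine anti_of_rop hq0 (c := 2 * (q ^ 2 - 1)) (mul_ne_zero two_ne_zero (sq_sub_one_ne_zero hq))
    (g' := rowAlt K q m g R) ?_ i
  funext C
  rw [Pi.smul_apply, minor, ← rowAlt_rop_row hq0 hk, hg, rowAlt_rop_column hq0]
  rfl

/-- The factor is −q, 0 or −q⁻¹ according to the order of the two values and does not depend on g.
Antisymmetric functions can thus be transported along chains of adjacent swaps. -/
theorem exists_smul_of_antiOn {ι : Type*} [DecidableEq ι] (hq0 : q ≠ 0) {p : ℕ → ι} {m k : ℕ}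
    (hk : k + 1 < m) (i : ι → Fin N) :
    ∃ c : ℂ, ∀ g : (ι → Fin N) → E, AntiOn K q p m g →
      g i = algebraMap ℂ K c • g (i ∘ Equiv.swap (p k) (p (k + 1))) := by
  rcases lt_trichotomy (i (p k)) (i (p (k + 1))) with h | h | h
  · refine ⟨-q, fun g hg => ?_⟩
    rw [(hg k hk i).2 h, smul_smul, map_neg, neg_mul_neg, ← map_mul, mul_inv_cancel₀ hq0, map_one,
      one_smul]
  · refine ⟨0, fun g hg => ?_⟩
    rw [(hg k hk i).1 h, map_zero, zero_smul]
  · refine ⟨-q⁻¹, fun g hg => ?_⟩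
    have := (hg k hk (i ∘ Equiv.swap (p k) (p (k + 1)))).2 (by simpa using h)
    have hs : (i ∘ Equiv.swap (p k) (p (k + 1))) ∘ Equiv.swap (p k) (p (k + 1)) = i := by
      funext n
      simp
    rw [hs] at this
    rw [this, map_neg]

theorem AntiOn.eq_zero {ι : Type*} [DecidableEq ι] (hq0 : q ≠ 0) {p : ℕ → ι}
    (hp : Function.Injective p) {m : ℕ} {g : (ι → Fin N) → E} (hg : AntiOn K q p m g) {a b : ℕ}
    (hab : a < b) (hb : b < m) {i : ι → Fin N} (hi : i (p a) = i (p b)) : g i = 0 := by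
  induction b, hab using Nat.le_induction generalizing i with
  | base => exact (hg a hb i).1 hi
  | succ b hab ih =>
    obtain ⟨c, hc⟩ := exists_smul_of_antiOn (K := K) (E := E) (p := p) hq0 hb i
    rw [hc g hg, ih (by omega), smul_zero]
    have : p a ≠ p b := hp.ne (by omega)
    have : p a ≠ p (b + 1) := hp.ne (by omega)
    rw [Function.comp_apply, Function.comp_apply, Equiv.swap_apply_of_ne_of_ne ‹_› ‹_›,
      Equiv.swap_apply_left, hi]

end Minor
end TwistedYangian

namespace TwistedYangian

/-! ### Expansion of a minor along its last column -/

section Expansion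

open Sum

variable {K E : Type*} [CommRing K] [Algebra ℂ K] [Ring E] [Algebra K E]

theorem exchange_comp {ι ι' L L' : Type*} [DecidableEq ι] [DecidableEq ι'] {A B : L → L → K}
    {A' B' : L' → L' → K} {a b : ι} {a' b' : ι'} {Ψ : (ι → L) → (ι' → L')} {i : ι → L}
    (hA : A' (Ψ i a') (Ψ i b') = A (i a) (i b)) (hB : B' (Ψ i a') (Ψ i b') = B (i a) (i b))
    (hΨ : Ψ (i ∘ Equiv.swap a b) = Ψ i ∘ Equiv.swap a' b') (g : (ι' → L') → E) :
    exchange A' B' a' b' g (Ψ i) = exchange A B a b (g ∘ Ψ) i := by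
  simp only [exchange_apply, hA, hB, Function.comp_apply, hΨ]

/-- The coefficients of R depend only on the relative order of the two values, so R is compatible
with strictly increasing relabellings and with maps that keep some positions fixed. -/
theorem rop_comp {ι ι' L L' : Type*} [LinearOrder L] [LinearOrder L'] [DecidableEq ι]
    [DecidableEq ι'] (q : ℂ) (u v : K) {a b : ι} {a' b' : ι'} {Ψ : (ι → L) → (ι' → L')} {i : ι → L}
    {e : L → L'} (he : StrictMono e) (ha : Ψ i a' = e (i a)) (hb : Ψ i b' = e (i b))
    (hΨ : Ψ (i ∘ Equiv.swap a b) = Ψ i ∘ Equiv.swap a' b') (g : (ι' → L') → E) :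
    rop q a' b' u v g (Ψ i) = rop q a b u v (g ∘ Ψ) i := by
  refine exchange_comp ?_ ?_ hΨ g
  · simp only [ha, hb, diagCoeff, he.injective.eq_iff]
  · simp only [ha, hb, swapCoeff, he.lt_iff_lt]

theorem elim_update_comp_swap {L : Type*} (ρ : ℕ → L) (j : Option ℕ → L) (m k : ℕ) :
    (Sum.elim (Function.update ρ m ((j ∘ Equiv.swap (some k) none) none))
      ((j ∘ Equiv.swap (some k) none) ∘ some) : ℕ ⊕ ℕ → L) =
      Sum.elim (Function.update ρ m (j none)) (j ∘ some) ∘ Equiv.swap (inr k) (inl m) := by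
  funext n
  rcases n with n | n
  · by_cases hn : n = m
    · subst hn
      simp only [Function.comp_apply, elim_inl, Function.update_self, Equiv.swap_apply_right,
        elim_inr]
    · have : (Equiv.swap (inr k) (inl m)) (inl n) = (inl n : ℕ ⊕ ℕ) :=
        Equiv.swap_apply_of_ne_of_ne (by simp) (by simpa using hn)
      simp only [Function.comp_apply, elim_inl, this, Function.update_of_ne hn]
  · by_cases hn : n = k
    · subst hn
      simp only [Function.comp_apply, elim_inl, Function.update_self, Equiv.swap_apply_left,
        elim_inr]
    · have : (Equiv.swap (inr k) (inl m)) (inr n) = (inr n : ℕ ⊕ ℕ) :=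
        Equiv.swap_apply_of_ne_of_ne (by simpa using hn) (by simp)
      have h' : (Equiv.swap (some k) none) (some n) = some n :=
        Equiv.swap_apply_of_ne_of_ne (by simpa using hn) (by simp)
      simp only [Function.comp_apply, elim_inr, this, h']

/-- The family of indices with value `r` at `none` and `C n` at `some n`. -/
def withAux {L : Type*} (C : ℕ → L) (r : L) : Option ℕ → L := fun o => o.elim r C

/-- The operator given by `R̄^t_{0b} ⋯ R̄^t_{k-1,b}` on functions of the columns `some n` and
of the row `none` of the `b`-th factor. -/
noncomputable def colTrans {L : Type*} [LinearOrder L] (q : ℂ) (y v : ℕ → K) :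
    ℕ → ((Option ℕ → L) → E) →ₗ[K] ((Option ℕ → L) → E)
  | 0 => LinearMap.id
  | k + 1 => colTrans q y v k ∘ₗ (v k • rop q (some k) none (y k) 1)

section ColTrans

variable {L : Type*} [LinearOrder L] {q : ℂ} {y v : ℕ → K}

theorem colTrans_succ (k : ℕ) (g : (Option ℕ → L) → E) :
    colTrans q y v (k + 1) g = colTrans q y v k (v k • rop q (some k) none (y k) 1 g) := rfl

theorem colTrans_congr {k : ℕ} {Q : Set (Option ℕ → L)}
    (hQ : ∀ c < k, ∀ i ∈ Q, i ∘ Equiv.swap (some c) none ∈ Q) {g h : (Option ℕ → L) → E}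
    (hgh : ∀ i ∈ Q, g i = h i) {i : Option ℕ → L} (hi : i ∈ Q) :
    colTrans q y v k g i = colTrans q y v k h i := by
  induction k generalizing g h with
  | zero => exact hgh i hi
  | succ k ih =>
    rw [colTrans_succ, colTrans_succ]
    refine ih (fun c hc => hQ c (hc.trans k.lt_succ_self)) fun j hj => ?_
    rw [Pi.smul_apply, Pi.smul_apply, rop_apply, rop_apply, hgh j hj,
      hgh _ (hQ k k.lt_succ_self j hj)]

theorem colTrans_mul_const (k : ℕ) (g : (Option ℕ → L) → E) (e : E) (i : Option ℕ → L) :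
    colTrans q y v k (fun i => g i * e) i = colTrans q y v k g i * e := by
  induction k generalizing g with
  | zero => rfl
  | succ k ih =>
    rw [colTrans_succ, colTrans_succ, ← ih]
    refine congrArg (fun h => colTrans q _ _ k h i) (funext fun j => ?_)
    simp only [Pi.smul_apply, rop_apply, smul_mul_assoc, add_mul]

theorem colTrans_const_mul (k : ℕ) (g : (Option ℕ → L) → E) (e : E) (i : Option ℕ → L) :
    colTrans q y v k (fun i => e * g i) i = e * colTrans q y v k g i := by
  induction k generalizing g with
  | zero => rfl
  | succ k ih =>
    rw [colTrans_succ, colTrans_succ, ← ih]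
    refine congrArg (fun h => colTrans q _ _ k h i) (funext fun j => ?_)
    simp only [Pi.smul_apply, rop_apply, mul_smul_comm, mul_add]

theorem colTrans_comp {L' : Type*} [LinearOrder L'] {k : ℕ} {Ψ : (Option ℕ → L) → (Option ℕ → L')}
    {e : L → L'} (he : StrictMono e) (hsome : ∀ c < k, ∀ i, Ψ i (some c) = e (i (some c)))
    (hnone : ∀ i, Ψ i none = e (i none))
    (hΨ : ∀ c < k, ∀ i, Ψ (i ∘ Equiv.swap (some c) none) = Ψ i ∘ Equiv.swap (some c) none)
    (g : (Option ℕ → L') → E) (i : Option ℕ → L) :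
    colTrans q y v k g (Ψ i) = colTrans q y v k (g ∘ Ψ) i := by
  induction k generalizing g with
  | zero => rfl
  | succ k ih =>
    rw [colTrans_succ, colTrans_succ, ih (fun c hc => hsome c (hc.trans k.lt_succ_self))
      (fun c hc => hΨ c (hc.trans k.lt_succ_self))]
    refine congrArg (fun h => colTrans q _ _ k h i) (funext fun j => ?_)
    rw [Function.comp_apply, Pi.smul_apply, Pi.smul_apply,
      rop_comp q _ _ he (hsome k k.lt_succ_self j) (hnone j) (hΨ k k.lt_succ_self j)]

theorem dependsOn_colTrans {k : ℕ} {g : (Option ℕ → L) → E} {s : Set (Option ℕ)}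
    (hg : DependsOn g s) (hn : none ∈ s) (hk : ∀ c < k, some c ∈ s) :
    DependsOn (colTrans q y v k g) s := by
  induction k generalizing g with
  | zero => exact hg
  | succ k ih =>
    rw [colTrans_succ]
    refine ih (fun i j h => ?_) fun c hc => hk c (hc.trans k.lt_succ_self)
    have := dependsOn_exchange (diagCoeff q (y k) 1) (swapCoeff q (y k) 1) hg
      (hk k k.lt_succ_self) hn
    rw [Pi.smul_apply, Pi.smul_apply, rop, this h]

/-- The operators R̄^t_{cm} change only columns of earlier factors and the row of the factor m. With
the remaining rows frozen, the latter becomes the auxiliary index `none`. -/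
theorem trans_freeze {x w : ℕ → ℕ → K} {m k : ℕ} (ρ : ℕ → L) (g : (ℕ ⊕ ℕ → L) → E)
    (i : Option ℕ → L) :
    trans q x w m k g (Sum.elim (Function.update ρ m (i none)) (i ∘ some)) =
      colTrans q (fun c => x c m) (fun c => w c m) k
        (fun j => g (Sum.elim (Function.update ρ m (j none)) (j ∘ some))) i := by
  induction k generalizing g with
  | zero => rfl
  | succ k ih =>
    rw [trans_succ, colTrans_succ, ih]
    refine congrArg (fun h => colTrans q _ _ k h i) (funext fun j => ?_)
    rw [rbar_eq, Pi.smul_apply, Pi.smul_apply, rop_comp q (x k m) 1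
      (Ψ := fun j : Option ℕ → L => Sum.elim (Function.update ρ m (j none)) (j ∘ some))
      (a := some k) (b := none) strictMono_id]
    · rfl
    · simp
    · simp
    · exact elim_update_comp_swap ρ j m k

end ColTrans

/-- The sequence `R` without its `p`-th term. -/
def removeAt {L : Type*} (R : ℕ → L) (p : ℕ) : ℕ → L := fun n => if n < p then R n else R (n + 1)

/-- The permutation of `m + 1` letters sending the last one to `p` and acting as `τ` on the places
before it. -/
def insertPerm {m : ℕ} (p : Fin (m + 1)) (τ : Equiv.Perm (Fin m)) : Equiv.Perm (Fin (m + 1)) :=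
  Fin.cycleIcc p (Fin.last m) * finSuccEquivLast.symm.permCongr (Equiv.optionCongr τ)

theorem insertPerm_castSucc {m : ℕ} (p : Fin (m + 1)) (τ : Equiv.Perm (Fin m)) (a : Fin m) :
    insertPerm p τ a.castSucc = p.succAbove (τ a) := by
  rw [insertPerm, Equiv.Perm.mul_apply, ← Fin.cycleIcc_comp_succAbove p _ (Fin.le_last p),
    Function.comp_apply]
  congr 1
  simp

theorem insertPerm_last {m : ℕ} (p : Fin (m + 1)) (τ : Equiv.Perm (Fin m)) :
    insertPerm p τ (Fin.last m) = p := by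
  rw [insertPerm, Equiv.Perm.mul_apply]
  simp [Fin.cycleIcc_of_last (Fin.le_last p)]

theorem sign_insertPerm {m : ℕ} (p : Fin (m + 1)) (τ : Equiv.Perm (Fin m)) :
    Equiv.Perm.sign (insertPerm p τ) = (-1) ^ (m - p.val) * Equiv.Perm.sign τ := by
  rw [insertPerm, Equiv.Perm.sign_mul, Fin.sign_cycleIcc_of_le (Fin.le_last p),
    Equiv.Perm.sign_permCongr, Equiv.optionCongr_sign]
  rfl

theorem insertPerm_bijective (m : ℕ) :
    Function.Bijective fun z : Fin (m + 1) × Equiv.Perm (Fin m) => insertPerm z.1 z.2 := by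
  rw [Fintype.bijective_iff_injective_and_card]
  constructor
  · rintro ⟨p, τ⟩ ⟨p', τ'⟩ h
    have hp : p = p' := by
      rw [← insertPerm_last p τ, ← insertPerm_last p' τ']
      exact congrFun (congrArg _ h) _
    subst hp
    congr 1
    ext a
    have := congrFun (congrArg DFunLike.coe h) a.castSucc
    simp only [insertPerm_castSucc] at this
    rw [Fin.succAbove_right_injective this]
  · simp [Fintype.card_perm, Nat.factorial_succ]

theorem removeAt_val {L : Type*} {m : ℕ} (R : ℕ → L) (p : Fin (m + 1)) (a : Fin m) :
    removeAt R p a = R (p.succAbove a) := by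
  rw [removeAt, Fin.succAbove]
  by_cases h : a.val < p.val
  · have : a.castSucc < p := h
    simp [h, this]
  · have : ¬ a.castSucc < p := h
    simp [h, this]

theorem permute_insertPerm_of_lt {L : Type*} {m : ℕ} (R : ℕ → L) (p : Fin (m + 1))
    (τ : Equiv.Perm (Fin m)) {n : ℕ} (hn : n < m) :
    permute R (insertPerm p τ) n = permute (removeAt R p) τ n := by
  rw [permute, permute, dif_pos hn, dif_pos (by omega), removeAt_val,
    ← insertPerm_castSucc]
  rfl

theorem permute_insertPerm_last {L : Type*} {m : ℕ} (R : ℕ → L) (p : Fin (m + 1))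
    (τ : Equiv.Perm (Fin m)) : permute R (insertPerm p τ) m = R p := by
  rw [permute, dif_pos m.lt_succ_self]
  exact congrArg (fun a : Fin (m + 1) => R a) (insertPerm_last p τ)

variable {N : ℕ}

theorem seqInv_succ (m : ℕ) (R : ℕ → Fin N) :
    seqInv (m + 1) R = seqInv m R + ((Finset.range m).filter fun a => R m < R a).card := by
  simp only [seqInv, inversions, Finset.card_filter, Fintype.sum_prod_type, Fin.sum_univ_castSucc,
    Finset.sum_range, Finset.sum_add_distrib]
  simp [Fin.castSucc_lt_castSucc_iff, Fin.castSucc_lt_last, (Fin.castSucc_lt_last _).not_gt]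

theorem seqInv_congr {m : ℕ} {R R' : ℕ → Fin N} (h : ∀ n < m, R n = R' n) :
    seqInv m R = seqInv m R' := by
  rw [seqInv, seqInv]
  congr 1
  funext a
  exact h a a.2

/-- The coefficients of the expansion of a minor along its last column. -/
noncomputable def expandCoeff (q : ℂ) (m : ℕ) (R : ℕ → Fin N) (p : ℕ) : ℂ :=
  (-1) ^ (m - p) * (q ^ ((Finset.range (m + 1)).filter fun a => R p < R a).card)⁻¹

/-- Putting the p-th row last creates one inversion for every row index exceeding `R p`, and the
cycle that moves p to the end has sign (−1)^{m−p}. Counting over all m + 1 places is harmless, as p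
does not exceed itself. -/
theorem altCoeff_insertPerm {q : ℂ} {m : ℕ} (R : ℕ → Fin N) (p : Fin (m + 1))
    (τ : Equiv.Perm (Fin m)) :
    altCoeff q R (insertPerm p τ) = expandCoeff q m R p * altCoeff q (removeAt R p) τ := by
  have h : seqInv (m + 1) (permute R (insertPerm p τ)) =
      seqInv m (permute (removeAt R p) τ) +
        ((Finset.range (m + 1)).filter fun a => R p < R a).card := by
    rw [seqInv_succ, seqInv_congr fun n hn => permute_insertPerm_of_lt R p τ hn,
      permute_insertPerm_last]
    congr 1
    rw [Finset.card_filter, Finset.card_filter, Finset.sum_range, Finset.sum_range,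
      Fin.sum_univ_succAbove _ p, if_neg (lt_irrefl _), zero_add,
      ← Equiv.sum_comp τ fun a => if R p < R (p.succAbove a) then 1 else 0]
    refine Finset.sum_congr rfl fun a _ => ?_
    rw [permute_insertPerm_of_lt R p τ a.2, permute, dif_pos a.2, removeAt_val]
  rw [altCoeff, altCoeff, expandCoeff, h, sign_insertPerm, pow_add, mul_inv]
  push_cast
  ring

variable {q : ℂ} {x w : ℕ → ℕ → K} {S : ℕ → Fin N → Fin N → E}

/-- The right-hand side of the expansion of a minor along its last column, in which the entries of
the last factor are replaced by `g`. -/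
noncomputable def expansion (q : ℂ) (x w : ℕ → ℕ → K) (S : ℕ → Fin N → Fin N → E) (m : ℕ)
    (R C : ℕ → Fin N) (g : Fin N → E) : E :=
  ∑ p ∈ Finset.range (m + 1), algebraMap ℂ K (expandCoeff q m R p) •
    colTrans q (fun c => x c m) (fun c => w c m) m
      (fun i => minor q x w S m (removeAt R p) (i ∘ some) * g (i none)) (withAux C (R p))

theorem minor_zero (R C : ℕ → Fin N) : minor q x w S 0 R C = 1 := by
  simp [minor, rowAlt, altCoeff, brk, seqInv, inversions]

theorem minor_congr {m : ℕ} (R : ℕ → Fin N) {C C' : ℕ → Fin N} (h : ∀ n < m, C n = C' n) :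
    minor q x w S m R C = minor q x w S m R C' := by
  refine Finset.sum_congr rfl fun σ _ => ?_
  rw [dependsOn_brk m]
  rintro (n | n) hn
  · rfl
  · exact h n hn

/-- The sum over permutations is grouped by the row that ends up in the last factor. The operators
R̄^t mix this row index with the earlier columns, which is why `colTrans` appears. The entries of
the last column stand to the right of the smaller minors. -/
theorem minor_succ (m : ℕ) (R C : ℕ → Fin N) :
    minor q x w S (m + 1) R C = expansion q x w S m R C fun y => S m y (C m) := by
  have key : ∀ (p : Fin (m + 1)) (τ : Equiv.Perm (Fin m)),
      brk q x w S (m + 1) (Sum.elim (permute R (insertPerm p τ)) C) =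
        colTrans q (fun c => x c m) (fun c => w c m) m
        (fun i => brk q x w S m (Sum.elim (permute (removeAt R p) τ) (i ∘ some)) *
          S m (i none) (C m)) (withAux C (R p)) := by
    intro p τ
    have h := trans_freeze (q := q) (x := x) (w := w) (m := m) (k := m) (permute R (insertPerm p τ))
      (brk q x w S m * entry S m) (withAux C (R p))
    have h' : Function.update (permute R (insertPerm p τ)) m (withAux C (R p) none) =
        permute R (insertPerm p τ) := by
      rw [Function.update_eq_self_iff, permute_insertPerm_last]
      rfl
    rw [h'] at h
    rw [brk_succ]
    refine h.trans ?_
    -- The swaps involve only columns before m, so column m keeps its value throughout.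
    refine colTrans_congr (Q := {i | i (some m) = C m}) ?_ ?_ rfl
    · intro c hc i hi
      change i _ = _
      rw [Equiv.swap_apply_of_ne_of_ne (by simpa using hc.ne') (by simp)]
      exact hi
    · intro i hi
      rw [Pi.mul_apply]
      congr 1
      · apply dependsOn_brk m
        rintro (n | n) hn
        · have : n ≠ m := ne_of_lt hn
          simp only [elim_inl, Function.update_of_ne this]
          exact permute_insertPerm_of_lt R p τ hn
        · rfl
      · simp only [entry, elim_inl, elim_inr, Function.update_self, Function.comp_apply]
        rw [show i (some m) = C m from hi]
  rw [minor, rowAlt, ← (insertPerm_bijective m).sum_comp, Fintype.sum_prod_type, expansion,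
    Finset.sum_range]
  refine Finset.sum_congr rfl fun p _ => ?_
  simp only [key, altCoeff_insertPerm, map_mul, mul_smul, ← Finset.smul_sum]
  congr 1
  have h : (fun i : Option ℕ → Fin N => minor q x w S m (removeAt R p) (i ∘ some) *
      S m (i none) (C m)) = ∑ τ : Equiv.Perm (Fin m), algebraMap ℂ K (altCoeff q (removeAt R p) τ) •
        fun i : Option ℕ → Fin N => brk q x w S m
          (Sum.elim (permute (removeAt R p) τ) (i ∘ some)) * S m (i none) (C m) := by
    funext i
    simp only [Finset.sum_apply, Pi.smul_apply, minor, rowAlt, Finset.sum_mul, smul_mul_assoc]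
  rw [h, map_sum, Finset.sum_apply]
  simp only [map_smul, Pi.smul_apply]

end Expansion
end TwistedYangian

namespace TwistedYangian

/-! ### Minors containing all indices of J, and Schur complements -/

section Append

open Sum

variable {K E : Type*} [CommRing K] [Algebra ℂ K] [Ring E] [Algebra K E]
  {q : ℂ} {x w : ℕ → ℕ → K}

theorem trans_comp {L L' : Type*} [LinearOrder L] [LinearOrder L'] {e : L → L'}
    (he : StrictMono e) (b k : ℕ) (g : (ℕ ⊕ ℕ → L') → E) (i : ℕ ⊕ ℕ → L) :
    trans q x w b k g (e ∘ i) = trans q x w b k (fun j => g (e ∘ j)) i := by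
  induction k generalizing g with
  | zero => rfl
  | succ k ih =>
    rw [trans_succ, trans_succ, ih]
    refine congrArg (fun h => trans q x w b k h i) (funext fun j => ?_)
    rw [rbar_eq, rbar_eq, Pi.smul_apply, Pi.smul_apply,
      rop_comp q _ _ (Ψ := fun j : ℕ ⊕ ℕ → L => e ∘ j) (i := j) he rfl rfl rfl]
    rfl

theorem brk_comp {L L' : Type*} [LinearOrder L] [LinearOrder L'] {e : L → L'}
    (he : StrictMono e) (S : ℕ → L' → L' → E) (m : ℕ) (i : ℕ ⊕ ℕ → L) :
    brk q x w S m (e ∘ i) = brk q x w (fun a r c => S a (e r) (e c)) m i := by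
  induction m generalizing i with
  | zero => rfl
  | succ m ih =>
    rw [brk_succ, brk_succ, trans_comp he]
    refine congrArg (fun h => trans q x w m m h i) (funext fun j => ?_)
    rw [Pi.mul_apply, ih]
    rfl

variable {N N' : ℕ}

theorem seqInv_comp {e : Fin N → Fin N'} (he : StrictMono e) (m : ℕ) (R : ℕ → Fin N) :
    seqInv m (e ∘ R) = seqInv m R := by
  simp only [seqInv, inversions, Function.comp_apply, he.lt_iff_lt]

theorem permute_comp {L L' : Type*} (e : L → L') {m : ℕ} (R : ℕ → L) (σ : Equiv.Perm (Fin m)) :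
    permute (e ∘ R) σ = e ∘ permute R σ := by
  funext n
  simp only [permute, Function.comp_apply]
  split_ifs <;> rfl

theorem minor_comp {e : Fin N → Fin N'} (he : StrictMono e) (S : ℕ → Fin N' → Fin N' → E) (m : ℕ)
    (R C : ℕ → Fin N) :
    minor q x w S m (e ∘ R) (e ∘ C) = minor q x w (fun a r c => S a (e r) (e c)) m R C := by
  refine Finset.sum_congr rfl fun σ _ => ?_
  rw [altCoeff, altCoeff, permute_comp, seqInv_comp he, ← brk_comp he]
  congr 2
  exact (Sum.comp_elim e _ _).symm

variable {S : ℕ → Fin N → Fin N → E}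

theorem expansion_congr {m : ℕ} (R : ℕ → Fin N) {C C' : ℕ → Fin N} (h : ∀ n < m, C n = C' n)
    (g : Fin N → E) : expansion q x w S m R C g = expansion q x w S m R C' g := by
  refine Finset.sum_congr rfl fun p _ => ?_
  congr 1
  refine dependsOn_colTrans (s := {o | ∀ n, o = some n → n < m}) ?_ (by simp) (by simp) ?_
  · intro i j hij
    beta_reduce
    rw [hij none (by simp), minor_congr (C := i ∘ some) (C' := j ∘ some) _ fun n hn => hij (some n) (by simpa using hn)]
  · rintro (_ | n) hn
    · rfl
    · exact h n (hn n rfl)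

/-- The entry of the last factor is the rightmost one, so right multiples come out. Together with
additivity this makes a minor right linear in its last column. -/
theorem expansion_mul_const (m : ℕ) (R C : ℕ → Fin N) (g : Fin N → E) (e : E) :
    expansion q x w S m R C (fun y => g y * e) = expansion q x w S m R C g * e := by
  simp only [expansion, Finset.sum_mul, smul_mul_assoc, ← mul_assoc, colTrans_mul_const]

theorem expansion_sub (m : ℕ) (R C : ℕ → Fin N) (g h : Fin N → E) :
    expansion q x w S m R C (fun y => g y - h y) =
      expansion q x w S m R C g - expansion q x w S m R C h := by
  simp only [expansion, mul_sub, ← Finset.sum_sub_distrib, ← smul_sub]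
  refine Finset.sum_congr rfl fun p _ => ?_
  congr 1
  exact congrFun (map_sub (colTrans q (fun c => x c m) (fun c => w c m) m)
    (fun i : Option ℕ → Fin N => minor q x w S m (removeAt R p) (i ∘ some) * g (i none)) _) _

theorem expansion_zero (m : ℕ) (R C : ℕ → Fin N) :
    expansion q x w S m R C (fun _ => 0) = 0 := by
  have h := expansion_sub (q := q) (x := x) (w := w) (S := S) m R C 0 0
  rwa [sub_self, show (fun y => (0 : Fin N → E) y - (0 : Fin N → E) y) = fun _ => 0 from
    funext fun _ => sub_self _] at h

theorem expansion_sum {ι : Type*} (s : Finset ι) (m : ℕ) (R C : ℕ → Fin N) (g : ι → Fin N → E) :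
    expansion q x w S m R C (fun y => ∑ a ∈ s, g a y) =
      ∑ a ∈ s, expansion q x w S m R C (g a) := by
  classical
  induction s using Finset.induction_on with
  | empty => simpa using expansion_zero m R C
  | insert a s ha ih =>
    simp only [Finset.sum_insert ha, ← ih]
    have h := expansion_sub (q := q) (x := x) (w := w) (S := S) m R C
      (fun y => g a y + ∑ b ∈ s, g b y) fun y => ∑ b ∈ s, g b y
    simp only [add_sub_cancel_right] at h
    rw [h, sub_add_cancel]

/-- Column k is pushed to the right past l columns of larger index, each exchange costing −q⁻¹ by
antisymmetry. -/
theorem minor_move_column (hq0 : q ≠ 0) (hq : ∀ k : ℕ, 0 < k → q ^ k ≠ 1) (hS : Fusion q x w S)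
    {m : ℕ} (R C : ℕ → Fin N) (k l : ℕ) (hkl : k + l < m) (h : ∀ n, k < n → n ≤ k + l → C k < C n) :
    minor q x w S m R (fun n => if n < k then C n else if n < k + l then C (n + 1) else
      if n = k + l then C k else C n) = algebraMap ℂ K ((-q⁻¹) ^ l) • minor q x w S m R C := by
  induction l with
  | zero =>
    rw [pow_zero, map_one, one_smul]
    congr 1
    funext n
    split_ifs with h1 h2 h3
    · rfl
    · omega
    · rw [h3]
      rfl
    · rfl
  | succ l ih =>
    have := antiOn_minor hq0 hq hS m R (k + l) (by omega)
      (fun n => if n < k then C n else if n < k + l then C (n + 1) else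
      if n = k + l then C k else C n)
    have h2 := this.2 (by
      simp only [id]
      simp
      exact h _ (by omega) (by omega))
    rw [pow_succ', map_mul, mul_smul, ← ih (by omega) fun n h1 h2 => h n h1 (by omega), map_neg,
      ← h2]
    congr 1
    funext n
    simp only [Function.comp_apply, id, Equiv.swap_apply_def]
    split_ifs <;> first | omega | rfl | skip
    all_goals first
      | (congr 1
         omega)

variable {M : ℕ}

/-- The sequence `K` up to the `k`-th term, followed by the last `M` indices in the order `j`. -/
def append (j : ℕ → Fin M) (k : ℕ) (K : ℕ → Fin N) : ℕ → Fin (N + M) := fun n =>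
  if n < k then Fin.castAdd M (K n) else Fin.natAdd N (j (n - k))

theorem append_of_lt {j : ℕ → Fin M} {k n : ℕ} (h : n < k) (K : ℕ → Fin N) :
    append j k K n = Fin.castAdd M (K n) := if_pos h

theorem append_of_le {j : ℕ → Fin M} {k n : ℕ} (h : k ≤ n) (K : ℕ → Fin N) :
    append j k K n = Fin.natAdd N (j (n - k)) := if_neg h.not_gt

theorem castAdd_lt_natAdd (a : Fin N) (b : Fin M) : Fin.castAdd M a < Fin.natAdd N b := by
  rw [Fin.lt_def, Fin.val_castAdd, Fin.val_natAdd]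
  omega

theorem removeAt_append {j : ℕ → Fin M} {k p : ℕ} (hp : p ≤ k) (K : ℕ → Fin N) :
    removeAt (append j (k + 1) K) p = append j k (removeAt K p) := by
  funext n
  simp only [removeAt, append]
  split_ifs <;> first | omega | rfl | skip
  congr 2
  omega

/-- A row with index in I has M further places to pass, hence the sign (−1)^M, and M further indices
exceed it, hence q^{-M}. -/
theorem expandCoeff_append {j : ℕ → Fin M} {k p : ℕ} (hp : p ≤ k) (K : ℕ → Fin N) :
    expandCoeff q (k + M) (append j (k + 1) K) p = (-q⁻¹) ^ M * expandCoeff q k K p := by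
  have h : ((Finset.range (k + M + 1)).filter fun a =>
      append j (k + 1) K p < append j (k + 1) K a).card =
      ((Finset.range (k + 1)).filter fun a => K p < K a).card + M := by
    rw [show k + M + 1 = (k + 1) + M by omega, Finset.card_filter, Finset.sum_range_add,
      Finset.card_filter]
    congr 1
    · refine Finset.sum_congr rfl fun a ha => ?_
      rw [append_of_lt (Finset.mem_range.1 ha), append_of_lt (by omega)]
      rfl
    · rw [Finset.sum_congr rfl (g := fun _ => 1), Finset.sum_const, Finset.card_range, smul_eq_mul,
        mul_one]
      intro a _
      rw [append_of_lt (by omega), append_of_le (by omega), if_pos (castAdd_lt_natAdd _ _)]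
  rw [expandCoeff, expandCoeff, h, pow_add, mul_inv, neg_pow q⁻¹,
    show k + M - p = (k - p) + M by omega, pow_add, inv_pow]
  ring

/-- At a column with value in J the exchanged term has a row index in J and vanishes. The remaining
diagonal coefficient is x − 1, which the normalization `v` cancels, so the operator is the identity
there. -/
theorem colTrans_eq_of_zero {L : Type*} [LinearOrder L] {y v : ℕ → K} {k m : ℕ} (hkm : k ≤ m)
    (hv : ∀ b, v b * (y b - 1) = 1) {J : Set L} {φ : (Option ℕ → L) → E}
    (hφ : ∀ i, i none ∈ J → φ i = 0) {i : Option ℕ → L}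
    (hi : ∀ b, k ≤ b → b < m → i (some b) ∈ J) :
    colTrans q y v m φ i = colTrans q y v k φ i := by
  induction m, hkm using Nat.le_induction with
  | base => rfl
  | succ b hkb ih =>
    rw [← ih fun c h1 h2 => hi c h1 (by omega), colTrans_succ]
    refine colTrans_congr (Q := {i | i (some b) ∈ J}) ?_ ?_ (hi b hkb b.lt_succ_self)
    · intro c hc i hi
      change i _ ∈ J
      rwa [Equiv.swap_apply_of_ne_of_ne (by simpa using hc.ne') (by simp)]
    · intro i hi
      rw [Pi.smul_apply, rop_apply, hφ (i ∘ _) (by simpa using hi), smul_zero, add_zero]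
      by_cases hn : i none ∈ J
      · rw [hφ i hn, smul_zero, smul_zero]
      · rw [diagCoeff, if_neg fun h : i (some b) = i none => hn (h ▸ hi), smul_smul, hv, one_smul]

variable {S : ℕ → Fin (N + M) → Fin (N + M) → E}

/-- The entries of `S_II - S_IJ S_JJ⁻¹ S_JI`, where `I` consists of the first `N` indices, `J` of the
last `M`, and `G` is the inverse of `S_JJ`. -/
def schur (S : Fin (N + M) → Fin (N + M) → E) (G : Matrix (Fin M) (Fin M) E) (i j : Fin N) : E :=
  S (Fin.castAdd M i) (Fin.castAdd M j) - ∑ a, ∑ b,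
    S (Fin.castAdd M i) (Fin.natAdd N a) * G a b * S (Fin.natAdd N b) (Fin.castAdd M j)

/-- The column `C k` is moved behind J, where right linearity is available, and right multiples of
the columns of J are then subtracted from it. -/
theorem minor_append_succ (hq0 : q ≠ 0) (hq : ∀ k : ℕ, 0 < k → q ^ k ≠ 1) (hS : Fusion q x w S)
    {j : ℕ → Fin M} (hj : ∀ a : Fin M, j a = a) (k : ℕ) (R : ℕ → Fin (N + M)) (C : ℕ → Fin N)
    (G : Matrix (Fin M) (Fin M) E) :
    minor q x w S (k + M + 1) R (append j (k + 1) C) =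
      algebraMap ℂ K ((-q) ^ M) • expansion q x w S (k + M) R (append j k C)
        fun y => S (k + M) y (Fin.castAdd M (C k)) - ∑ a, ∑ b, S (k + M) y (Fin.natAdd N a) *
          G a b * S (k + M) (Fin.natAdd N b) (Fin.castAdd M (C k)) := by
  have hmove := minor_move_column hq0 hq hS R (append j (k + 1) C) k M (m := k + M + 1) (by omega)
    (fun n h1 h2 => by
      rw [append_of_lt (by omega), append_of_le (by omega)]
      exact castAdd_lt_natAdd _ _)
  have h1 : minor q x w S (k + M + 1) R (append j (k + 1) C) = algebraMap ℂ K ((-q) ^ M) •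
      algebraMap ℂ K ((-q⁻¹) ^ M) • minor q x w S (k + M + 1) R (append j (k + 1) C) := by
    rw [smul_smul, ← map_mul, ← mul_pow, neg_mul_neg, mul_inv_cancel₀ hq0, one_pow, map_one,
      one_smul]
  rw [h1, ← hmove, minor_succ, expansion_sub, expansion_congr R (C' := append j k C)]
  · congr 1
    -- Such an expansion is a minor in which the column of index a occurs twice.
    have h0 : ∀ a : Fin M, expansion q x w S (k + M) R (append j k C)
        (fun y => S (k + M) y (Fin.natAdd N a)) = 0 := by
      intro a
      have h2 := minor_succ (q := q) (x := x) (w := w) (S := S) (k + M) R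
        (Function.update (append j k C) (k + M) (Fin.natAdd N a))
      rw [Function.update_self, expansion_congr R (C' := append j k C)
        (fun n hn => Function.update_of_ne hn.ne _ _)] at h2
      rw [← h2]
      refine AntiOn.eq_zero hq0 Function.injective_id (antiOn_minor hq0 hq hS _ R)
        (a := k + a) (b := k + M) (by omega) (by omega) ?_
      rw [id, id, Function.update_self, Function.update_of_ne (by omega), append_of_le (by omega),
        Nat.add_sub_cancel_left, hj]
    simp only [mul_assoc, expansion_sum, expansion_mul_const, h0, zero_mul, Finset.sum_const_zero,
      sub_zero]
    rw [if_neg (by omega), if_neg (by omega), if_pos trivial, append_of_lt k.lt_succ_self]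
  · intro n hn
    by_cases h : n < k
    · rw [if_pos h, append_of_lt h, append_of_lt (by omega)]
    · rw [if_neg h, if_pos hn, append_of_le (by omega), append_of_le (by omega),
        Nat.add_sub_add_right]

/-- Induction on the number k of indices in I by column elimination: with G = S_JJ⁻¹, the corrected
last column vanishes on the rows of J and has the entries of the Schur complement on the rows of I.
The parameters `x a (b + M)` are shifted in the second index only: a corrected column sits behind J,
while the columns it is exchanged with keep their places. -/
theorem minor_append (hq0 : q ≠ 0) (hq : ∀ k : ℕ, 0 < k → q ^ k ≠ 1) (hS : Fusion q x w S)
    (hw : ∀ a b, w a b * (x a b - 1) = 1) {j : ℕ → Fin M} (hj : ∀ a : Fin M, j a = a)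
    {G : ℕ → Matrix (Fin M) (Fin M) E}
    (hG : ∀ n, (Matrix.of fun a b => S n (Fin.natAdd N a) (Fin.natAdd N b)) * G n = 1)
    (k : ℕ) (R C : ℕ → Fin N) :
    minor q x w S (k + M) (append j k R) (append j k C) =
      minor q x w (fun n a b => S n (Fin.natAdd N a) (Fin.natAdd N b)) M j j *
        minor q (fun a b => x a (b + M)) (fun a b => w a (b + M))
          (fun n => schur (S (n + M)) (G (n + M))) k R C := by
  induction k generalizing R C with
  | zero =>
    rw [minor_zero, mul_one, Nat.zero_add]
    exact minor_comp (Fin.strictMono_natAdd N) S M j j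
  | succ k ih =>
    rw [show k + 1 + M = k + M + 1 by omega, minor_append_succ hq0 hq hS hj k _ C (G (k + M)),
      minor_succ]
    set g : Fin (N + M) → E := fun y => S (k + M) y (Fin.castAdd M (C k)) -
      ∑ a, ∑ b, S (k + M) y (Fin.natAdd N a) * G (k + M) a b *
        S (k + M) (Fin.natAdd N b) (Fin.castAdd M (C k)) with hg
    -- This is the relation S_JJ G = 1 at the row a.
    have hgJ : ∀ a : Fin M, g (Fin.natAdd N a) = 0 := by
      intro a
      have h := fun b => congrFun (congrFun (hG (k + M)) a) b
      simp only [Matrix.mul_apply, Matrix.of_apply, Matrix.one_apply] at h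
      rw [hg]
      beta_reduce
      rw [Finset.sum_comm]
      simp only [← Finset.sum_mul, h, ite_mul, one_mul, zero_mul, Finset.sum_ite_eq,
        Finset.mem_univ, if_true, sub_self]
    have htrans : ∀ (R' : ℕ → Fin (N + M)) (i : Option ℕ → Fin (N + M)),
        (∀ b, k ≤ b → i (some b) = Fin.natAdd N (j (b - k))) →
        colTrans q (fun c => x c (k + M)) (fun c => w c (k + M)) (k + M)
          (fun i => minor q x w S (k + M) R' (i ∘ some) * g (i none)) i =
        colTrans q (fun c => x c (k + M)) (fun c => w c (k + M)) k
          (fun i => minor q x w S (k + M) R' (i ∘ some) * g (i none)) i := by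
      intro R' i hi
      refine colTrans_eq_of_zero (by omega) (fun b => hw _ _) (J := Set.range (Fin.natAdd N)) ?_ ?_
      · rintro i ⟨a, ha⟩
        rw [← ha, hgJ, mul_zero]
      · intro b h1 _
        exact ⟨_, (hi b h1).symm⟩
    have htail : ∀ r b, k ≤ b → withAux (append j k C) r (some b) = Fin.natAdd N (j (b - k)) :=
      fun r b hb => append_of_le hb C
    -- Removing a row of J contributes nothing. Along all swaps some value from J sits either in the
    -- row index, where g vanishes, or in one of the first k columns, where it repeats a column of
    -- the tail.
    have hlarge : ∀ p, k < p → colTrans q (fun c => x c (k + M)) (fun c => w c (k + M)) (k + M)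
        (fun i => minor q x w S (k + M) (removeAt (append j (k + 1) R) p) (i ∘ some) * g (i none))
        (withAux (append j k C) (append j (k + 1) R p)) = 0 := by
      intro p hp
      rw [htrans _ _ (htail _)]
      have h := colTrans_congr (q := q) (y := fun c => x c (k + M)) (v := fun c => w c (k + M))
        (k := k) (Q := {i | (∀ b, k ≤ b → i (some b) = Fin.natAdd N (j (b - k))) ∧
          ((∃ a : Fin M, i none = Fin.natAdd N a) ∨
            ∃ c < k, ∃ a : Fin M, i (some c) = Fin.natAdd N a)})
        (g := fun i => minor q x w S (k + M) (removeAt (append j (k + 1) R) p) (i ∘ some) *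
          g (i none)) (h := 0) ?_ ?_ (i := withAux (append j k C) (append j (k + 1) R p)) ?_
      · rw [h, map_zero]
        rfl
      · rintro c hc i ⟨h1, h2⟩
        refine ⟨fun b hb => ?_, ?_⟩
        · rw [Function.comp_apply, Equiv.swap_apply_of_ne_of_ne (by simpa using by omega) (by simp),
            h1 b hb]
        · rcases h2 with h2 | ⟨c', hc', h2⟩
          · right
            refine ⟨c, hc, ?_⟩
            rwa [Function.comp_apply, Equiv.swap_apply_left]
          · by_cases hcc : c' = c
            · subst hcc
              left
              rwa [Function.comp_apply, Equiv.swap_apply_right]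
            · right
              refine ⟨c', hc', ?_⟩
              rwa [Function.comp_apply, Equiv.swap_apply_of_ne_of_ne (by simpa using hcc) (by simp)]
      · rintro i ⟨h1, ⟨a, ha⟩ | ⟨c, hc, a, ha⟩⟩
        · rw [ha, hgJ, mul_zero]
          rfl
        · rw [AntiOn.eq_zero hq0 Function.injective_id (antiOn_minor hq0 hq hS _ _)
            (a := c) (b := k + a) (by omega) (by omega), zero_mul]
          · rfl
          · change i (some c) = i (some (k + a))
            rw [ha, h1 _ (by omega), Nat.add_sub_cancel_left, hj]
      · refine ⟨htail _, Or.inl ⟨j (p - (k + 1)), ?_⟩⟩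
        exact append_of_le hp R
    rw [expansion, ← Finset.sum_subset (Finset.range_mono (show k + 1 ≤ k + M + 1 by omega)),
      expansion, Finset.smul_sum, Finset.mul_sum]
    -- The factor (−q)^M from moving the column cancels (−q⁻¹)^M from the expansion coefficient.
    · refine Finset.sum_congr rfl fun p hp => ?_
      have hp : p ≤ k := Nat.lt_succ_iff.1 (Finset.mem_range.1 hp)
      rw [htrans _ _ (htail _), removeAt_append hp, expandCoeff_append hp, smul_smul, ← map_mul,
        ← mul_assoc, ← mul_pow, neg_mul_neg, mul_inv_cancel₀ hq0, one_pow, one_mul,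
        mul_smul_comm, append_of_lt (by omega : p < k + 1)]
      congr 1
      set Ψ : (Option ℕ → Fin N) → (Option ℕ → Fin (N + M)) := fun i =>
        withAux (append j k (i ∘ some)) (Fin.castAdd M (i none)) with hΨ
      have h := colTrans_comp (q := q) (y := fun c => x c (k + M)) (v := fun c => w c (k + M))
        (k := k) (Ψ := Ψ) (Fin.strictMono_castAdd M)
        (fun c hc i => append_of_lt hc _) (fun i => rfl) ?_
        (fun i => minor q x w S (k + M) (append j k (removeAt R p)) (i ∘ some) * g (i none))
        (withAux C (R p))
      · refine h.trans ?_
        rw [← colTrans_const_mul]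
        refine congrArg (fun h => colTrans q _ _ k h _) (funext fun i => ?_)
        rw [← mul_assoc, ← ih]
        rfl
      · intro c hc i
        funext o
        rcases o with _ | n
        · rw [Function.comp_apply, Equiv.swap_apply_right]
          change _ = append j k (i ∘ some) c
          rw [append_of_lt hc]
          rfl
        · by_cases hn : n = c
          · subst hn
            rw [Function.comp_apply, Equiv.swap_apply_left]
            change append j k ((i ∘ Equiv.swap (some n) none) ∘ some) n = Fin.castAdd M (i none)
            rw [append_of_lt hc, Function.comp_apply, Function.comp_apply, Equiv.swap_apply_left]
          · have hs : Equiv.swap (some c) none (some n) = some n :=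
              Equiv.swap_apply_of_ne_of_ne (by simpa using hn) (by simp)
            rw [Function.comp_apply, hs]
            change append j k ((i ∘ Equiv.swap (some c) none) ∘ some) n = append j k (i ∘ some) n
            simp only [append, Function.comp_apply, hs]
    · intro p _ hp
      rw [hlarge p (by simpa using hp), smul_zero]

theorem commute_trans {L : Type*} [LinearOrder L] {e : E} (b k : ℕ) {g : (ℕ ⊕ ℕ → L) → E}
    (hg : ∀ i, Commute e (g i)) (i : ℕ ⊕ ℕ → L) : Commute e (trans q x w b k g i) := by
  induction k generalizing g with
  | zero => exact hg i
  | succ k ih =>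
    refine ih fun j => ?_
    rw [rbar_eq, Pi.smul_apply, rop_apply]
    exact (((hg _).smul_right _).add_right ((hg _).smul_right _)).smul_right _

theorem commute_brk {L : Type*} [LinearOrder L] {S : ℕ → L → L → E} {e : E} (m : ℕ)
    (hS : ∀ a r c, Commute e (S a r c)) (i : ℕ ⊕ ℕ → L) : Commute e (brk q x w S m i) := by
  induction m generalizing i with
  | zero => exact Commute.one_right e
  | succ m ih => exact commute_trans m m (fun i => (ih i).mul_right (hS _ _ _)) i

theorem commute_minor {S : ℕ → Fin N → Fin N → E} {e : E} (m : ℕ)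
    (hS : ∀ a r c, Commute e (S a r c)) (R C : ℕ → Fin N) : Commute e (minor q x w S m R C) :=
  Commute.sum_right _ _ _ fun _ _ => (commute_brk m hS _).smul_right _

theorem trans_const_mul {L : Type*} [LinearOrder L] (e : E) (b k : ℕ) (g : (ℕ ⊕ ℕ → L) → E) :
    trans q x w b k (fun i => e * g i) = fun i => e * trans q x w b k g i := by
  have := trans_mul_left (q := q) (x := x) (w := w) (n := b) (k := k) (f := fun _ => e) g
    (s := ∅) (fun _ _ _ => rfl) (Set.notMem_empty _) (fun _ _ => Set.notMem_empty _)
  exact this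

/-- Each `d n` passes all entries of the matrices, so the factors come out on the left; their mutual
order is kept, as they are not assumed to commute with each other. -/
theorem brk_mul {L : Type*} [LinearOrder L] {S : ℕ → L → L → E} {d : ℕ → E}
    (hd : ∀ n a r c, Commute (d n) (S a r c)) (m : ℕ) (i : ℕ ⊕ ℕ → L) :
    brk q x w (fun a r c => d a * S a r c) m i =
      ((List.range m).map d).prod * brk q x w S m i := by
  induction m generalizing i with
  | zero => exact (one_mul _).symm
  | succ m ih =>
    rw [brk_succ, brk_succ, List.range_succ, List.map_append, List.prod_append, List.map_singleton,
      List.prod_singleton]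
    have h : brk q x w (fun a r c => d a * S a r c) m * entry (fun a r c => d a * S a r c) m =
        fun i => (((List.range m).map d).prod * d m) * (brk q x w S m * entry S m) i := by
      funext i
      change _ * (d m * entry S m i) = _ * (_ * entry S m i)
      rw [ih, mul_assoc, mul_assoc, ← mul_assoc (brk q x w S m i), ← mul_assoc (d m),
        (commute_brk m (hd m) i).eq]
    rw [h, trans_const_mul]

theorem minor_mul {S : ℕ → Fin N → Fin N → E} {d : ℕ → E}
    (hd : ∀ n a r c, Commute (d n) (S a r c)) (m : ℕ) (R C : ℕ → Fin N) :
    minor q x w (fun a r c => d a * S a r c) m R C =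
      ((List.range m).map d).prod * minor q x w S m R C := by
  simp only [minor, rowAlt, Finset.mul_sum, mul_smul_comm, brk_mul hd]

end Append
end TwistedYangian

namespace TwistedYangian

/-! ### Comparison of tensor products of matrices with functions of indices -/

open PowerSeries in
/-- Power series with coefficients in an algebra form an algebra over power series of scalars. -/
noncomputable instance powerSeriesAlgebra {K E : Type*} [CommRing K] [Ring E] [Algebra K E] :
    Algebra (PowerSeries K) (PowerSeries E) :=
  (PowerSeries.map (algebraMap K E)).toAlgebra' fun c f => by
    ext n
    rw [coeff_mul, coeff_mul, ← Finset.Nat.sum_antidiagonal_swap]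
    refine Finset.sum_congr rfl fun p _ => ?_
    rw [Prod.fst_swap, Prod.snd_swap, coeff_map, Algebra.commutes]

section Link

open Sum

variable {K E : Type*} [CommRing K] [Algebra ℂ K] [Ring E] [Algebra K E] {N : ℕ}

theorem RMatrix_apply (q : ℂ) (u v : K) (a b c d : Fin N) :
    RMatrix q N u v (a, b) (c, d) = (if c = a then if d = b then diagCoeff q u v a b else 0 else 0) +
      if d = a then if c = b then swapCoeff q u v a b else 0 else 0 := by
  simp only [RMatrix, Prod.mk.injEq, diagCoeff, swapCoeff, Algebra.smul_def, sub_mul, map_sub]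
  rcases lt_trichotomy a b with h | h | h
  · by_cases hc : c = a
    · subst hc
      by_cases hd : d = b
      · subst hd
        simp [h.ne, h.ne']
      · simp [h.ne, h.ne', hd, Ne.symm hd]
    · by_cases hd : d = a
      · subst hd
        by_cases hc' : c = b
        · subst hc'
          simp [h, h.ne, h.ne', h.not_gt]
        · simp [hc, Ne.symm hc, Ne.symm hc', hc']
      · simp [hc, hd, Ne.symm hc, Ne.symm hd]
  · subst h
    by_cases hc : c = a
    · subst hc
      by_cases hd : d = c
      · subst hd
        simp
      · simp [hd, Ne.symm hd]
    · simp [hc, Ne.symm hc]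
  · by_cases hc : c = a
    · subst hc
      by_cases hd : d = b
      · subst hd
        simp [h.ne, h.ne']
      · simp [h.ne, h.ne', hd, Ne.symm hd]
    · by_cases hd : d = a
      · subst hd
        by_cases hc' : c = b
        · subst hc'
          simp [h, h.ne, h.ne', h.not_gt]
        · simp [hc, Ne.symm hc, Ne.symm hc', hc']
      · simp [hc, hd, Ne.symm hc, Ne.symm hd]

theorem mul_onFactor_apply {B : Type*} [Ring B] {m : ℕ} (a : Fin m) (T : Matrix (Fin N) (Fin N) B)
    (H : Matrix (Fin m → Fin N) (Fin m → Fin N) B) (i j : Fin m → Fin N) :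
    (H * onFactor a T) i j = ∑ v, H i (Function.update j a v) * T v (j a) := by
  classical
  rw [Matrix.mul_apply]
  symm
  refine Finset.sum_of_injOn (fun v => Function.update j a v) ?_ (by simp) ?_ ?_
  · intro v _ v' _ h
    simpa using congrFun h a
  · intro z _ hz
    rw [onFactor, if_neg, mul_zero]
    intro h
    apply hz
    refine ⟨z a, by simp, ?_⟩
    funext k
    by_cases hk : k = a
    · subst hk
      simp
    · simp [hk, h k hk]
  · intro v _
    rw [onFactor, if_pos, Function.update_self]
    intro k hk
    exact Function.update_of_ne hk _ _

theorem mul_onFactors_apply {B : Type*} [Ring B] {m : ℕ} {a b : Fin m} (hab : a ≠ b)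
    (T : Matrix (Fin N × Fin N) (Fin N × Fin N) B)
    (H : Matrix (Fin m → Fin N) (Fin m → Fin N) B) (i j : Fin m → Fin N) :
    (H * onFactors a b T) i j = ∑ v, ∑ y,
      H i (Function.update (Function.update j a v) b y) * T (v, y) (j a, j b) := by
  classical
  rw [Matrix.mul_apply, ← Fintype.sum_prod_type' (f := fun v y =>
    H i (Function.update (Function.update j a v) b y) * T (v, y) (j a, j b))]
  symm
  refine Finset.sum_of_injOn (fun v => Function.update (Function.update j a v.1) b v.2) ?_ (by simp)
    ?_ ?_
  · intro v _ v' _ h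
    have h1 := congrFun h a
    have h2 := congrFun h b
    simp only [Function.update_of_ne hab, Function.update_self] at h1 h2
    exact Prod.ext h1 h2
  · intro z _ hz
    rw [onFactors, if_neg, mul_zero]
    intro h
    apply hz
    refine ⟨(z a, z b), by simp, ?_⟩
    funext k
    by_cases hk : k = b
    · subst hk
      simp
    · by_cases hk' : k = a
      · subst hk'
        simp [hk]
      · simp [hk, hk', h k hk' hk]
  · intro v _
    rw [onFactors, if_pos, Function.update_self, Function.update_of_ne hab, Function.update_self]
    intro k hk hk'
    rw [Function.update_of_ne hk', Function.update_of_ne hk]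

theorem update_comp_swap {ι L : Type*} [DecidableEq ι] {p a b : ι} (ha : p ≠ a) (hb : p ≠ b)
    (i : ι → L) (v : L) :
    Function.update i p v ∘ Equiv.swap a b = Function.update (i ∘ Equiv.swap a b) p v := by
  funext n
  by_cases hn : n = p
  · subst hn
    simp [Equiv.swap_apply_of_ne_of_ne ha hb]
  · rw [Function.update_of_ne hn, Function.comp_apply, Function.update_of_ne, Function.comp_apply]
    intro h
    apply hn
    rw [← Equiv.swap_apply_self a b n, h, Equiv.swap_apply_of_ne_of_ne ha hb]

theorem trans_sum_update {q : ℂ} {x w : ℕ → ℕ → K} {p : ℕ ⊕ ℕ} {b k : ℕ} (hp : p ≠ inl b)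
    (hp' : ∀ c < k, p ≠ inr c) (f : Fin N → (ℕ ⊕ ℕ → Fin N) → E) (i : ℕ ⊕ ℕ → Fin N) :
    trans q x w b k (fun i => ∑ v, f v (Function.update i p v)) i =
      ∑ v, trans q x w b k (f v) (Function.update i p v) := by
  induction k generalizing f with
  | zero => rfl
  | succ k ih =>
    simp only [trans_succ, ← ih fun c hc => hp' c (hc.trans k.lt_succ_self)]
    refine congrArg (fun h => trans q x w b k h i) (funext fun j => ?_)
    have hk := hp' k k.lt_succ_self
    simp only [rbar_eq, Pi.smul_apply, rop_apply, update_comp_swap hk hp,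
      Function.update_of_ne hk.symm, Function.update_of_ne hp.symm, Finset.smul_sum, smul_add,
      Finset.sum_add_distrib]

theorem trans_mul_const {q : ℂ} {x w : ℕ → ℕ → K} (b k : ℕ) (g : (ℕ ⊕ ℕ → Fin N) → E) (e : E)
    (i : ℕ ⊕ ℕ → Fin N) :
    trans q x w b k (fun i => g i * e) i = trans q x w b k g i * e :=
  congrFun (trans_mul_right (q := q) (x := x) (w := w) (n := b) (k := k) g (f := fun _ => e)
    (s := ∅) (fun _ _ _ => rfl) (Set.notMem_empty _) (fun _ _ => Set.notMem_empty _)) i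

theorem trans_congr {q : ℂ} {x w : ℕ → ℕ → K} {b k : ℕ} {Q : Set (ℕ ⊕ ℕ → Fin N)}
    (hQ : ∀ c < k, ∀ i ∈ Q, i ∘ Equiv.swap (inr c) (inl b) ∈ Q) {g h : (ℕ ⊕ ℕ → Fin N) → E}
    (hgh : ∀ i ∈ Q, g i = h i) {i : ℕ ⊕ ℕ → Fin N} (hi : i ∈ Q) :
    trans q x w b k g i = trans q x w b k h i := by
  induction k generalizing g h with
  | zero => exact hgh i hi
  | succ k ih =>
    rw [trans_succ, trans_succ]
    refine ih (fun c hc => hQ c (hc.trans k.lt_succ_self)) fun j hj => ?_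
    rw [rbar_eq, rbar_eq, Pi.smul_apply, Pi.smul_apply, rop_apply, rop_apply, hgh j hj,
      hgh _ (hQ k k.lt_succ_self j hj)]

theorem prod_map_mul_range {B : Type*} [Monoid B] (F G : ℕ → B) (n : ℕ)
    (h : ∀ a b, a < b → b < n → Commute (G a) (F b)) :
    ((List.range n).map fun a => F a * G a).prod =
      ((List.range n).map F).prod * ((List.range n).map G).prod := by
  induction n with
  | zero => simp
  | succ n ih =>
    have hc : Commute ((List.range n).map G).prod (F n) := by
      refine Commute.list_prod_left _ _ fun g hg => ?_
      obtain ⟨a, ha, rfl⟩ := List.mem_map.1 hg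
      exact h a n (List.mem_range.1 ha) n.lt_succ_self
    simp only [List.range_succ, List.map_append, List.prod_append, List.map_singleton,
      List.prod_singleton, ih fun a b h1 h2 => h a b h1 (by omega)]
    rw [mul_assoc, mul_assoc, ← mul_assoc _ (F n), hc.eq]
    simp only [mul_assoc]

theorem map_finRange_eq {B : Type*} (m : ℕ) (f : Fin m → B) (g : ℕ → B)
    (h : ∀ a : Fin m, f a = g a) : (List.finRange m).map f = (List.range m).map g := by
  rw [← List.map_coe_finRange_eq_range, List.map_map]
  exact List.map_congr_left fun a _ => h a

theorem prod_map_filter_finRange {B : Type*} [Monoid B] {m : ℕ} (a : Fin m) (f : Fin m → B)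
    (g : ℕ → B) (h : ∀ b : Fin m, f b = g b) :
    (((List.finRange m).filter fun b => a < b).map f).prod =
      (((List.range m).filter fun b => a.val < b).map g).prod := by
  rw [← List.map_coe_finRange_eq_range, List.filter_map, List.map_map]
  congr 1
  exact List.map_congr_left fun a _ => h a

/-- The operator `X` acts on the tensor factors in `s` only. -/
structure ActsOn {B : Type*} [Zero B] {m : ℕ} (s : Set (Fin m))
    (X : Matrix (Fin m → Fin N) (Fin m → Fin N) B) : Prop where
  eq_zero : ∀ i j, (∃ k, k ∉ s ∧ i k ≠ j k) → X i j = 0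
  congr : ∀ i j i' j', (∀ k ∈ s, i k = i' k) → (∀ k ∈ s, j k = j' k) → (∀ k, k ∉ s → i k = j k) →
    (∀ k, k ∉ s → i' k = j' k) → X i j = X i' j'

theorem actsOn_onFactor {B : Type*} [Zero B] {m : ℕ} (a : Fin m) (T : Matrix (Fin N) (Fin N) B) :
    ActsOn {a} (onFactor a T) where
  eq_zero i j h := by
    obtain ⟨k, hk, h⟩ := h
    exact if_neg fun h' => h (h' k hk)
  congr i j i' j' h1 h2 h3 h4 := by
    refine (if_pos h3).trans (Eq.trans ?_ (if_pos h4).symm)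
    rw [h1 a rfl, h2 a rfl]

theorem actsOn_onFactors {B : Type*} [Zero B] {m : ℕ} (a b : Fin m)
    (T : Matrix (Fin N × Fin N) (Fin N × Fin N) B) : ActsOn {a, b} (onFactors a b T) where
  eq_zero i j h := by
    obtain ⟨k, hk, h⟩ := h
    simp only [Set.mem_insert_iff, Set.mem_singleton_iff, not_or] at hk
    exact if_neg fun h' => h (h' k hk.1 hk.2)
  congr i j i' j' h1 h2 h3 h4 := by
    rw [onFactors, onFactors, if_pos, if_pos, h1 a (by simp), h2 a (by simp), h1 b (by simp),
      h2 b (by simp)]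
    · exact fun k h h' => h4 k (by simp [h, h'])
    · exact fun k h h' => h3 k (by simp [h, h'])

theorem ActsOn.mul_apply {B : Type*} [Ring B] {m : ℕ} {s t : Set (Fin m)} (hst : Disjoint s t)
    {X Y : Matrix (Fin m → Fin N) (Fin m → Fin N) B} (hX : ActsOn s X) (hY : ActsOn t Y)
    {i j z : Fin m → Fin N} (hz : ∀ k ∈ s, z k = j k)
    (hz' : ∀ k, k ∉ s → z k = i k) : (X * Y) i j = X i z * Y z j := by
  rw [Matrix.mul_apply, Finset.sum_eq_single z _ (by simp)]
  intro y _ hy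
  by_cases h1 : ∃ k, k ∉ s ∧ i k ≠ y k
  · rw [hX.eq_zero _ _ h1, zero_mul]
  · push Not at h1
    rw [hY.eq_zero, mul_zero]
    by_contra! h2
    apply hy
    funext k
    by_cases hk : k ∈ s
    · rw [hz k hk, h2 k (Set.disjoint_left.1 hst hk)]
    · rw [hz' k hk, h1 k hk]

theorem ActsOn.commute {B : Type*} [Ring B] {m : ℕ} {s t : Set (Fin m)} (hst : Disjoint s t)
    {X Y : Matrix (Fin m → Fin N) (Fin m → Fin N) B} (hX : ActsOn s X) (hY : ActsOn t Y)
    (hXY : ∀ i j i' j', Commute (X i j) (Y i' j')) : Commute X Y := by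
  classical
  ext i j
  by_cases h : ∀ k, k ∉ s → k ∉ t → i k = j k
  · rw [hX.mul_apply hst hY (z := fun k => if k ∈ s then j k else i k)
      (fun k hk => if_pos hk) (fun k hk => if_neg hk),
      hY.mul_apply hst.symm hX (z := fun k => if k ∈ t then j k else i k)
      (fun k hk => if_pos hk) (fun k hk => if_neg hk), (hXY _ _ _ _).eq]
    congr 1
    · refine hY.congr _ _ _ _ (fun k hk => if_neg (Set.disjoint_right.1 hst hk))
        (fun k hk => (if_pos hk).symm) ?_ fun k hk => (if_neg hk).symm
      intro k hk
      by_cases hs : k ∈ s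
      · exact if_pos hs
      · exact (if_neg hs).trans (h k hs hk)
    · refine hX.congr _ _ _ _ (fun k hk => (if_neg (Set.disjoint_left.1 hst hk)).symm)
        (fun k hk => if_pos hk) (fun k hk => (if_neg hk).symm) ?_
      intro k hk
      by_cases ht : k ∈ t
      · exact if_pos ht
      · exact (if_neg ht).trans (h k hk ht)
  · push Not at h
    obtain ⟨k, hs, ht, hk⟩ := h
    rw [Matrix.mul_apply, Matrix.mul_apply, Finset.sum_eq_zero, Finset.sum_eq_zero]
    · intro z _
      by_cases hz : i k = z k
      · rw [hX.eq_zero z j ⟨k, hs, hz ▸ hk⟩, mul_zero]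
      · rw [hY.eq_zero i z ⟨k, ht, hz⟩, zero_mul]
    · intro z _
      by_cases hz : i k = z k
      · rw [hY.eq_zero z j ⟨k, ht, hz ▸ hk⟩, mul_zero]
      · rw [hX.eq_zero i z ⟨k, hs, hz⟩, zero_mul]

/-- The positions `p k` of the first `m` factors. -/
def restrict (m : ℕ) (p : ℕ → ℕ ⊕ ℕ) (i : ℕ ⊕ ℕ → Fin N) : Fin m → Fin N := fun a => i (p a)

theorem restrict_update {m : ℕ} (a : Fin m) (i : ℕ ⊕ ℕ → Fin N) (v : Fin N) :
    restrict m inr (Function.update i (inr a.val) v) = Function.update (restrict m inr i) a v := by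
  funext k
  by_cases hk : k = a
  · subst hk
    simp [restrict]
  · rw [Function.update_of_ne hk, restrict, Function.update_of_ne, restrict]
    simpa [Fin.ext_iff] using hk

theorem restrict_update_inl {m : ℕ} (a : Fin m) (i : ℕ ⊕ ℕ → Fin N) (v : Fin N) :
    restrict m inl (Function.update i (inr a.val) v) = restrict m inl i := by
  funext k
  rw [restrict, Function.update_of_ne (by simp), restrict]

variable (q : ℂ) (x w : ℕ → ℕ → K) (S : ℕ → Fin N → Fin N → E) (m : ℕ)

/-- The operator `S_a` on `m` tensor factors. -/
noncomputable def factorOp (a : ℕ) : Matrix (Fin m → Fin N) (Fin m → Fin N) E :=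
  if h : a < m then onFactor ⟨a, h⟩ (Matrix.of (S a)) else 1

/-- The operator `R̄^t_{ab}` on `m` tensor factors. -/
noncomputable def rbarOp (a b : ℕ) : Matrix (Fin m → Fin N) (Fin m → Fin N) E :=
  if h : a < m ∧ b < m then onFactors ⟨a, h.1⟩ ⟨b, h.2⟩
    ((w a b • transposeFirst (RMatrix q N (x a b) 1)).map (algebraMap K E)) else 1

/-- The operator `⟨S_0, …, S_{k-1}⟩` on `m` tensor factors. -/
noncomputable def bracketOp (k : ℕ) : Matrix (Fin m → Fin N) (Fin m → Fin N) E :=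
  ((List.range k).map fun a => factorOp S m a *
    (((List.range k).filter fun b => a < b).map (rbarOp q x w m a)).prod).prod

theorem commute_rbarOp {a b : ℕ} {s : Set (Fin m)}
    {Y : Matrix (Fin m → Fin N) (Fin m → Fin N) E} (hY : ActsOn s Y)
    (ha : ∀ k ∈ s, k.val ≠ a ∧ k.val ≠ b) : Commute (rbarOp q x w m a b) Y := by
  rw [rbarOp]
  split_ifs with h
  · refine (actsOn_onFactors _ _ _).commute ?_ hY ?_
    · rw [Set.disjoint_right]
      intro k hk h'
      have := ha k hk
      simp only [Set.mem_insert_iff, Set.mem_singleton_iff, Fin.ext_iff] at h'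
      omega
    · intro i j i' j'
      simp only [onFactors]
      split_ifs
      · exact Algebra.commutes _ _
      · exact Commute.zero_left _
  · exact Commute.one_left _

theorem commute_rbarOp_factorOp {a b c : ℕ} (hac : a ≠ c) (hbc : b ≠ c) :
    Commute (rbarOp q x w m a b) (factorOp S m c) := by
  rw [factorOp]
  split_ifs with h
  · refine commute_rbarOp q x w m (actsOn_onFactor _ _) ?_
    rintro k rfl
    exact ⟨hac.symm, hbc.symm⟩
  · exact Commute.one_right _

theorem commute_rbarOp_rbarOp {a b c d : ℕ} (hac : a ≠ c) (hbc : b ≠ c) (had : a ≠ d)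
    (hbd : b ≠ d) :
    Commute (rbarOp q x w m a b : Matrix _ _ E) (rbarOp q x w m c d : Matrix (Fin m → Fin N) _ E) := by
  rw [rbarOp.eq_def q x w m c d]
  split_ifs with h
  · refine commute_rbarOp q x w m (actsOn_onFactors _ _ _) ?_
    rintro k (rfl | rfl)
    · exact ⟨hac.symm, hbc.symm⟩
    · exact ⟨had.symm, hbd.symm⟩
  · exact Commute.one_right _

/-- For a < b < k the operator R̄^t_{ak} commutes with S_b and with R̄^t_{bc}, b < c < k, which act
on other factors. Moving all R̄^t_{ak} to the right turns the definition into a recursion that adds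
one matrix at a time. -/
theorem bracketOp_succ (k : ℕ) : bracketOp q x w S m (k + 1) =
    bracketOp q x w S m k * ((List.range k).map fun a => rbarOp q x w m a k).prod *
      factorOp S m k := by
  have h0 : (List.range k).filter (fun b => k < b) = [] := by
    rw [List.filter_eq_nil_iff]
    intro b hb
    simpa using (List.mem_range.1 hb).le
  have h1 : (List.range k).map (fun a => factorOp S m a *
      (((List.range (k + 1)).filter fun b => a < b).map (rbarOp q x w m a)).prod) =
      (List.range k).map fun a => (factorOp S m a *
      (((List.range k).filter fun b => a < b).map (rbarOp q x w m a)).prod) * rbarOp q x w m a k := by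
    refine List.map_congr_left fun a ha => ?_
    rw [List.range_succ, List.filter_append, List.map_append, List.prod_append, mul_assoc,
      List.filter_singleton]
    simp [List.mem_range.1 ha]
  rw [bracketOp, List.range_succ, List.map_append, List.prod_append, ← List.range_succ, h1,
    prod_map_mul_range, bracketOp]
  · congr 1
    simp [List.range_succ, List.filter_append, h0, List.filter_singleton]
  · intro a b hab hbk
    refine (commute_rbarOp_factorOp q x w S m (by omega) (by omega)).mul_right ?_
    refine Commute.list_prod_right _ _ fun y hy => ?_
    obtain ⟨c, hc, rfl⟩ := List.mem_map.1 hy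
    simp only [List.mem_filter, List.mem_range, decide_eq_true_eq] at hc
    exact commute_rbarOp_rbarOp q x w m (by omega) (by omega) (by omega) (by omega)

-- Before S_k is multiplied in, the k-th factor carries the identity, whose entries enter as a
-- Kronecker delta. Right multiplication by R̄^t_{ak} sums over the columns of a and k, whereas
-- `trans` acts on the column of a and the row of k; the delta identifies the two.
open Classical in
theorem mul_prod_rbarOp_apply {k : ℕ} (hk : k < m) (H : Matrix (Fin m → Fin N) (Fin m → Fin N) E)
    {β : (ℕ ⊕ ℕ → Fin N) → E} (hβ : DependsOn β (before k))
    (hH : ∀ i, H (restrict m inl i) (restrict m inr i) =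
      if ∀ n, k ≤ n → n < m → i (inl n) = i (inr n) then β i else 0) (l : ℕ) (hl : l ≤ k)
    (i : ℕ ⊕ ℕ → Fin N) :
    (H * ((List.range l).map fun a => rbarOp q x w m a k).prod :
      Matrix (Fin m → Fin N) (Fin m → Fin N) E)
      (restrict m inl i) (restrict m inr i) =
      if ∀ n, k < n → n < m → i (inl n) = i (inr n) then
        trans q x w k l (β * entry (fun _ r c => if r = c then 1 else 0) k) i else 0 := by
  induction l generalizing i with
  | zero =>
    rw [List.range_zero, List.map_nil, List.prod_nil, mul_one, hH, trans_zero, Pi.mul_apply, entry]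
    by_cases h : i (inl k) = i (inr k)
    · rw [if_pos h, mul_one]
      congr 1
      rw [eq_iff_iff]
      constructor
      · exact fun h' n h1 h2 => h' n h1.le h2
      · intro h' n h1 h2
        rcases h1.eq_or_lt with rfl | h1
        · exact h
        · exact h' n h1 h2
    · rw [if_neg h, mul_zero, ite_self, if_neg fun h' => h (h' k le_rfl hk)]
  | succ l ih =>
    have hlk : l < k := hl
    rw [List.range_succ, List.map_append, List.prod_append, List.map_singleton, List.prod_singleton,
      ← mul_assoc, rbarOp, dif_pos ⟨hlk.trans hk, hk⟩,
      mul_onFactors_apply (by simpa [Fin.ext_iff] using hlk.ne)]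
    have hu : ∀ v y, restrict m inr (Function.update (Function.update i (inr l) v) (inr k) y) =
        Function.update (Function.update (restrict m inr i) ⟨l, hlk.trans hk⟩ v) ⟨k, hk⟩ y := by
      intro v y
      rw [← restrict_update, ← restrict_update]
    have hu' : ∀ v y, restrict m inl (Function.update (Function.update i (inr l) v) (inr k) y) =
        restrict m inl i := by
      intro v y
      exact (restrict_update_inl ⟨k, hk⟩ _ y).trans (restrict_update_inl ⟨l, hlk.trans hk⟩ _ v)
    have h1 : ∀ v y, (H * ((List.range l).map fun a => rbarOp q x w m a k).prod :
        Matrix (Fin m → Fin N) (Fin m → Fin N) E)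
        (restrict m inl i)
        (Function.update (Function.update (restrict m inr i) ⟨l, hlk.trans hk⟩ v) ⟨k, hk⟩ y) =
        if ∀ n, k < n → n < m → i (inl n) = i (inr n) then
        trans q x w k l (β * entry (fun _ r c => if r = c then 1 else 0) k)
          (Function.update (Function.update i (inr l) v) (inr k) y) else 0 := by
      intro v y
      rw [← hu, ← hu' v y, ih hlk.le]
      congr 1
      rw [eq_iff_iff]
      refine forall_congr' fun n => forall_congr' fun hn => forall_congr' fun hn' => ?_
      rw [Function.update_of_ne (by simp), Function.update_of_ne (by simp),
        Function.update_of_ne (by simpa using by omega),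
        Function.update_of_ne (by simpa using by omega)]
    set F : (ℕ ⊕ ℕ → Fin N) → E := β * entry (fun _ r c => if r = c then 1 else 0) k with hF
    set e : Fin N → Fin N → E := fun v y => algebraMap K E (w l k *
      ((if v = i (inr l) then if i (inr k) = y then diagCoeff q (x l k) 1 (i (inr l)) y else 0
        else 0) +
      if i (inr k) = i (inr l) then if v = y then swapCoeff q (x l k) 1 (i (inr l)) y else 0
        else 0)) with he
    have h1' : ∀ v y, ((w l k • transposeFirst (RMatrix q N (x l k) 1)).map (algebraMap K E)) (v, y)
        (restrict m inr i ⟨l, hlk.trans hk⟩, restrict m inr i ⟨k, hk⟩) = e v y := by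
      intro v y
      rw [Matrix.map_apply, Matrix.smul_apply, transposeFirst, RMatrix_apply]
      rfl
    simp only [h1, h1']
    split_ifs with hc
    · simp only [← trans_mul_const]
      have h2 := fun v => trans_sum_update (q := q) (x := x) (w := w) (p := inr k) (b := k) (k := l)
        (by simp) (fun c hc => by simpa using by omega) (fun y j => F j * e v y)
        (Function.update i (inr l) v)
      simp only [← h2]
      have h3 := trans_sum_update (q := q) (x := x) (w := w) (p := inr l) (b := k) (k := l)
        (by simp) (fun c hc => by simpa using by omega)
        (fun v j => ∑ y, F (Function.update j (inr k) y) * e v y) i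
      rw [← h3, trans_succ]
      refine trans_congr (Q := {j | j (inr l) = i (inr l) ∧ j (inr k) = i (inr k)}) ?_ ?_ ⟨rfl, rfl⟩
      · rintro c hc j ⟨h4, h5⟩
        refine ⟨?_, ?_⟩
        · rw [Function.comp_apply, Equiv.swap_apply_of_ne_of_ne (by simpa using by omega) (by simp),
            h4]
        · rw [Function.comp_apply, Equiv.swap_apply_of_ne_of_ne (by simpa using by omega) (by simp),
            h5]
      · rintro j ⟨h4, h5⟩
        have hβ' : ∀ v y, β (Function.update (Function.update j (inr l) v) (inr k) y) =
            β (Function.update j (inr l) v) := fun v y => hβ fun n hn =>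
          Function.update_of_ne (by
            rintro rfl
            simp at hn) _ _
        have hs : β (j ∘ Equiv.swap (inr l) (inl k)) = β (Function.update j (inr l) (j (inl k))) := by
          refine hβ fun n hn => ?_
          by_cases hnl : n = inr l
          · subst hnl
            rw [Function.comp_apply, Equiv.swap_apply_left, Function.update_self]
          · rw [Function.comp_apply, Equiv.swap_apply_of_ne_of_ne hnl, Function.update_of_ne hnl]
            rintro rfl
            simp at hn
        have hkl : (inr k : ℕ ⊕ ℕ) ≠ inr l := by simpa using hlk.ne'
        have hj : Function.update j (inr l) (i (inr l)) = j := by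
          rw [← h4, Function.update_eq_self]
        simp only [hF, he, Pi.mul_apply, entry, Function.update_self, hβ',
          Function.update_of_ne (show (inl k : ℕ ⊕ ℕ) ≠ inr k by simp),
          Function.update_of_ne (show (inl k : ℕ ⊕ ℕ) ≠ inr l by simp)]
        simp only [mul_ite, mul_one, mul_zero, ite_mul, zero_mul,
          mul_add, map_add, Finset.sum_add_distrib, apply_ite (algebraMap K E), map_zero]
        rw [rbar_eq, Pi.smul_apply, rop_apply, Pi.mul_apply, Pi.mul_apply, entry, entry, hs,
          Function.comp_apply, Function.comp_apply, Equiv.swap_apply_right,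
          Equiv.swap_apply_of_ne_of_ne hkl (by simp), h4, h5]
        have hc1 : ∀ (a : K) (b : E), b * algebraMap K E (w l k * a) = w l k • a • b := by
          intro a b
          rw [← Algebra.commutes, ← Algebra.smul_def, mul_smul]
        -- The deltas in R^t and in the identity leave one term of each double sum: the diagonal
        -- term and the exchanged one.
        rw [Finset.sum_eq_single (i (inr l)) (by intro b _ hb; simp [hb]) (by simp),
          Finset.sum_eq_single (j (inl k)) (by intro b _ hb; simp [hb.symm]) (by simp),
          Finset.sum_eq_single (j (inl k)) (by
            intro b _ hb
            refine Finset.sum_eq_zero fun y _ => ?_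
            split_ifs <;> simp_all) (by simp),
          Finset.sum_eq_single (j (inl k)) (by intro b _ hb; simp [hb.symm]) (by simp), hj]
        simp only [if_true, hc1, eq_comm (a := i (inr k)) (b := j (inl k)),
          eq_comm (a := i (inr k)) (b := i (inr l)), smul_add, mul_ite, mul_one, mul_zero,
          smul_ite, smul_zero]
    · simp

-- Contracting the Kronecker delta of the k-th factor with S_k replaces it by an entry of S_k, which
-- is the recursion for `brk`. The factors from k on are still the identity.
open Classical in
theorem bracketOp_apply (k : ℕ) (hk : k ≤ m) (i : ℕ ⊕ ℕ → Fin N) :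
    bracketOp q x w S m k (restrict m inl i) (restrict m inr i) =
      if ∀ n, k ≤ n → n < m → i (inl n) = i (inr n) then brk q x w S k i else 0 := by
  induction k generalizing i with
  | zero =>
    rw [bracketOp, List.range_zero, List.map_nil, List.prod_nil, Matrix.one_apply]
    congr 1
    rw [eq_iff_iff, funext_iff, Fin.forall_iff]
    exact ⟨fun h n _ h' => h n h', fun h n h' => h n n.zero_le h'⟩
  | succ k ih =>
    have hkm : k < m := hk
    rw [bracketOp_succ, factorOp, dif_pos hkm, mul_onFactor_apply]
    have h1 : ∀ v, (bracketOp q x w S m k *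
        ((List.range k).map fun a => rbarOp q x w m a k).prod :
        Matrix (Fin m → Fin N) (Fin m → Fin N) E) (restrict m inl i)
        (Function.update (restrict m inr i) ⟨k, hkm⟩ v) =
        if ∀ n, k + 1 ≤ n → n < m → i (inl n) = i (inr n) then
        trans q x w k k (brk q x w S k * entry (fun _ r c => if r = c then 1 else 0) k)
          (Function.update i (inr k) v) else 0 := by
      intro v
      rw [← restrict_update, ← restrict_update_inl ⟨k, hkm⟩ i v,
        mul_prod_rbarOp_apply q x w m hkm _ (dependsOn_brk k) (ih hkm.le) k le_rfl]
      congr 1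
      rw [eq_iff_iff]
      refine forall_congr' fun n => forall_congr' fun hn => forall_congr' fun hn' => ?_
      rw [Function.update_of_ne (by simp), Function.update_of_ne (by simpa using by omega)]
    simp only [h1, Matrix.of_apply]
    split_ifs with hc
    · set F : (ℕ ⊕ ℕ → Fin N) → E :=
        brk q x w S k * entry (fun _ r c => if r = c then 1 else 0) k with hF
      have h3 := trans_sum_update (q := q) (x := x) (w := w) (p := inr k) (b := k) (k := k)
        (by simp) (fun c hc => by simpa using by omega)
        (fun v j => F j * S k v (i (inr k))) i
      simp only [trans_mul_const] at h3
      refine h3.symm.trans ?_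
      rw [brk_succ]
      refine trans_congr (Q := {j | j (inr k) = i (inr k)}) ?_ ?_ rfl
      · intro c hc j hj
        change (j ∘ _) _ = _
        rw [Function.comp_apply, Equiv.swap_apply_of_ne_of_ne (by simpa using by omega) (by simp)]
        exact hj
      · intro j hj
        have hb : ∀ v, brk q x w S k (Function.update j (inr k) v) = brk q x w S k j :=
          fun v => dependsOn_brk k fun n hn => Function.update_of_ne (by
            rintro rfl
            simp at hn) _ _
        simp only [hF, Pi.mul_apply, entry, Function.update_self, hb,
          Function.update_of_ne (show (inl k : ℕ ⊕ ℕ) ≠ inr k by simp)]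
        simp [show j (inr k) = i (inr k) from hj]
    · simp

/-- Only Z = R ∘ σ contributes, with the weight q^{inv(R) − inv(R∘σ)}; the part independent of σ is
taken out. -/
theorem sum_qPerm_mul (B : Matrix (Fin m → Fin N) (Fin m → Fin N) E) (hq : q ≠ 0) (R C : ℕ → Fin N)
    (h : (ℕ ⊕ ℕ → Fin N) → E) (hB : ∀ i, B (restrict m inl i) (restrict m inr i) = h i) :
    ∑ σ : Equiv.Perm (Fin m), ∑ Z, algebraMap ℂ K (((Equiv.Perm.sign σ : ℤ) : ℂ) *
      qPerm q N σ (fun a => R a) Z) • B Z (fun a => C a) =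
      algebraMap ℂ K (q ^ seqInv m R) • rowAlt K q m h R C := by
  rw [rowAlt, Finset.smul_sum]
  refine Finset.sum_congr rfl fun σ _ => ?_
  rw [Finset.sum_eq_single (fun a : Fin m => permute R σ a)]
  · rw [smul_smul, ← map_mul]
    have hc : ((Equiv.Perm.sign σ : ℤ) : ℂ) * qPerm q N σ (fun a => R a) (fun a => permute R σ a) =
        q ^ seqInv m R * altCoeff q R σ := by
      rw [permute_fin, qPerm, if_pos, altCoeff, seqInv, seqInv, permute_fin, zpow_sub₀ hq,
        zpow_natCast, zpow_natCast]
      · ring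
      · funext a
        simp
    rw [hc, ← hB]
    rfl
  · intro Z _ hZ
    rw [qPerm, if_neg, mul_zero, map_zero, zero_smul]
    intro h'
    apply hZ
    rw [permute_fin, h']
    funext a
    simp
  · simp

end Link

/-! ### Sklyanin minors in terms of functions of indices -/

section Series

open Sum PowerSeries

variable {A : Type*} [Ring A] [Algebra ℂ A] {N : ℕ}

/-- The parameters `u_a⁻¹ u_b⁻¹` of a Sklyanin minor. -/
noncomputable def sklyaninParam (q : ℂ) (a b : ℕ) : ℂ⟦X⟧ := C (q ^ (2 * a + 2 * b)) * X ^ 2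

/-- The inverses of `u_a⁻¹ u_b⁻¹ - 1`. -/
noncomputable def sklyaninInv (q : ℂ) (a b : ℕ) : ℂ⟦X⟧ := (sklyaninParam q a b - 1)⁻¹

theorem sklyaninInv_mul (q : ℂ) (a b : ℕ) : sklyaninInv q a b * (sklyaninParam q a b - 1) = 1 := by
  refine PowerSeries.inv_mul_cancel _ ?_
  simp [sklyaninParam]

/-- The sequence of the matrices `S(q^{-2a} u)`. -/
noncomputable def shifts (q : ℂ) (S : Matrix (Fin N) (Fin N) A⟦X⟧) (a : ℕ) (r c : Fin N) : A⟦X⟧ :=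
  scaleVar (q ^ (-2 * (a : ℤ))) (S r c)

theorem algebraMap_C_smul (c : ℂ) (f : A⟦X⟧) : (C c : ℂ⟦X⟧) • f = c • f := by
  rw [Algebra.smul_def, RingHom.algebraMap_toAlgebra', PowerSeries.map_C]
  ext n
  rw [coeff_C_mul, coeff_smul, Algebra.smul_def]

theorem bracket_eq (q : ℂ) (S : Matrix (Fin N) (Fin N) A⟦X⟧) (m : ℕ) :
    bracket q S m = bracketOp q (sklyaninParam q) (sklyaninInv q) (shifts q S) m m := by
  rw [bracket, bracketOp]
  congr 1
  refine map_finRange_eq m _ _ fun a => ?_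
  rw [bracketFactor]
  congr 1
  · rw [factorOp, dif_pos a.2]
    rfl
  · refine prod_map_filter_finRange a _ _ fun b => ?_
    rw [rbarOp, dif_pos ⟨a.2, b.2⟩]
    rfl

theorem sklyaninMinor_eq {q : ℂ} (hq : q ≠ 0) (S : Matrix (Fin N) (Fin N) A⟦X⟧) (m : ℕ)
    (R C : ℕ → Fin N) : sklyaninMinor q S (fun a : Fin m => R a) (fun a : Fin m => C a) =
      q ^ seqInv m R • minor q (sklyaninParam q) (sklyaninInv q) (shifts q S) m R C := by
  rw [← algebraMap_C_smul, minor]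
  refine Eq.trans ?_ (sum_qPerm_mul (K := ℂ⟦X⟧) q m (bracket q S m) hq R C _ fun i => ?_)
  · rw [sklyaninMinor, Matrix.mul_apply, Finset.sum_comm, Finset.smul_sum]
    refine Finset.sum_congr rfl fun Z _ => ?_
    rw [← Finset.sum_smul, ← map_sum, Matrix.map_apply, qAntisymmetrizer, Matrix.smul_apply,
      Matrix.sum_apply]
    simp only [Matrix.smul_apply, smul_eq_mul]
    generalize ∑ σ : Equiv.Perm (Fin m), ((Equiv.Perm.sign σ : ℤ) : ℂ) *
      qPerm q N σ (fun a => R a) Z = c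
    rw [← Algebra.smul_def, mul_smul, ← Nat.cast_smul_eq_nsmul ℂ,
      smul_inv_smul₀ (Nat.cast_ne_zero.2 m.factorial_ne_zero)]
    exact (algebraMap_C_smul _ _).symm
  · rw [bracket_eq, bracketOp_apply _ _ _ _ _ _ le_rfl, if_pos]
    intro n h1 h2
    omega

end Series
end TwistedYangian

namespace TwistedYangian

open Sum

/-! ### The reflection relation for a pair of matrices -/

section Reflects

variable {N : ℕ} {K E : Type*} [CommRing K] [Algebra ℂ K] [Ring E] [Algebra K E]

/-- The product `a_{i 0, j 0} b_{i 1, j 1}` of entries of two matrices, `i` and `j` being the rows and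
columns. -/
def pairLeft (a b : Fin N → Fin N → E) (i : Fin 2 ⊕ Fin 2 → Fin N) : E :=
  a (i (inl 0)) (i (inr 0)) * b (i (inl 1)) (i (inr 1))

/-- The product `b_{i 1, j 1} a_{i 0, j 0}` of entries of two matrices. -/
def pairRight (a b : Fin N → Fin N → E) (i : Fin 2 ⊕ Fin 2 → Fin N) : E :=
  b (i (inl 1)) (i (inr 1)) * a (i (inl 0)) (i (inr 0))

/-- The reflection relation `R(U,V) a_1 R^t(x,1) b_2 = b_2 R^t(x,1) a_1 R(U,V)`. -/
def Reflects (q : ℂ) (a b : Fin N → Fin N → E) (U V x : K) : Prop := ∀ i,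
  rop q (inl 0) (inl 1) U V (rop q (inr 0) (inl 1) x 1 (pairLeft a b)) i =
    rop q (inr 1) (inr 0) U V (rop q (inr 1) (inl 0) x 1 (pairRight a b)) i

/-- R(u,v) is homogeneous of degree one, so common factors of its arguments can be cancelled in the
reflection relation. -/
theorem rop_mul_param {ι L : Type*} [DecidableEq ι] [LinearOrder L] (q : ℂ) (a b : ι) (t u v : K)
    (g : (ι → L) → E) : rop q a b (t * u) (t * v) g = t • rop q a b u v g := by
  funext i
  rw [Pi.smul_apply, rop_apply, rop_apply, smul_add, smul_smul, smul_smul]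
  congr 2
  · simp only [diagCoeff]
    split_ifs <;> ring
  · simp only [swapCoeff]
    split_ifs <;> ring

theorem rop_map {ι L K' E' : Type*} [DecidableEq ι] [LinearOrder L] [CommRing K'] [Algebra ℂ K']
    [Ring E'] [Algebra K' E'] {q : ℂ} (fK : K →+* K') (fE : E →+* E')
    (hK : ∀ c : ℂ, fK (algebraMap ℂ K c) = algebraMap ℂ K' c)
    (hE : ∀ (k : K) (e : E), fE (k • e) = fK k • fE e) (a b : ι) (u v : K) (g : (ι → L) → E)
    (i : ι → L) : fE (rop q a b u v g i) = rop q a b (fK u) (fK v) (fE ∘ g) i := by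
  rw [rop_apply, rop_apply, map_add, hE, hE]
  congr 2
  · simp only [diagCoeff]
    split_ifs <;> simp only [map_sub, map_mul, hK]
  · simp only [swapCoeff]
    split_ifs <;> simp only [map_sub, map_mul, map_zero, hK]

theorem Reflects.map {K' E' : Type*} [CommRing K'] [Algebra ℂ K'] [Ring E'] [Algebra K' E'] {q : ℂ}
    {a b : Fin N → Fin N → E} {U V x : K} (h : Reflects q a b U V x) (fK : K →+* K')
    (fE : E →+* E') (hK : ∀ c : ℂ, fK (algebraMap ℂ K c) = algebraMap ℂ K' c)
    (hE : ∀ (k : K) (e : E), fE (k • e) = fK k • fE e) :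
    Reflects q (fun r c => fE (a r c)) (fun r c => fE (b r c)) (fK U) (fK V) (fK x) := by
  have h1 : (fE ∘ pairLeft a b) = pairLeft (fun r c => fE (a r c)) fun r c => fE (b r c) :=
    funext fun i => map_mul fE _ _
  have h2 : (fE ∘ pairRight a b) = pairRight (fun r c => fE (a r c)) fun r c => fE (b r c) :=
    funext fun i => map_mul fE _ _
  have h3 : ∀ (a b : Fin 2 ⊕ Fin 2) (g : (Fin 2 ⊕ Fin 2 → Fin N) → E),
      fE ∘ rop q a b x 1 g = rop q a b (fK x) 1 (fE ∘ g) := fun a b g => funext fun i => by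
    rw [Function.comp_apply, rop_map fK fE hK hE, map_one]
  intro i
  have := congrArg fE (h i)
  rwa [rop_map fK fE hK hE, rop_map fK fE hK hE, h3, h3, h1, h2] at this

theorem rop_comp_injective {ι ι' L : Type*} [DecidableEq ι] [DecidableEq ι'] [LinearOrder L] (q : ℂ)
    (u v : K) {ρ : ι' → ι} (hρ : Function.Injective ρ) (a b : ι') (g : (ι' → L) → E) (i : ι → L) :
    rop q (ρ a) (ρ b) u v (fun i => g (i ∘ ρ)) i = rop q a b u v g (i ∘ ρ) := by
  rw [rop_apply, rop_apply, Function.comp_assoc, hρ.swap_comp]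
  rfl

theorem Reflects.entry {q : ℂ} {S : ℕ → Fin N → Fin N → E} {m n : ℕ} (hmn : m ≠ n) {U V x : K}
    (h : Reflects q (S m) (S n) U V x) :
    rop q (inl m) (inl n) U V (rop q (inr m) (inl n) x 1 (entry S m * entry S n)) =
      rop q (inr n) (inr m) U V (rop q (inr n) (inl m) x 1 (entry S n * entry S m)) := by
  have hs : Function.Injective (![m, n] : Fin 2 → ℕ) := by
    intro a b
    fin_cases a <;> fin_cases b <;> simp [hmn, hmn.symm]
  have hρ := hs.sumMap hs
  have h1 : ∀ a b, ∀ (u v : K) (g : (Fin 2 ⊕ Fin 2 → Fin N) → E),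
      rop q (Sum.map ![m, n] ![m, n] a) (Sum.map ![m, n] ![m, n] b) u v
        (fun i => g (i ∘ Sum.map ![m, n] ![m, n])) =
        fun i => rop q a b u v g (i ∘ Sum.map ![m, n] ![m, n]) :=
    fun a b u v g => funext fun i => rop_comp_injective q u v hρ a b g i
  have h2 := h1 (inr 0) (inl 1) x 1 (pairLeft (S m) (S n))
  have h3 := h1 (inr 1) (inl 0) x 1 (pairRight (S m) (S n))
  have h4 := h1 (inl 0) (inl 1) U V (rop q (inr 0) (inl 1) x 1 (pairLeft (S m) (S n)))
  have h5 := h1 (inr 1) (inr 0) U V (rop q (inr 1) (inl 0) x 1 (pairRight (S m) (S n)))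
  rw [← h2] at h4
  rw [← h3] at h5
  refine h4.trans (Eq.trans ?_ h5.symm)
  funext i
  exact h _

end Reflects

/-! ### Entries of the two sides of the reflection relation -/

section EntryFormula

variable {N : ℕ} {A : Type*} [Ring A] [Algebra ℂ A]

open PowerSeries

theorem onFactors_mul_apply {B : Type*} [Ring B] {m : ℕ} {a b : Fin m} (hab : a ≠ b)
    (T : Matrix (Fin N × Fin N) (Fin N × Fin N) B)
    (H : Matrix (Fin m → Fin N) (Fin m → Fin N) B) (i j : Fin m → Fin N) :
    (onFactors a b T * H) i j = ∑ v, ∑ y,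
      T (i a, i b) (v, y) * H (Function.update (Function.update i a v) b y) j := by
  classical
  rw [Matrix.mul_apply, ← Fintype.sum_prod_type' (f := fun v y =>
    T (i a, i b) (v, y) * H (Function.update (Function.update i a v) b y) j)]
  symm
  refine Finset.sum_of_injOn (fun v => Function.update (Function.update i a v.1) b v.2) ?_ (by simp)
    ?_ ?_
  · intro v _ v' _ h
    have h1 := congrFun h a
    have h2 := congrFun h b
    simp only [Function.update_of_ne hab, Function.update_self] at h1 h2
    exact Prod.ext h1 h2
  · intro z _ hz
    rw [onFactors, if_neg, zero_mul]
    intro h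
    apply hz
    refine ⟨(z a, z b), by simp, ?_⟩
    funext k
    by_cases hk : k = b
    · subst hk
      simp
    · by_cases hk' : k = a
      · subst hk'
        simp [hk]
      · simp [hk, hk', h k hk' hk]
  · intro v _
    rw [onFactors, if_pos, Function.update_self, Function.update_of_ne hab, Function.update_self]
    intro k hk hk'
    rw [Function.update_of_ne hk', Function.update_of_ne hk]

theorem elim_comp_swap_rows (i j : Fin 2 → Fin N) :
    Sum.elim i j ∘ Equiv.swap (inl 0) (inl 1) =
      Sum.elim (Function.update (Function.update i 0 (i 1)) 1 (i 0)) j := by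
  funext n
  rcases n with n | n <;> fin_cases n <;> rfl

theorem elim_comp_swap_columns (i j : Fin 2 → Fin N) :
    Sum.elim i j ∘ Equiv.swap (inr 1) (inr 0) =
      Sum.elim i (Function.update (Function.update j 0 (j 1)) 1 (j 0)) := by
  funext n
  rcases n with n | n <;> fin_cases n <;> rfl

variable {K E : Type*} [CommRing K] [Algebra ℂ K] [Ring E] [Algebra K E]

theorem RMatrix_mul_apply (q : ℂ) (u v : K) (H : Matrix (Fin 2 → Fin N) (Fin 2 → Fin N) E)
    (i j : Fin 2 → Fin N) :
    (onFactors 0 1 ((RMatrix q N u v).map (algebraMap K E)) * H :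
      Matrix (Fin 2 → Fin N) (Fin 2 → Fin N) E) i j =
      rop q (inl 0) (inl 1) u v (fun i => H (i ∘ inl) (i ∘ inr)) (Sum.elim i j) := by
  rw [onFactors_mul_apply (by simp), rop_apply, elim_comp_swap_rows]
  simp only [Matrix.map_apply, RMatrix_apply, map_add, apply_ite (algebraMap K E), map_zero, add_mul,
    ite_mul, zero_mul, Finset.sum_add_distrib, Finset.sum_ite_eq', Finset.mem_univ, if_true,
    Finset.sum_ite_irrel, Finset.sum_const_zero, ← Algebra.smul_def]
  congr 2
  simp

/-- Multiplication from the right acts on columns through the transposed coefficients, which amounts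
to exchanging the two positions; hence the order 1, 0. -/
theorem mul_RMatrix_apply (q : ℂ) (u v : K) (H : Matrix (Fin 2 → Fin N) (Fin 2 → Fin N) E)
    (i j : Fin 2 → Fin N) :
    (H * onFactors 0 1 ((RMatrix q N u v).map (algebraMap K E)) :
      Matrix (Fin 2 → Fin N) (Fin 2 → Fin N) E) i j =
      rop q (inr 1) (inr 0) u v (fun i => H (i ∘ inl) (i ∘ inr)) (Sum.elim i j) := by
  rw [mul_onFactors_apply (by simp), rop_apply, elim_comp_swap_columns]
  simp only [Matrix.map_apply, RMatrix_apply, map_add, apply_ite (algebraMap K E), map_zero, mul_add,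
    mul_ite, mul_zero, Finset.sum_add_distrib, Finset.sum_ite_eq, Finset.mem_univ, if_true,
    Finset.sum_ite_irrel, Finset.sum_const_zero, ← Algebra.commutes, ← Algebra.smul_def]
  congr 2
  · simp [diagCoeff, eq_comm]
  · simp

/-- Partial transposition turns R^t, placed between two matrices, into R acting on the two inner
indices: the column of the left matrix and the row of the right one. -/
theorem factors_apply_left (q : ℂ) (x : K) (a b : Matrix (Fin N) (Fin N) E) (i j : Fin 2 → Fin N) :
    (onFactor 0 a * onFactors 0 1 ((transposeFirst (RMatrix q N x 1)).map (algebraMap K E)) *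
      onFactor 1 b : Matrix (Fin 2 → Fin N) (Fin 2 → Fin N) E) i j =
      rop q (inr 0) (inl 1) x 1 (pairLeft a b) (Sum.elim i j) := by
  have h1 : ∀ z : Fin 2 → Fin N, onFactor 0 a i z = if i 1 = z 1 then a (i 0) (z 0) else 0 := by
    intro z
    simp [onFactor]
  rw [mul_onFactor_apply]
  simp only [mul_onFactors_apply (show (0 : Fin 2) ≠ 1 by simp), h1, transposeFirst, Matrix.map_apply,
    RMatrix_apply, Function.update_self, Function.update_of_ne (show (0 : Fin 2) ≠ 1 by simp)]
  simp only [ite_mul, zero_mul, Finset.sum_ite_eq, Finset.sum_ite_eq', Finset.mem_univ, if_true, map_add, mul_add,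
    apply_ite (algebraMap K E), map_zero, mul_ite, mul_zero, Finset.sum_add_distrib,
    Finset.sum_ite_irrel, Finset.sum_const_zero, add_mul]
  have hc : ∀ (k : K) (e f : E), e * algebraMap K E k * f = k • (e * f) := fun k e f => by
    rw [← Algebra.commutes, ← Algebra.smul_def, smul_mul_assoc]
  simp only [rop_apply, pairLeft, hc]
  rfl

theorem factors_apply_right (q : ℂ) (x : K) (a b : Matrix (Fin N) (Fin N) E) (i j : Fin 2 → Fin N) :
    (onFactor 1 b * onFactors 0 1 ((transposeFirst (RMatrix q N x 1)).map (algebraMap K E)) *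
      onFactor 0 a : Matrix (Fin 2 → Fin N) (Fin 2 → Fin N) E) i j =
      rop q (inr 1) (inl 0) x 1 (pairRight a b) (Sum.elim i j) := by
  have h1 : ∀ z : Fin 2 → Fin N, onFactor 1 b i z = if i 0 = z 0 then b (i 1) (z 1) else 0 := by
    intro z
    simp [onFactor]
  rw [mul_onFactor_apply]
  simp only [mul_onFactors_apply (show (0 : Fin 2) ≠ 1 by simp), h1, transposeFirst, Matrix.map_apply,
    RMatrix_apply, Function.update_self, Function.update_of_ne (show (0 : Fin 2) ≠ 1 by simp),
    Function.update_of_ne (show (1 : Fin 2) ≠ 0 by simp)]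
  simp only [ite_mul, zero_mul, Finset.sum_ite_eq, Finset.sum_ite_eq', Finset.mem_univ, if_true, map_add, mul_add,
    apply_ite (algebraMap K E), map_zero, mul_ite, mul_zero, Finset.sum_add_distrib,
    Finset.sum_ite_irrel, Finset.sum_const_zero, add_mul]
  have hc : ∀ (k : K) (e f : E), e * algebraMap K E k * f = k • (e * f) := fun k e f => by
    rw [← Algebra.commutes, ← Algebra.smul_def, smul_mul_assoc]
  have hd : diagCoeff q x 1 (i 0) (j 1) = diagCoeff q x 1 (j 1) (i 0) := by
    simp only [diagCoeff, eq_comm]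
  simp only [rop_apply, pairRight, hc, hd]
  rfl

end EntryFormula

/-! ### The reflection relation for series and its specializations -/

section Series

variable {N : ℕ} {A : Type*} [Ring A] [Algebra ℂ A]

open PowerSeries

/-- The reflection relation for the series `S(u)` and `S(v)`. -/
def SeriesReflects (q : ℂ) (S : Matrix (Fin N) (Fin N) A⟦X⟧) : Prop :=
  Reflects (K := ℂ⟦X⟧⟦X⟧) (E := A⟦X⟧⟦X⟧) q (fun i j => C (S i j))
    (fun i j => PowerSeries.map C (S i j)) X (C X) (C X * X)

theorem reflLeft_apply (q : ℂ) (S : Matrix (Fin N) (Fin N) A⟦X⟧) (i j : Fin 2 → Fin N) :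
    reflLeft q S i j = rop (K := ℂ⟦X⟧⟦X⟧) q (inl 0) (inl 1) X (C X)
      (rop (K := ℂ⟦X⟧⟦X⟧) q (inr 0) (inl 1) (C X * X) 1
        (pairLeft (fun i j => C (S i j)) fun i j => PowerSeries.map C (S i j))) (Sum.elim i j) := by
  rw [reflLeft, mul_assoc, mul_assoc]
  refine (RMatrix_mul_apply (K := ℂ⟦X⟧⟦X⟧) (E := A⟦X⟧⟦X⟧) q X (C X) _ i j).trans ?_
  refine congrArg (fun g => rop (K := ℂ⟦X⟧⟦X⟧) q (inl 0) (inl 1) X (C X) g (Sum.elim i j))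
    (funext fun z => ?_)
  rw [← mul_assoc]
  refine (factors_apply_left (K := ℂ⟦X⟧⟦X⟧) (E := A⟦X⟧⟦X⟧) q (C X * X) _ _ _ _).trans ?_
  rw [Sum.elim_comp_inl_inr]
  rfl

theorem reflRight_apply (q : ℂ) (S : Matrix (Fin N) (Fin N) A⟦X⟧) (i j : Fin 2 → Fin N) :
    reflRight q S i j = rop (K := ℂ⟦X⟧⟦X⟧) q (inr 1) (inr 0) X (C X)
      (rop (K := ℂ⟦X⟧⟦X⟧) q (inr 1) (inl 0) (C X * X) 1
        (pairRight (fun i j => C (S i j)) fun i j => PowerSeries.map C (S i j))) (Sum.elim i j) := by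
  rw [reflRight]
  refine (mul_RMatrix_apply (K := ℂ⟦X⟧⟦X⟧) (E := A⟦X⟧⟦X⟧) q X (C X) _ i j).trans ?_
  refine congrArg (fun g => rop (K := ℂ⟦X⟧⟦X⟧) q (inr 1) (inr 0) X (C X) g (Sum.elim i j))
    (funext fun z => ?_)
  refine (factors_apply_right (K := ℂ⟦X⟧⟦X⟧) (E := A⟦X⟧⟦X⟧) q (C X * X) _ _ _ _).trans ?_
  rw [Sum.elim_comp_inl_inr]
  rfl

theorem seriesReflects_iff (q : ℂ) (S : Matrix (Fin N) (Fin N) A⟦X⟧) :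
    SeriesReflects q S ↔ reflLeft q S = reflRight q S := by
  constructor
  · intro h
    ext1 i j
    rw [reflLeft_apply, reflRight_apply]
    exact h _
  · intro h i
    have := congrFun (congrFun h (i ∘ inl)) (i ∘ inr)
    rwa [reflLeft_apply, reflRight_apply, Sum.elim_comp_inl_inr] at this

/-- The effect on series in two variables of a homomorphism of coefficients. -/
noncomputable abbrev mapSeries {B : Type*} [Ring B] [Algebra ℂ B] (f : A →ₐ[ℂ] B) :
    A⟦X⟧⟦X⟧ →+* B⟦X⟧⟦X⟧ := PowerSeries.map (PowerSeries.map (f : A →+* B))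

theorem mapSeries_smul {B : Type*} [Ring B] [Algebra ℂ B] (f : A →ₐ[ℂ] B) (k : ℂ⟦X⟧⟦X⟧)
    (e : A⟦X⟧⟦X⟧) : mapSeries f (k • e) = k • mapSeries f e := by
  rw [Algebra.smul_def, Algebra.smul_def, map_mul]
  congr 1
  ext m n
  simp [mapSeries, RingHom.algebraMap_toAlgebra']

theorem mapSeries_pair {B : Type*} [Ring B] [Algebra ℂ B] (f : A →ₐ[ℂ] B)
    (S : Matrix (Fin N) (Fin N) A⟦X⟧) :
    (mapSeries f ∘ pairLeft (fun i j => C (S i j)) fun i j => PowerSeries.map C (S i j)) =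
      (pairLeft (fun i j => C (S.map (PowerSeries.map (f : A →+* B)) i j))
        fun i j => PowerSeries.map C (S.map (PowerSeries.map (f : A →+* B)) i j)) ∧
    (mapSeries f ∘ pairRight (fun i j => C (S i j)) fun i j => PowerSeries.map C (S i j)) =
      (pairRight (fun i j => C (S.map (PowerSeries.map (f : A →+* B)) i j))
        fun i j => PowerSeries.map C (S.map (PowerSeries.map (f : A →+* B)) i j)) := by
  have h1 : ∀ g : A⟦X⟧, mapSeries f (C g) = C (PowerSeries.map (f : A →+* B) g) := fun g =>
    PowerSeries.map_C _ _
  have h2 : ∀ g : A⟦X⟧, mapSeries f (PowerSeries.map C g) =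
      PowerSeries.map C (PowerSeries.map (f : A →+* B) g) := fun g => by
    ext1 n
    simp [mapSeries]
  constructor <;>
  · funext i
    simp only [Function.comp_apply, pairLeft, pairRight, map_mul, h1, h2, Matrix.map_apply]

theorem reflLeft_map {B : Type*} [Ring B] [Algebra ℂ B] (f : A →ₐ[ℂ] B) (q : ℂ)
    (S : Matrix (Fin N) (Fin N) A⟦X⟧) (i j : Fin 2 → Fin N) :
    reflLeft q (S.map (PowerSeries.map (f : A →+* B))) i j = mapSeries f (reflLeft q S i j) := by
  have h := fun a b u v g i => rop_map (K := ℂ⟦X⟧⟦X⟧) (ι := Fin 2 ⊕ Fin 2) (L := Fin N) (q := q)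
    (RingHom.id _) (mapSeries f) (fun _ => rfl) (mapSeries_smul f) a b u v g i
  have h' := fun a b u v g => funext (h a b u v g)
  rw [reflLeft_apply, reflLeft_apply, h, ← (mapSeries_pair f S).1]
  exact congrArg (fun g => rop (K := ℂ⟦X⟧⟦X⟧) q (inl 0) (inl 1) X (C X) g (Sum.elim i j))
    (h' _ _ _ _ _).symm

theorem reflRight_map {B : Type*} [Ring B] [Algebra ℂ B] (f : A →ₐ[ℂ] B) (q : ℂ)
    (S : Matrix (Fin N) (Fin N) A⟦X⟧) (i j : Fin 2 → Fin N) :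
    reflRight q (S.map (PowerSeries.map (f : A →+* B))) i j = mapSeries f (reflRight q S i j) := by
  have h := fun a b u v g i => rop_map (K := ℂ⟦X⟧⟦X⟧) (ι := Fin 2 ⊕ Fin 2) (L := Fin N) (q := q)
    (RingHom.id _) (mapSeries f) (fun _ => rfl) (mapSeries_smul f) a b u v g i
  have h' := fun a b u v g => funext (h a b u v g)
  rw [reflRight_apply, reflRight_apply, h, ← (mapSeries_pair f S).2]
  exact congrArg (fun g => rop (K := ℂ⟦X⟧⟦X⟧) q (inr 1) (inr 0) X (C X) g (Sum.elim i j))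
    (h' _ _ _ _ _).symm

/-- The homomorphism substituting `c₁ X` for the inner and `c₂ X` for the outer variable. -/
noncomputable def specialize (A : Type*) [Ring A] [Algebra ℂ A] (c₁ c₂ : ℂ) :
    A⟦X⟧⟦X⟧ →+* A⟦X⟧ where
  toFun f := mk fun k => ∑ p ∈ Finset.HasAntidiagonal.antidiagonal k,
    (c₂ ^ p.1 * c₁ ^ p.2) • coeff p.2 (coeff p.1 f)
  map_one' := by
    ext k
    rw [coeff_mk, coeff_one]
    split_ifs with hk
    · subst hk
      simp
    · refine Finset.sum_eq_zero fun p hp => ?_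
      rw [Finset.HasAntidiagonal.mem_antidiagonal] at hp
      rw [coeff_one]
      split_ifs with h
      · rw [coeff_one, if_neg (by omega), smul_zero]
      · rw [map_zero, smul_zero]
  map_mul' f g := by
    ext k
    simp only [coeff_mk, coeff_mul, map_sum, Finset.smul_sum, Finset.sum_mul_sum]
    simp only [Finset.sum_sigma']
    -- Both sides run over 2 × 2 arrays of exponents with sum k, grouped by variable or by factor.
    -- The bijection transposes the array.
    refine Finset.sum_nbij'
      (fun z => ⟨(z.2.1.1 + z.2.2.1, z.2.1.2 + z.2.2.2),
        ⟨(z.2.1.1, z.2.2.1), (z.2.1.2, z.2.2.2)⟩⟩)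
      (fun z => ⟨(z.2.1.1 + z.2.2.1, z.2.1.2 + z.2.2.2),
        ⟨(z.2.1.1, z.2.2.1), (z.2.1.2, z.2.2.2)⟩⟩)
      ?_ ?_ ?_ ?_ ?_
    · rintro ⟨⟨n, m⟩, ⟨⟨n1, n2⟩, m1, m2⟩⟩ h
      simp only [Finset.mem_sigma, Finset.HasAntidiagonal.mem_antidiagonal] at h ⊢
      exact ⟨by omega, trivial, trivial⟩
    · rintro ⟨⟨n, m⟩, ⟨⟨n1, n2⟩, m1, m2⟩⟩ h
      simp only [Finset.mem_sigma, Finset.HasAntidiagonal.mem_antidiagonal] at h ⊢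
      exact ⟨by omega, trivial, trivial⟩
    · rintro ⟨⟨n, m⟩, ⟨⟨n1, n2⟩, m1, m2⟩⟩ h
      simp only [Finset.mem_sigma, Finset.HasAntidiagonal.mem_antidiagonal] at h
      obtain ⟨h1, rfl, rfl⟩ := h
      rfl
    · rintro ⟨⟨n, m⟩, ⟨⟨n1, n2⟩, m1, m2⟩⟩ h
      simp only [Finset.mem_sigma, Finset.HasAntidiagonal.mem_antidiagonal] at h
      obtain ⟨h1, rfl, rfl⟩ := h
      rfl
    · rintro ⟨⟨n, m⟩, ⟨⟨n1, n2⟩, m1, m2⟩⟩ h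
      simp only [Finset.mem_sigma, Finset.HasAntidiagonal.mem_antidiagonal] at h
      obtain ⟨h1, rfl, rfl⟩ := h
      simp only [smul_mul_assoc, mul_smul_comm, smul_smul, pow_add]
      congr 1
      ring
  map_zero' := by
    ext k
    simp
  map_add' f g := by
    ext k
    simp [smul_add, Finset.sum_add_distrib]

theorem coeff_specialize (c₁ c₂ : ℂ) (f : A⟦X⟧⟦X⟧) (k : ℕ) : coeff k (specialize A c₁ c₂ f) =
    ∑ p ∈ Finset.HasAntidiagonal.antidiagonal k, (c₂ ^ p.1 * c₁ ^ p.2) • coeff p.2 (coeff p.1 f) := by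
  simp only [specialize, RingHom.coe_mk, MonoidHom.coe_mk, OneHom.coe_mk, coeff_mk]

theorem specialize_C (c₁ c₂ : ℂ) (f : A⟦X⟧) : specialize A c₁ c₂ (C f) = scaleVar c₁⁻¹ f := by
  ext k
  rw [coeff_specialize, scaleVar, coeff_mk, inv_inv, Finset.sum_eq_single (0, k)]
  · simp
  · rintro ⟨n, m⟩ h hne
    rw [Finset.HasAntidiagonal.mem_antidiagonal] at h
    rw [coeff_C, if_neg, map_zero, smul_zero]
    rintro rfl
    apply hne
    simpa using h
  · simp

theorem specialize_map_C (c₁ c₂ : ℂ) (f : A⟦X⟧) :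
    specialize A c₁ c₂ (PowerSeries.map C f) = scaleVar c₂⁻¹ f := by
  ext k
  rw [coeff_specialize, scaleVar, coeff_mk, inv_inv, Finset.sum_eq_single (k, 0)]
  · simp
  · rintro ⟨n, m⟩ h hne
    rw [Finset.HasAntidiagonal.mem_antidiagonal] at h
    rw [coeff_map, coeff_C, if_neg, smul_zero]
    rintro rfl
    apply hne
    simpa using h
  · simp

theorem specialize_smul (c₁ c₂ : ℂ) (k : ℂ⟦X⟧⟦X⟧) (e : A⟦X⟧⟦X⟧) :
    specialize A c₁ c₂ (k • e) = specialize ℂ c₁ c₂ k • specialize A c₁ c₂ e := by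
  rw [Algebra.smul_def, Algebra.smul_def, map_mul]
  congr 1
  ext n
  rw [coeff_specialize, RingHom.algebraMap_toAlgebra', RingHom.algebraMap_toAlgebra', coeff_map,
    coeff_specialize, map_sum]
  refine Finset.sum_congr rfl fun p _ => ?_
  rw [coeff_map, coeff_map, smul_eq_mul, map_mul, Algebra.smul_def]

theorem algebraMap_series (c : ℂ) : algebraMap ℂ ℂ⟦X⟧⟦X⟧ c = C (C c) := by
  rw [PowerSeries.algebraMap_apply]
  rfl

theorem scaleVar_C (c d : ℂ) : scaleVar c (C d : ℂ⟦X⟧) = C d := by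
  ext n
  rw [scaleVar, coeff_mk, coeff_C]
  split_ifs with h
  · subst h
    simp
  · simp

theorem scaleVar_X (c : ℂ) : scaleVar c (X : ℂ⟦X⟧) = C c⁻¹ * X := by
  ext n
  rw [scaleVar, coeff_mk, coeff_C_mul, coeff_X]
  split_ifs with h
  · subst h
    simp
  · simp

/-- The substitution is u ↦ q^{-2a}u, v ↦ q^{-2b}u. As R is normalized to R(v⁻¹,u⁻¹), the parameter
of b comes first. -/
theorem SeriesReflects.shifts {q : ℂ} {S : Matrix (Fin N) (Fin N) A⟦X⟧}
    (hS : SeriesReflects q S) (a b : ℕ) :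
    Reflects q (shifts q S a) (shifts q S b) (C (q ^ (2 * b)) * X) (C (q ^ (2 * a)) * X)
      (sklyaninParam q a b) := by
  have h := hS.map (K' := ℂ⟦X⟧) (specialize ℂ (q ^ (2 * a)) (q ^ (2 * b)))
    (specialize A (q ^ (2 * a)) (q ^ (2 * b)))
    (fun c => by rw [algebraMap_series, specialize_C, scaleVar_C]; rfl) (specialize_smul _ _)
  have h1 : ∀ a : ℕ, (q ^ (2 * a))⁻¹ = q ^ (-2 * (a : ℤ)) := fun a => by
    rw [neg_mul, zpow_neg]
    norm_cast
  have hX : (X : ℂ⟦X⟧⟦X⟧) = PowerSeries.map C (X : ℂ⟦X⟧) := (map_X _).symm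
  simp only [specialize_C, specialize_map_C, map_mul, hX, scaleVar_X, inv_inv] at h
  simp only [h1] at h
  have hx : sklyaninParam q a b = C (q ^ (2 * a)) * X * (C (q ^ (2 * b)) * X) := by
    rw [sklyaninParam, pow_add, map_mul]
    ring
  rw [hx]
  exact h

theorem X_smul_injective : Function.Injective fun f : A⟦X⟧ => (X : ℂ⟦X⟧) • f := by
  intro f g h
  have hX : ∀ f : A⟦X⟧, (X : ℂ⟦X⟧) • f = X * f := fun f => by
    rw [Algebra.smul_def, RingHom.algebraMap_toAlgebra', map_X]
  ext n
  have := congrArg (coeff (n + 1)) h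
  simpa only [hX, coeff_succ_X_mul] using this

/-- For neighbours the common factor q^{2k}u⁻¹ cancels by homogeneity and R(q²,1) remains. This is
what the choice u_a = q^{-2a}u is for. -/
theorem fusion_shifts {q : ℂ} (hq : q ≠ 0) {S : Matrix (Fin N) (Fin N) A⟦X⟧}
    (hS : SeriesReflects q S) : Fusion q (sklyaninParam q) (sklyaninInv q) (shifts q S) where
  left k c _ := by
    rw [sklyaninParam, sklyaninParam, show algebraMap ℂ ℂ⟦X⟧ (q ^ 2) = C (q ^ 2) from rfl,
      show 2 * c + 2 * (k + 1) = 2 * c + 2 * k + 2 by ring, pow_add q (2 * c + 2 * k) 2, map_mul]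
    ring
  right k b _ := by
    rw [sklyaninParam, sklyaninParam, show algebraMap ℂ ℂ⟦X⟧ (q ^ 2) = C (q ^ 2) from rfl,
      show 2 * (k + 1) + 2 * b = 2 * k + 2 * b + 2 by ring, pow_add q (2 * k + 2 * b) 2, map_mul]
    ring
  refl k := by
    have h := Reflects.entry (S := TwistedYangian.shifts q S) (by omega) (hS.shifts k (k + 1))
    have hU : C (q ^ (2 * (k + 1))) * X = (C (q ^ (2 * k)) * X) * algebraMap ℂ ℂ⟦X⟧ (q ^ 2) := by
      rw [show algebraMap ℂ ℂ⟦X⟧ (q ^ 2) = C (q ^ 2) from rfl, mul_add, pow_add q, map_mul]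
      ring
    have hV : C (q ^ (2 * k)) * X = (C (q ^ (2 * k)) * X) * (1 : ℂ⟦X⟧) := (mul_one _).symm
    rw [hU] at h
    nth_rw 2 [hV] at h
    nth_rw 4 [hV] at h
    rw [rop_mul_param, rop_mul_param, mul_smul, mul_smul] at h
    refine ⟨sklyaninInv q k (k + 1) • rop q (inr (k + 1)) (inl k) (sklyaninParam q k (k + 1)) 1
      (entry (shifts q S) (k + 1) * entry (shifts q S) k), ?_⟩
    rw [rbar_eq, map_smul, map_smul]
    congr 1
    funext i
    have h2 := algebraMap_smul_left_injective (K := ℂ⟦X⟧) (pow_ne_zero (2 * k) hq) (congrFun h i)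
    exact X_smul_injective h2

end Series
end TwistedYangian

namespace TwistedYangian

open Sum

/-! ### Inverses: the reflection relation and blocks -/

section Inverse

variable {R : Type*} [Ring R]

/-- Inverting everything except r exchanges the roles of the two matrices and replaces k by its
inverse. The result has the same shape, so the lemma can be applied a second time to return. -/
theorem reflection_inverse {r s₁ s₂ t₁ t₂ k l : R} (h : r * s₁ * k * s₂ = s₂ * k * s₁ * r)
    (h₁ : t₁ * s₁ = 1) (h₁' : s₁ * t₁ = 1) (h₂ : t₂ * s₂ = 1) (h₂' : s₂ * t₂ = 1) (hl : l * k = 1)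
    (hl' : k * l = 1) : r * t₂ * l * t₁ = t₁ * l * t₂ * r := by
  have h3 : t₁ * l * t₂ * (r * s₁ * k * s₂) = r := by
    rw [h]
    calc t₁ * l * t₂ * (s₂ * k * s₁ * r) = t₁ * (l * ((t₂ * s₂) * k)) * s₁ * r := by
          simp only [mul_assoc]
      _ = r := by rw [h₂, one_mul, hl, mul_one, h₁, one_mul]
  calc r * t₂ * l * t₁ = t₁ * l * t₂ * (r * s₁ * k * s₂) * t₂ * l * t₁ := by rw [h3]
    _ = t₁ * l * t₂ * r * s₁ * (k * ((s₂ * t₂) * l)) * t₁ := by simp only [mul_assoc]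
    _ = t₁ * l * t₂ * r := by rw [h₂', one_mul, hl', mul_one, mul_assoc, h₁', mul_one]

variable {N M : ℕ}

theorem submatrix_mul_block {ι κ : Type*} (S T : Matrix (Fin (N + M)) (Fin (N + M)) R)
    (e : ι → Fin (N + M)) (f : κ → Fin (N + M)) :
    (S * T).submatrix e f = S.submatrix e (Fin.castAdd M) * T.submatrix (Fin.castAdd M) f +
      S.submatrix e (Fin.natAdd N) * T.submatrix (Fin.natAdd N) f := by
  ext i j
  rw [Matrix.submatrix_apply, Matrix.mul_apply, Fin.sum_univ_add]
  rfl

theorem one_submatrix_castAdd_natAdd :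
    (1 : Matrix (Fin (N + M)) (Fin (N + M)) R).submatrix (Fin.castAdd M) (Fin.natAdd N) = 0 := by
  ext i j
  rw [Matrix.submatrix_apply, Matrix.one_apply_ne (castAdd_lt_natAdd i j).ne, Matrix.zero_apply]

theorem one_submatrix_natAdd_castAdd :
    (1 : Matrix (Fin (N + M)) (Fin (N + M)) R).submatrix (Fin.natAdd N) (Fin.castAdd M) = 0 := by
  ext i j
  rw [Matrix.submatrix_apply, Matrix.one_apply_ne (castAdd_lt_natAdd j i).ne', Matrix.zero_apply]

theorem of_schur (S : Matrix (Fin (N + M)) (Fin (N + M)) R) (G : Matrix (Fin M) (Fin M) R) :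
    Matrix.of (schur S G) = S.submatrix (Fin.castAdd M) (Fin.castAdd M) -
      S.submatrix (Fin.castAdd M) (Fin.natAdd N) * G * S.submatrix (Fin.natAdd N) (Fin.castAdd M) := by
  ext i j
  simp only [Matrix.of_apply, schur, Matrix.sub_apply, Matrix.submatrix_apply, Matrix.mul_apply,
    Finset.sum_mul]
  rw [Finset.sum_comm]

/-- The submatrix with the first `N` rows and columns. -/
def subI (S : Matrix (Fin (N + M)) (Fin (N + M)) R) : Matrix (Fin N) (Fin N) R :=
  S.submatrix (Fin.castAdd M) (Fin.castAdd M)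

/-- The submatrix with the last `M` rows and columns. -/
def subLast (S : Matrix (Fin (N + M)) (Fin (N + M)) R) : Matrix (Fin M) (Fin M) R :=
  S.submatrix (Fin.natAdd N) (Fin.natAdd N)

/-- The I-block of S⁻¹ is the inverse of the Schur complement. The entries do not commute, so the
two one-sided identities are proved separately. -/
theorem subI_inv_mul_schur {S T : Matrix (Fin (N + M)) (Fin (N + M)) R} (hTS : T * S = 1)
    {G : Matrix (Fin M) (Fin M) R} (hG : subLast S * G = 1) : subI T * Matrix.of (schur S G) = 1 := by
  have h1 := submatrix_mul_block T S (Fin.castAdd M) (Fin.castAdd M)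
  have h2 := submatrix_mul_block T S (Fin.castAdd M) (Fin.natAdd N)
  rw [hTS, Matrix.submatrix_one _ (Fin.castAdd_injective N M)] at h1
  rw [hTS, one_submatrix_castAdd_natAdd] at h2
  rw [of_schur, subI, mul_sub, ← Matrix.mul_assoc, ← Matrix.mul_assoc,
    eq_neg_of_add_eq_zero_left h2.symm, Matrix.neg_mul, Matrix.neg_mul,
    Matrix.mul_assoc (T.submatrix _ _), ← subLast, hG, Matrix.mul_one, sub_neg_eq_add, ← h1]

theorem schur_mul_subI_inv {S T : Matrix (Fin (N + M)) (Fin (N + M)) R} (hST : S * T = 1)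
    {G : Matrix (Fin M) (Fin M) R} (hG : G * subLast S = 1) : Matrix.of (schur S G) * subI T = 1 := by
  have h1 := submatrix_mul_block S T (Fin.castAdd M) (Fin.castAdd M)
  have h2 := submatrix_mul_block S T (Fin.natAdd N) (Fin.castAdd M)
  rw [hST, Matrix.submatrix_one _ (Fin.castAdd_injective N M)] at h1
  rw [hST, one_submatrix_natAdd_castAdd] at h2
  rw [of_schur, subI, sub_mul, Matrix.mul_assoc, eq_neg_of_add_eq_zero_left h2.symm, Matrix.mul_neg,
    Matrix.mul_assoc, ← Matrix.mul_assoc G, ← subLast, hG, Matrix.one_mul, sub_neg_eq_add, ← h1]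

end Inverse

/-! ### The structure of R^t(x,1) and the compression of its inverse -/

section Mix

variable {N : ℕ} {K : Type*} [CommRing K]

/-- The operator multiplying `e_a ⊗ e_b`, `a ≠ b`, by `d` and acting on the span of the `e_a ⊗ e_a`
by the matrix `k`. -/
def mix {N : ℕ} (d : K) (k : Matrix (Fin N) (Fin N) K) : Matrix (Fin N × Fin N) (Fin N × Fin N) K :=
  fun r c => if r.1 = r.2 then if c.1 = c.2 then k r.1 c.1 else 0 else if r = c then d else 0

theorem mix_diag (d : K) (k : Matrix (Fin N) (Fin N) K) (a c e : Fin N) :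
    mix d k (a, a) (c, e) = if c = e then k a c else 0 := if_pos rfl

theorem mix_off (d : K) (k : Matrix (Fin N) (Fin N) K) {a b : Fin N} (h : a ≠ b)
    (z : Fin N × Fin N) : mix d k (a, b) z = if (a, b) = z then d else 0 := if_neg h

theorem mix_mul (d d' : K) (k k' : Matrix (Fin N) (Fin N) K) :
    mix d k * mix d' k' = mix (d * d') (k * k') := by
  ext ⟨a, b⟩ ⟨c, e⟩
  by_cases h : a = b
  · subst h
    rw [Matrix.mul_apply, Fintype.sum_prod_type]
    simp only [mix_diag, ite_mul, zero_mul, Finset.sum_ite_eq, Finset.mem_univ, if_true, mul_ite,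
      mul_zero, Finset.sum_ite_irrel, Finset.sum_const_zero, Matrix.mul_apply]
  · simp only [Matrix.mul_apply, mix_off _ _ h, ite_mul, zero_mul, Finset.sum_ite_eq,
      Finset.mem_univ, if_true, mul_ite, mul_zero]

theorem mix_one : mix (1 : K) (1 : Matrix (Fin N) (Fin N) K) = 1 := by
  ext ⟨a, b⟩ ⟨c, e⟩
  simp only [mix, Matrix.one_apply, Prod.mk.injEq]
  grind

variable [Algebra ℂ K]

/-- The action of `R^t(x,1)` on the span of the vectors `e_a ⊗ e_a`. -/
noncomputable def crossMatrix (q : ℂ) (N : ℕ) (x : K) : Matrix (Fin N) (Fin N) K := fun a c =>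
  if a = c then algebraMap ℂ K q⁻¹ * x - algebraMap ℂ K q else
  if a < c then (algebraMap ℂ K q⁻¹ - algebraMap ℂ K q) * x else
    algebraMap ℂ K q⁻¹ - algebraMap ℂ K q

/-- R^t(x,1) is the scalar x − 1 on e_a ⊗ e_b, a ≠ b, and preserves the span of the e_a ⊗ e_a.
Inverting it reduces to inverting an N × N matrix. -/
theorem transposeFirst_RMatrix (q : ℂ) (x : K) :
    transposeFirst (RMatrix q N x 1) = mix (x - 1) (crossMatrix q N x) := by
  ext ⟨a, b⟩ ⟨c, e⟩
  simp only [transposeFirst, RMatrix, mix, crossMatrix, Prod.mk.injEq, Algebra.smul_def, map_sub,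
    mul_one]
  grind

/-- The proportionality of the Schur complement of `R^t(x,1)` to `R^t(q^{-2M} x,1)`. -/
theorem exists_crossMatrix_mulVec {q : ℂ} (hq : q ≠ 0) (M : ℕ) {x y v : K}
    (hy : y = algebraMap ℂ K (q⁻¹ ^ (2 * M)) * x) (hv : v * (y - 1) = 1) :
    ∃ w : Fin M → K, (∀ a, ∑ c, crossMatrix q M x a c * w c = 1) ∧
      1 - (algebraMap ℂ K q⁻¹ - algebraMap ℂ K q) * x * ∑ c, w c = v * (x - 1) := by
  have hps : algebraMap ℂ K q⁻¹ * algebraMap ℂ K q = 1 := by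
    rw [← map_mul, inv_mul_cancel₀ hq, map_one]
  rw [map_pow] at hy
  simp only [crossMatrix]
  generalize algebraMap ℂ K q⁻¹ = p at *
  generalize algebraMap ℂ K q = s at *
  have h1 : ∀ m, ∑ c ∈ Finset.range m, (p - s) * p ^ (2 * c) = - s * (1 - p ^ (2 * m)) := by
    intro m
    induction m with
    | zero => simp
    | succ m ih =>
      rw [Finset.sum_range_succ, ih]
      linear_combination (-p ^ (2 * m) * p) * hps
  have h2 : ∀ a m, ∑ c ∈ Finset.range m, (if a = c then p * x - s else if a < c then (p - s) * x
      else p - s) * p ^ (2 * c) =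
      if m ≤ a then - s * (1 - p ^ (2 * m)) else s * (p ^ (2 * m) * x - 1) := by
    intro a m
    induction m with
    | zero => simp
    | succ m ih =>
      rw [Finset.sum_range_succ, ih]
      rcases lt_trichotomy a m with h | rfl | h
      · rw [if_neg (by omega), if_neg (by omega), if_pos h, if_neg (by omega)]
        linear_combination (-p ^ (2 * m) * p * x) * hps
      · rw [if_pos le_rfl, if_pos rfl, if_neg (by omega)]
        linear_combination (-p ^ (2 * a) * p * x) * hps
      · rw [if_pos h.le, if_neg (by omega), if_neg (by omega), if_pos (by omega)]
        linear_combination (-p ^ (2 * m) * p) * hps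
  -- A geometric progression of ratio q⁻² makes the row sums telescope, as in `h2`. A full row then
  -- gives q(y − 1), and the factor v q⁻¹ normalizes it to 1.
  refine ⟨fun c => v * p * p ^ (2 * c.val), fun a => ?_, ?_⟩
  · have h3 := h2 a M
    rw [if_neg (by omega), Finset.sum_range] at h3
    have h4 : ∑ c : Fin M, (if a = c then p * x - s else if a < c then (p - s) * x else p - s) *
        (v * p * p ^ (2 * c.val)) = v * p * (s * (p ^ (2 * M) * x - 1)) := by
      rw [← h3, Finset.mul_sum]
      refine Finset.sum_congr rfl fun c _ => ?_
      simp only [Fin.ext_iff, Fin.lt_def]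
      ring
    rw [h4, ← hy]
    linear_combination hv + v * (y - 1) * hps
  · have h3 := h1 M
    rw [← Finset.mul_sum, Finset.sum_range] at h3
    rw [← Finset.mul_sum]
    linear_combination (-(x * v * p)) * h3 + x * v * (1 - p ^ (2 * M)) * hps - hv + v * hy

/-- The compression to the first `N` indices of the inverse of `R^t(x,1)` on the span of the
`e_a ⊗ e_a` is inverse to `R^t(q^{-2M} x,1)`, up to a factor. -/
theorem subI_inv_mul_crossMatrix {q : ℂ} (hq : q ≠ 0) {M : ℕ} {x y v : K}
    (hy : y = algebraMap ℂ K (q⁻¹ ^ (2 * M)) * x) (hv : v * (y - 1) = 1)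
    {B : Matrix (Fin (N + M)) (Fin (N + M)) K} (hB : B * crossMatrix q (N + M) x = 1) :
    subI B * (v * (x - 1)) • crossMatrix q N y = 1 := by
  obtain ⟨w, hw, hs⟩ := exists_crossMatrix_mulVec hq M hy hv
  have h1 := submatrix_mul_block B (crossMatrix q (N + M) x) (Fin.castAdd M) (Fin.castAdd M)
  have h2 := submatrix_mul_block B (crossMatrix q (N + M) x) (Fin.castAdd M) (Fin.natAdd N)
  rw [hB, Matrix.submatrix_one _ (Fin.castAdd_injective N M)] at h1
  rw [hB, one_submatrix_castAdd_natAdd] at h2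
  set h := algebraMap ℂ K q⁻¹ - algebraMap ℂ K q with hh
  have hIJ : ∀ (i : Fin N) (j : Fin M),
      crossMatrix q (N + M) x (Fin.castAdd M i) (Fin.natAdd N j) = h * x := by
    intro i j
    have := castAdd_lt_natAdd i j
    rw [crossMatrix, if_neg this.ne, if_pos this]
  have hJI : ∀ (i : Fin N) (j : Fin M),
      crossMatrix q (N + M) x (Fin.natAdd N j) (Fin.castAdd M i) = h := by
    intro i j
    have := castAdd_lt_natAdd i j
    rw [crossMatrix, if_neg this.ne', if_neg this.not_gt]
  have hII : ∀ i j : Fin N, crossMatrix q (N + M) x (Fin.castAdd M i) (Fin.castAdd M j) =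
      crossMatrix q N x i j := by
    intro i j
    simp only [crossMatrix, Fin.castAdd_inj, (Fin.strictMono_castAdd M).lt_iff_lt]
  have hJJ : ∀ i j : Fin M, crossMatrix q (N + M) x (Fin.natAdd N i) (Fin.natAdd N j) =
      crossMatrix q M x i j := by
    intro i j
    simp only [crossMatrix, Fin.natAdd_inj, (Fin.strictMono_natAdd N).lt_iff_lt]
  -- The off-diagonal blocks of the cross matrix are constant, so contracting the IJ-block of
  -- B·(cross matrix) = 1 with w expresses the row sums of B over J through those over I.
  have h3 : ∀ i, (∑ a, B (Fin.castAdd M i) (Fin.castAdd M a)) * (h * x * ∑ c, w c) +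
      ∑ b, B (Fin.castAdd M i) (Fin.natAdd N b) = 0 := by
    intro i
    have h4 : ∑ c, ((∑ a, B (Fin.castAdd M i) (Fin.castAdd M a) * (h * x) +
        ∑ b, B (Fin.castAdd M i) (Fin.natAdd N b) * crossMatrix q M x b c) * w c) = 0 := by
      refine Finset.sum_eq_zero fun c _ => ?_
      have := congrFun (congrFun h2 i) c
      simp only [Matrix.add_apply, Matrix.mul_apply, Matrix.submatrix_apply, hIJ, hJJ,
        Matrix.zero_apply] at this
      rw [← this, zero_mul]
    have h5 : ∑ c, (∑ b, B (Fin.castAdd M i) (Fin.natAdd N b) * crossMatrix q M x b c) * w c =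
        ∑ b, B (Fin.castAdd M i) (Fin.natAdd N b) := by
      simp only [Finset.sum_mul, mul_assoc]
      rw [Finset.sum_comm]
      simp only [← Finset.mul_sum, hw, mul_one]
    simp only [add_mul, Finset.sum_add_distrib, h5, ← Finset.sum_mul] at h4
    rw [← h4, ← Finset.mul_sum]
    ring
  have hps : algebraMap ℂ K q⁻¹ * algebraMap ℂ K q = 1 := by
    rw [← map_mul, inv_mul_cancel₀ hq, map_one]
  -- The Schur complement subtracts the same constant from every entry, and the result is
  -- proportional to the cross matrix with parameter y.
  have h6 : ∀ a j : Fin N, (v * (x - 1)) * crossMatrix q N y a j =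
      crossMatrix q N x a j - h * (h * x * ∑ c, w c) := by
    intro a j
    rw [show h * x * ∑ c, w c = 1 - v * (x - 1) by rw [← hs]; ring]
    simp only [crossMatrix, ← hh]
    split_ifs
    · rw [hh]
      linear_combination (-algebraMap ℂ K q⁻¹ * (1 - x)) * hv
    · linear_combination (h * (x - 1)) * hv
    · ring
  ext i j
  have h7 := congrFun (congrFun h1 i) j
  simp only [Matrix.add_apply, Matrix.mul_apply, Matrix.submatrix_apply, hII, hJI,
    ← Finset.sum_mul] at h7
  rw [h7, Matrix.mul_apply]
  simp only [Matrix.smul_apply, smul_eq_mul, h6]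
  simp only [mul_sub, Finset.sum_sub_distrib, subI,
    Matrix.submatrix_apply, ← Finset.sum_mul]
  linear_combination (-h) * h3 i

end Mix

/-! ### Products of matrices with operators of this block shape -/

section MixFactors

variable {N : ℕ} {K E : Type*} [CommRing K] [Algebra ℂ K] [Ring E] [Algebra K E]

theorem mix_apply_left (d : K) (k : Matrix (Fin N) (Fin N) K) (p r c v : Fin N) :
    mix d k (p, r) (c, v) = (if r = p then if v = c then k r c else 0 else 0) +
      if p = c then if r = v then if v = c then 0 else d else 0 else 0 := by
  simp only [mix, Prod.mk.injEq]
  grind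

theorem mix_apply_right (d : K) (k : Matrix (Fin N) (Fin N) K) (p r c v : Fin N) :
    mix d k (p, r) (c, v) = (if p = r then if c = v then k p v else 0 else 0) +
      if r = v then if p = c then if c = v then 0 else d else 0 else 0 := by
  simp only [mix, Prod.mk.injEq]
  grind

theorem mul_algebraMap_mul (k : K) (e f : E) : e * algebraMap K E k * f = k • (e * f) := by
  rw [← Algebra.commutes, ← Algebra.smul_def, smul_mul_assoc]

/-- No summation over inner indices survives. Restricting the outer indices to I therefore restricts
a, b and k to their I-blocks, so that a reflection relation with such an operator passes to
submatrices. -/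
theorem factors_mix_left (d : K) (k : Matrix (Fin N) (Fin N) K) (a b : Matrix (Fin N) (Fin N) E)
    (i j : Fin 2 → Fin N) :
    (onFactor 0 a * onFactors 0 1 ((mix d k).map (algebraMap K E)) * onFactor 1 b :
      Matrix (Fin 2 → Fin N) (Fin 2 → Fin N) E) i j =
      k (i 1) (j 0) • (a (i 0) (i 1) * b (j 0) (j 1)) +
        if i 1 = j 0 then 0 else d • (a (i 0) (j 0) * b (i 1) (j 1)) := by
  have h1 : ∀ z : Fin 2 → Fin N, onFactor 0 a i z = if i 1 = z 1 then a (i 0) (z 0) else 0 := by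
    intro z
    simp [onFactor]
  rw [mul_onFactor_apply]
  simp only [mul_onFactors_apply (show (0 : Fin 2) ≠ 1 by simp), h1, Matrix.map_apply,
    Function.update_self, Function.update_of_ne (show (0 : Fin 2) ≠ 1 by simp), mix_apply_left]
  simp only [ite_mul, zero_mul, Finset.sum_ite_eq, Finset.sum_ite_eq', Finset.mem_univ, if_true,
    map_add, mul_add, apply_ite (algebraMap K E), map_zero, mul_ite, mul_zero,
    Finset.sum_add_distrib, Finset.sum_ite_irrel, Finset.sum_const_zero, add_mul,
    mul_algebraMap_mul]
  congr 1
  rw [Finset.sum_eq_single (i 1) (fun y _ hy => by simp [hy.symm]) (by simp)]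
  simp

theorem factors_mix_right (d : K) (k : Matrix (Fin N) (Fin N) K) (a b : Matrix (Fin N) (Fin N) E)
    (i j : Fin 2 → Fin N) :
    (onFactor 1 b * onFactors 0 1 ((mix d k).map (algebraMap K E)) * onFactor 0 a :
      Matrix (Fin 2 → Fin N) (Fin 2 → Fin N) E) i j =
      k (i 0) (j 1) • (b (i 1) (i 0) * a (j 1) (j 0)) +
        if i 0 = j 1 then 0 else d • (b (i 1) (j 1) * a (i 0) (j 0)) := by
  have h1 : ∀ z : Fin 2 → Fin N, onFactor 1 b i z = if i 0 = z 0 then b (i 1) (z 1) else 0 := by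
    intro z
    simp [onFactor]
  rw [mul_onFactor_apply]
  simp only [mul_onFactors_apply (show (0 : Fin 2) ≠ 1 by simp), h1, Matrix.map_apply,
    Function.update_self, Function.update_of_ne (show (0 : Fin 2) ≠ 1 by simp),
    Function.update_of_ne (show (1 : Fin 2) ≠ 0 by simp), mix_apply_right]
  simp only [ite_mul, zero_mul, Finset.sum_ite_eq, Finset.sum_ite_eq', Finset.mem_univ, if_true,
    map_add, mul_add, apply_ite (algebraMap K E), map_zero, mul_ite, mul_zero,
    Finset.sum_add_distrib, Finset.sum_ite_irrel, Finset.sum_const_zero, add_mul,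
    mul_algebraMap_mul]
  congr 1
  rw [Finset.sum_eq_single (i 0) (fun y _ hy => by simp [hy.symm]) (by simp)]
  simp

theorem onFactor_mul {B : Type*} [Ring B] {m : ℕ} (a : Fin m) (X Y : Matrix (Fin N) (Fin N) B) :
    (onFactor a X * onFactor a Y : Matrix (Fin m → Fin N) (Fin m → Fin N) B) =
      onFactor a (X * Y) := by
  ext i j
  rw [mul_onFactor_apply]
  simp only [onFactor]
  have h : ∀ v, (∀ k, k ≠ a → i k = Function.update j a v k) ↔ ∀ k, k ≠ a → i k = j k := by
    intro v
    refine forall_congr' fun k => forall_congr' fun hk => ?_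
    rw [Function.update_of_ne hk]
  simp only [h, Function.update_self]
  split_ifs
  · rfl
  · simp

theorem onFactor_one {B : Type*} [Ring B] {m : ℕ} (a : Fin m) :
    (onFactor a (1 : Matrix (Fin N) (Fin N) B) : Matrix (Fin m → Fin N) (Fin m → Fin N) B) = 1 := by
  ext i j
  rw [onFactor, Matrix.one_apply, Matrix.one_apply]
  by_cases h : i = j
  · simp [h]
  · rw [if_neg h]
    split_ifs with h1 h2
    · exfalso
      apply h
      funext k
      by_cases hk : k = a
      · rw [hk, h2]
      · exact h1 k hk
    · rfl
    · rfl

theorem onFactors_mul {B : Type*} [Ring B] {m : ℕ} {a b : Fin m} (hab : a ≠ b)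
    (X Y : Matrix (Fin N × Fin N) (Fin N × Fin N) B) :
    (onFactors a b X * onFactors a b Y : Matrix (Fin m → Fin N) (Fin m → Fin N) B) =
      onFactors a b (X * Y) := by
  ext i j
  rw [mul_onFactors_apply hab]
  simp only [onFactors]
  have h : ∀ v y, (∀ k, k ≠ a → k ≠ b → i k =
      Function.update (Function.update j a v) b y k) ↔ ∀ k, k ≠ a → k ≠ b → i k = j k := by
    intro v y
    refine forall_congr' fun k => forall_congr' fun hk => forall_congr' fun hk' => ?_
    rw [Function.update_of_ne hk', Function.update_of_ne hk]
  simp only [h, Function.update_self, Function.update_of_ne hab]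
  split_ifs
  · rw [Matrix.mul_apply, Fintype.sum_prod_type]
  · simp

theorem onFactors_one {B : Type*} [Ring B] {m : ℕ} (a b : Fin m) :
    (onFactors a b (1 : Matrix (Fin N × Fin N) (Fin N × Fin N) B) :
      Matrix (Fin m → Fin N) (Fin m → Fin N) B) = 1 := by
  ext i j
  rw [onFactors, Matrix.one_apply, Matrix.one_apply]
  by_cases h : i = j
  · simp [h]
  · rw [if_neg h]
    split_ifs with h1 h2
    · exfalso
      apply h
      funext k
      by_cases hk : k = a
      · rw [hk, (Prod.mk.inj h2).1]
      · by_cases hk' : k = b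
        · rw [hk', (Prod.mk.inj h2).2]
        · exact h1 k hk hk'
    · rfl
    · rfl

end MixFactors

/-! ### The reflection relation for Schur complements -/

section Schur

variable {N M : ℕ} {K E : Type*} [CommRing K] [Algebra ℂ K] [Ring E] [Algebra K E]

/-- The action of a matrix of scalars on two tensor factors. -/
def scalarFactors (E : Type*) [Ring E] [Algebra K E]
    (T : Matrix (Fin N × Fin N) (Fin N × Fin N) K) :
    Matrix (Fin 2 → Fin N) (Fin 2 → Fin N) E := onFactors 0 1 (T.map (algebraMap K E))

theorem scalarFactors_mul_of_mul_eq_one {X Y : Matrix (Fin N × Fin N) (Fin N × Fin N) K}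
    (h : X * Y = 1) : scalarFactors E X * scalarFactors E Y = 1 := by
  rw [scalarFactors, scalarFactors, onFactors_mul (by simp), ← Matrix.map_mul, h,
    Matrix.map_one _ (map_zero _) (map_one _), onFactors_one]

theorem scalarFactors_smul (c : K) (X : Matrix (Fin N × Fin N) (Fin N × Fin N) K) :
    scalarFactors E (c • X) = c • scalarFactors E X := by
  ext i j
  simp only [scalarFactors, onFactors, Matrix.map_apply, Matrix.smul_apply, smul_eq_mul, map_mul,
    Algebra.smul_def c (ite _ _ _), mul_ite, mul_zero]

theorem reflects_iff {q : ℂ} {a b : Matrix (Fin N) (Fin N) E} {U V x : K} :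
    Reflects q a b U V x ↔
      scalarFactors E (RMatrix q N U V) * (onFactor 0 a *
        scalarFactors E (transposeFirst (RMatrix q N x 1)) * onFactor 1 b) =
      onFactor 1 b * scalarFactors E (transposeFirst (RMatrix q N x 1)) * onFactor 0 a *
        scalarFactors E (RMatrix q N U V) := by
  have h1 : ∀ i j : Fin 2 → Fin N, (scalarFactors E (RMatrix q N U V) * (onFactor 0 a *
        scalarFactors E (transposeFirst (RMatrix q N x 1)) * onFactor 1 b) :
        Matrix (Fin 2 → Fin N) (Fin 2 → Fin N) E) i j =
      rop q (inl 0) (inl 1) U V (rop q (inr 0) (inl 1) x 1 (pairLeft a b)) (Sum.elim i j) := by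
    intro i j
    rw [scalarFactors, RMatrix_mul_apply]
    refine congrArg (fun g => rop q (inl 0) (inl 1) U V g (Sum.elim i j)) (funext fun z => ?_)
    rw [scalarFactors, factors_apply_left, Sum.elim_comp_inl_inr]
  have h2 : ∀ i j : Fin 2 → Fin N, (onFactor 1 b *
        scalarFactors E (transposeFirst (RMatrix q N x 1)) * onFactor 0 a *
        scalarFactors E (RMatrix q N U V) : Matrix (Fin 2 → Fin N) (Fin 2 → Fin N) E) i j =
      rop q (inr 1) (inr 0) U V (rop q (inr 1) (inl 0) x 1 (pairRight a b)) (Sum.elim i j) := by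
    intro i j
    rw [scalarFactors, scalarFactors, mul_RMatrix_apply]
    refine congrArg (fun g => rop q (inr 1) (inr 0) U V g (Sum.elim i j)) (funext fun z => ?_)
    rw [factors_apply_right, Sum.elim_comp_inl_inr]
  constructor
  · intro h
    ext1 i j
    rw [h1, h2]
    exact h _
  · intro h i
    have := congrFun (congrFun h (i ∘ inl)) (i ∘ inr)
    rwa [h1, h2, Sum.elim_comp_inl_inr] at this

/-- Invert, restrict to I, invert again. The second inversion turns the I-blocks of the inverses
into Schur complements and the compression of (R^t(x,1))⁻¹ into a multiple of R^t(y,1). -/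
theorem Reflects.schur {q : ℂ} (hq : q ≠ 0) {a b a' b' : Matrix (Fin (N + M)) (Fin (N + M)) E}
    {U V x y v w : K} (h : Reflects q a b U V x) (hy : y = algebraMap ℂ K (q⁻¹ ^ (2 * M)) * x)
    (hv : v * (y - 1) = 1) (hw : w * (x - 1) = 1) {B : Matrix (Fin (N + M)) (Fin (N + M)) K}
    (hB : B * crossMatrix q (N + M) x = 1) (ha : a' * a = 1) (ha' : a * a' = 1) (hb : b' * b = 1)
    (hb' : b * b' = 1) {c d : Matrix (Fin M) (Fin M) E} (hc : c * subLast a = 1)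
    (hc' : subLast a * c = 1) (hd : d * subLast b = 1) (hd' : subLast b * d = 1) :
    Reflects q (TwistedYangian.schur a c) (TwistedYangian.schur b d) U V y := by
  have hB' := mul_eq_one_comm.1 hB
  have hI := subI_inv_mul_crossMatrix hq hy hv hB
  have hI' := mul_eq_one_comm.1 hI
  have h1 := reflects_iff.1 h
  rw [transposeFirst_RMatrix, ← mul_assoc, ← mul_assoc] at h1
  have e1 : (onFactor 0 a' * onFactor 0 a : Matrix (Fin 2 → Fin (N + M)) _ E) = 1 := by
    rw [onFactor_mul, ha, onFactor_one]
  have e2 : (onFactor 0 a * onFactor 0 a' : Matrix (Fin 2 → Fin (N + M)) _ E) = 1 := by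
    rw [onFactor_mul, ha', onFactor_one]
  have e3 : (onFactor 1 b' * onFactor 1 b : Matrix (Fin 2 → Fin (N + M)) _ E) = 1 := by
    rw [onFactor_mul, hb, onFactor_one]
  have e4 : (onFactor 1 b * onFactor 1 b' : Matrix (Fin 2 → Fin (N + M)) _ E) = 1 := by
    rw [onFactor_mul, hb', onFactor_one]
  have e5 : mix w B * mix (x - 1) (crossMatrix q (N + M) x) = 1 := by
    rw [mix_mul, hB, hw, mix_one]
  have h2 := reflection_inverse h1 e1 e2 e3 e4 (scalarFactors_mul_of_mul_eq_one e5)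
    (scalarFactors_mul_of_mul_eq_one (mul_eq_one_comm.1 e5))
  -- The restriction to I: R does not leave the set of index families with values in I, and the
  -- remaining products involve no inner sums.
  have h3 : scalarFactors E (RMatrix q N U V) * onFactor 1 (subI b') *
      scalarFactors E (mix w (subI B)) * onFactor 0 (subI a') =
      onFactor 0 (subI a') * scalarFactors E (mix w (subI B)) * onFactor 1 (subI b') *
      scalarFactors E (RMatrix q N U V) := by
    ext1 i j
    have h4 := congrFun (congrFun h2 (Fin.castAdd M ∘ i)) (Fin.castAdd M ∘ j)
    rw [mul_assoc, mul_assoc, ← mul_assoc (onFactor 1 b'), scalarFactors, scalarFactors,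
      RMatrix_mul_apply, mul_RMatrix_apply] at h4
    rw [mul_assoc, mul_assoc, ← mul_assoc (onFactor 1 (subI b')), scalarFactors, scalarFactors,
      RMatrix_mul_apply, mul_RMatrix_apply]
    simp only [factors_mix_left, factors_mix_right] at h4 ⊢
    have h5 : (Sum.elim (Fin.castAdd M ∘ i) (Fin.castAdd M ∘ j)) =
        Fin.castAdd M ∘ Sum.elim i j := (Sum.comp_elim _ _ _).symm
    rw [h5] at h4
    have h6 : ∀ (e f : Fin 2 ⊕ Fin 2) (g : (Fin 2 ⊕ Fin 2 → Fin (N + M)) → E) z,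
        rop q e f U V g (Fin.castAdd M ∘ z) =
          rop q e f U V (g ∘ fun z => Fin.castAdd M ∘ z) z := fun e f g z =>
      rop_comp q U V (Fin.strictMono_castAdd M) rfl rfl rfl g
    rw [h6, h6] at h4
    simp only [Function.comp_def, Fin.castAdd_inj] at h4 ⊢
    exact h4
  have e6 : (onFactor 1 (Matrix.of (TwistedYangian.schur b d)) * onFactor 1 (subI b') :
      Matrix (Fin 2 → Fin N) _ E) = 1 := by
    rw [onFactor_mul, schur_mul_subI_inv hb' hd, onFactor_one]
  have e7 : (onFactor 1 (subI b') * onFactor 1 (Matrix.of (TwistedYangian.schur b d)) :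
      Matrix (Fin 2 → Fin N) _ E) = 1 := by
    rw [onFactor_mul, subI_inv_mul_schur hb hd', onFactor_one]
  have e8 : (onFactor 0 (Matrix.of (TwistedYangian.schur a c)) * onFactor 0 (subI a') :
      Matrix (Fin 2 → Fin N) _ E) = 1 := by
    rw [onFactor_mul, schur_mul_subI_inv ha' hc, onFactor_one]
  have e9 : (onFactor 0 (subI a') * onFactor 0 (Matrix.of (TwistedYangian.schur a c)) :
      Matrix (Fin 2 → Fin N) _ E) = 1 := by
    rw [onFactor_mul, subI_inv_mul_schur ha hc', onFactor_one]
  have e10 : ((v * (x - 1)) • transposeFirst (RMatrix q N y 1)) * mix w (subI B) = 1 := by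
    have : (v * (x - 1)) • transposeFirst (RMatrix q N y 1) =
        mix (x - 1) ((v * (x - 1)) • crossMatrix q N y) := by
      rw [transposeFirst_RMatrix]
      ext r z
      simp only [mix, Matrix.smul_apply, smul_eq_mul]
      split_ifs
      · rfl
      · rw [mul_zero]
      · linear_combination (x - 1) * hv
      · rw [mul_zero]
    rw [this, mix_mul, hI', mul_comm (x - 1), hw, mix_one]
  have h7 := reflection_inverse h3 e6 e7 e8 e9 (scalarFactors_mul_of_mul_eq_one e10)
    (scalarFactors_mul_of_mul_eq_one (mul_eq_one_comm.1 e10))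
  rw [scalarFactors_smul] at h7
  simp only [mul_smul_comm, smul_mul_assoc] at h7
  -- The scalar v(x − 1) produced by the compression is invertible, with inverse w(y − 1).
  have h8 := congrArg (fun Z => (w * (y - 1)) • Z) h7
  have hc : w * (y - 1) * (v * (x - 1)) = 1 := by linear_combination v * (y - 1) * hw + hv
  simp only [smul_smul, hc, one_smul] at h8
  refine reflects_iff.2 ?_
  rw [← mul_assoc, ← mul_assoc]
  exact h8

theorem onFactor_mul_apply {B : Type*} [Ring B] {m : ℕ} (a : Fin m) (T : Matrix (Fin N) (Fin N) B)
    (H : Matrix (Fin m → Fin N) (Fin m → Fin N) B) (i j : Fin m → Fin N) :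
    (onFactor a T * H) i j = ∑ v, T (i a) v * H (Function.update i a v) j := by
  classical
  rw [Matrix.mul_apply]
  symm
  refine Finset.sum_of_injOn (fun v => Function.update i a v) ?_ (by simp) ?_ ?_
  · intro v _ v' _ h
    simpa using congrFun h a
  · intro z _ hz
    rw [onFactor, if_neg, zero_mul]
    intro h
    apply hz
    refine ⟨z a, by simp, ?_⟩
    funext k
    by_cases hk : k = a
    · subst hk
      simp
    · simp [hk, h k hk]
  · intro v _
    rw [onFactor, if_pos, Function.update_self]
    intro k hk
    exact (Function.update_of_ne hk _ _).symm

/-- Multiplying by b' on both sides gives b'₂ R a₁ R^t = R^t a₁ R b'₂. At entries with r, c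
different from i, j only the diagonal coefficients U − V and x − 1 of R and R^t survive. -/
theorem Reflects.smul_commute_inverse {q : ℂ} {a b b' : Matrix (Fin N) (Fin N) E} {U V x : K}
    (h : Reflects q a b U V x) (hb : b' * b = 1) (hb' : b * b' = 1) {r c i j : Fin N} (hri : r ≠ i)
    (hrj : r ≠ j) (hci : c ≠ i) (hcj : c ≠ j) :
    ((U - V) * (x - 1)) • (b' i j * a r c) = ((U - V) * (x - 1)) • (a r c * b' i j) := by
  have h1 := reflects_iff.1 h
  rw [transposeFirst_RMatrix] at h1
  have e3 : (onFactor 1 b' * onFactor 1 b : Matrix (Fin 2 → Fin N) _ E) = 1 := by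
    rw [onFactor_mul, hb, onFactor_one]
  have e4 : (onFactor 1 b * onFactor 1 b' : Matrix (Fin 2 → Fin N) _ E) = 1 := by
    rw [onFactor_mul, hb', onFactor_one]
  -- An identity matrix under an opaque name, inserted so that the formulas for products with three
  -- factors apply.
  obtain ⟨e, he⟩ : ∃ e : Matrix (Fin N) (Fin N) E, e = 1 := ⟨1, rfl⟩
  have hd : ∀ z, e z z = 1 := fun z => by rw [he, Matrix.one_apply_eq]
  have ho : ∀ {z y}, z ≠ y → e z y = 0 := fun h => by rw [he, Matrix.one_apply_ne h]
  have h2 : onFactor 1 b' * (scalarFactors E (RMatrix q N U V) *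
      (onFactor 0 a * scalarFactors E (mix (x - 1) (crossMatrix q N x)) * onFactor 1 e)) =
      onFactor 1 e * scalarFactors E (mix (x - 1) (crossMatrix q N x)) * onFactor 0 a *
        scalarFactors E (RMatrix q N U V) * onFactor 1 b' := by
    rw [he, onFactor_one, mul_one, one_mul]
    generalize scalarFactors E (mix (x - 1) (crossMatrix q N x)) = k at *
    generalize scalarFactors E (RMatrix q N U V) = r at *
    calc onFactor 1 b' * (r * (onFactor 0 a * k)) =
        onFactor 1 b' * (r * (onFactor 0 a * k * onFactor 1 b)) * onFactor 1 b' := by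
          simp only [mul_assoc, e4, mul_one]
      _ = onFactor 1 b' * onFactor 1 b * (k * onFactor 0 a * r) * onFactor 1 b' := by
          rw [h1]
          simp only [mul_assoc]
      _ = _ := by rw [e3, one_mul]
  have h3 := congrFun (congrFun h2 ![r, i]) ![c, j]
  have hu : ∀ z y v : Fin N, Function.update ![z, y] 1 v = ![z, v] := fun z y v => by
    funext k
    fin_cases k <;> rfl
  have hu' : ∀ z y v : Fin N, Function.update (Function.update ![z, y] 0 v) 1 z = ![v, z] :=
    fun z y v => by
      funext k
      fin_cases k <;> rfl
  have hL : ∀ v, (scalarFactors E (RMatrix q N U V) * (onFactor 0 a *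
      scalarFactors E (mix (x - 1) (crossMatrix q N x)) * onFactor 1 e) :
      Matrix (Fin 2 → Fin N) (Fin 2 → Fin N) E) ![r, v] ![c, j] =
      if v = j then ((U - V) * (x - 1)) • a r c else 0 := by
    intro v
    rw [scalarFactors, RMatrix_mul_apply, rop_apply, elim_comp_swap_rows]
    simp only [scalarFactors, factors_mix_left]
    simp only [Function.comp_apply, Sum.elim_inl, Sum.elim_inr, Matrix.cons_val_zero,
      Matrix.cons_val_one, hu', ho hcj, ho hrj, mul_zero,
      smul_zero, ite_self, add_zero, zero_add]
    by_cases hv : v = j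
    · subst hv
      simp only [hcj.symm, if_false, if_true, hd, mul_one, smul_smul, diagCoeff, hrj]
    · simp only [ho hv, mul_zero, smul_zero, ite_self, hv, if_false]
  have hR : ∀ v, (onFactor 1 e * scalarFactors E (mix (x - 1) (crossMatrix q N x)) * onFactor 0 a *
      scalarFactors E (RMatrix q N U V) :
      Matrix (Fin 2 → Fin N) (Fin 2 → Fin N) E) ![r, i] ![c, v] =
      if i = v then ((U - V) * (x - 1)) • a r c else 0 := by
    intro v
    rw [scalarFactors, scalarFactors, mul_RMatrix_apply, rop_apply, elim_comp_swap_columns]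
    simp only [factors_mix_right]
    simp only [Function.comp_apply, Sum.elim_inl, Sum.elim_inr, Matrix.cons_val_zero,
      Matrix.cons_val_one, hu', ho hri.symm, ho hci.symm,
      zero_mul, smul_zero, ite_self, add_zero, zero_add]
    by_cases hv : i = v
    · subst hv
      simp only [hri, if_false, if_true, hd, one_mul, smul_smul, diagCoeff, hci.symm]
    · simp only [ho hv, zero_mul, smul_zero, ite_self, hv, if_false]
  rw [onFactor_mul_apply, mul_onFactor_apply] at h3
  simpa only [hu, hL, hR, Matrix.cons_val_zero, Matrix.cons_val_one, mul_ite, mul_zero, ite_mul,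
    zero_mul, Finset.sum_ite_eq, Finset.sum_ite_eq', Finset.mem_univ, if_true, mul_smul_comm,
    smul_mul_assoc] using h3

end Schur
end TwistedYangian

namespace TwistedYangian

open Sum

/-! ### Series in two variables, rescaling, and Schur complements of series -/

section PowerSeries

open PowerSeries

/-- The lowest coefficients multiply to the lowest coefficient of the product. The hypothesis has
the same form as the conclusion, so the lemma is iterated to reach two variables. -/
theorem smul_powerSeries_eq_zero {K E : Type*} [CommRing K] [Ring E] [Algebra K E]
    (h : ∀ (c : K) (e : E), c ≠ 0 → c • e = 0 → e = 0) (k : K⟦X⟧) (f : E⟦X⟧) (hk : k ≠ 0)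
    (hf : k • f = 0) : f = 0 := by
  by_contra hf'
  have hk1 : ∃ n, coeff n k ≠ 0 := by
    by_contra! hn
    exact hk (PowerSeries.ext hn)
  have hf1 : ∃ n, coeff n f ≠ 0 := by
    by_contra! hn
    exact hf' (PowerSeries.ext hn)
  classical
  have h1 := congrArg (coeff (Nat.find hk1 + Nat.find hf1)) hf
  rw [Algebra.smul_def, RingHom.algebraMap_toAlgebra', coeff_mul, map_zero,
    Finset.sum_eq_single (Nat.find hk1, Nat.find hf1), coeff_map, ← Algebra.smul_def] at h1
  · exact Nat.find_spec hf1 (h _ _ (Nat.find_spec hk1) h1)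
  · rintro ⟨a, b⟩ hab hne
    rw [Finset.HasAntidiagonal.mem_antidiagonal] at hab
    dsimp only at hab ⊢
    by_cases ha : a < Nat.find hk1
    · rw [coeff_map, not_not.1 (Nat.find_min hk1 ha), map_zero, zero_mul]
    · have hb : b < Nat.find hf1 := by
        rcases Nat.lt_or_ge b (Nat.find hf1) with hb | hb
        · exact hb
        · exact absurd (Prod.ext (by dsimp only; omega) (by dsimp only; omega)) hne
      rw [not_not.1 (Nat.find_min hf1 hb), mul_zero]
  · intro hn
    exact absurd (Finset.HasAntidiagonal.mem_antidiagonal (a := (Nat.find hk1, Nat.find hf1)).2 rfl) hn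

variable {A : Type*} [Ring A] [Algebra ℂ A]

theorem smul_series_eq_zero (k : ℂ⟦X⟧) (f : A⟦X⟧) (hk : k ≠ 0) (hf : k • f = 0) : f = 0 :=
  smul_powerSeries_eq_zero (fun c e hc he => by
    have := congrArg (fun z => c⁻¹ • z) he
    simpa [smul_smul, inv_mul_cancel₀ hc] using this) k f hk hf

theorem smul_double_series_injective {k : ℂ⟦X⟧⟦X⟧} (hk : k ≠ 0) {f g : A⟦X⟧⟦X⟧}
    (h : k • f = k • g) : f = g := by
  rw [← sub_eq_zero]
  refine smul_powerSeries_eq_zero smul_series_eq_zero k _ hk ?_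
  rw [smul_sub, h, sub_self]

/-- A power series of matrices as a matrix of power series. -/
noncomputable def matrixSeries (n A : Type*) [Fintype n] [DecidableEq n] [Ring A] :
    (Matrix n n A)⟦X⟧ →+* Matrix n n A⟦X⟧ where
  toFun f := Matrix.of fun i j => mk fun k => coeff k f i j
  map_one' := by
    ext i j k
    rw [Matrix.of_apply, coeff_mk, coeff_one, Matrix.one_apply]
    by_cases hij : i = j
    · subst hij
      by_cases hk : k = 0 <;> simp [hk, coeff_one]
    · by_cases hk : k = 0 <;> simp [hk, hij]
  map_mul' f g := by
    ext i j k
    simp only [Matrix.of_apply, coeff_mk, coeff_mul, Matrix.mul_apply, map_sum, Matrix.sum_apply]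
    exact Finset.sum_comm
  map_zero' := by
    ext i j k
    simp
  map_add' f g := by
    ext i j k
    simp

/-- A matrix of power series with invertible constant term is invertible. -/
theorem exists_matrix_inverse {n A : Type*} [Ring A] [Fintype n] [DecidableEq n] (S : Matrix n n A⟦X⟧)
    (T₀ : Matrix n n A) (h : (S.map (coeff 0)) * T₀ = 1) (h' : T₀ * (S.map (coeff 0)) = 1) :
    ∃ T, S * T = 1 ∧ T * S = 1 := by
  let F : (Matrix n n A)⟦X⟧ := mk fun k => S.map (coeff k)
  have hF : matrixSeries n A F = S := by
    ext i j k
    simp [matrixSeries, F]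
  let u : (Matrix n n A)ˣ := ⟨S.map (coeff 0), T₀, h, h'⟩
  have hu : constantCoeff F = u := by
    rw [← coeff_zero_eq_constantCoeff_apply]
    simp [F, u]
  refine ⟨matrixSeries n A (invOfUnit F u), ?_, ?_⟩
  · conv_lhs => rw [← hF]
    rw [← map_mul, mul_invOfUnit F u hu, map_one]
  · conv_lhs => rw [← hF]
    rw [← map_mul, invOfUnit_mul F u hu, map_one]

theorem exists_crossMatrix_inverse {q : ℂ} (hq : q ≠ 0) (N : ℕ) :
    ∃ B : Matrix (Fin N) (Fin N) ℂ⟦X⟧⟦X⟧, B * crossMatrix q N (C X * X) = 1 := by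
  -- At u⁻¹ = v⁻¹ = 0 the matrix is lower triangular with −q on the diagonal.
  have hu : IsUnit (crossMatrix q N (C X * X : ℂ⟦X⟧⟦X⟧)).det := by
    rw [PowerSeries.isUnit_iff_constantCoeff, PowerSeries.isUnit_iff_constantCoeff,
      RingHom.map_det, RingHom.map_det, Matrix.det_of_isLowerTriangular, isUnit_iff_ne_zero,
      Finset.prod_ne_zero_iff]
    · intro i _
      simp [crossMatrix, algebraMap_series, hq]
    · intro i j hij
      have hij' : i < j := hij
      simp [crossMatrix, algebraMap_series, hij'.ne, hij']
  exact ⟨_, Matrix.nonsing_inv_mul _ hu⟩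

theorem exists_inverse_sub_one (k : ℂ⟦X⟧) : ∃ w : ℂ⟦X⟧⟦X⟧, w * (C k * X - 1) = 1 := by
  have : IsUnit (C k * X - 1 : ℂ⟦X⟧⟦X⟧) := by
    rw [PowerSeries.isUnit_iff_constantCoeff]
    simp
  obtain ⟨u, hu⟩ := this
  exact ⟨↑u⁻¹, by rw [← hu, Units.inv_mul]⟩

/-- The substitution `u ↦ cu`. -/
noncomputable def scaleHom (A : Type*) [Ring A] [Algebra ℂ A] (c : ℂ) : A⟦X⟧ →+* A⟦X⟧ where
  toFun := scaleVar c
  map_one' := by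
    ext n
    rw [scaleVar, coeff_mk, coeff_one]
    split_ifs with h
    · simp [h]
    · rw [smul_zero]
  map_mul' f g := by
    ext n
    simp only [scaleVar, coeff_mk, coeff_mul, Finset.smul_sum]
    refine Finset.sum_congr rfl fun p hp => ?_
    rw [Finset.HasAntidiagonal.mem_antidiagonal] at hp
    rw [smul_mul_smul_comm, ← pow_add, hp]
  map_zero' := by
    ext n
    simp [scaleVar]
  map_add' f g := by
    ext n
    simp [scaleVar]

theorem scaleHom_apply (c : ℂ) (f : A⟦X⟧) : scaleHom A c f = scaleVar c f := rfl

theorem scaleHom_smul (c : ℂ) (k : ℂ⟦X⟧) (f : A⟦X⟧) :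
    scaleHom A c (k • f) = scaleHom ℂ c k • scaleHom A c f := by
  rw [Algebra.smul_def, Algebra.smul_def, map_mul]
  congr 1
  ext n
  rw [RingHom.algebraMap_toAlgebra', scaleHom_apply, scaleVar,
    coeff_mk, coeff_map, coeff_map, scaleHom_apply, scaleVar, coeff_mk, smul_eq_mul, map_mul,
    Algebra.smul_def]

theorem scaleVar_scaleVar (c d : ℂ) (f : A⟦X⟧) : scaleVar c (scaleVar d f) = scaleVar (c * d) f := by
  ext n
  simp only [scaleVar, coeff_mk, smul_smul, mul_inv, mul_pow]

theorem scaleVar_one (f : A⟦X⟧) : scaleVar 1 f = f := by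
  ext n
  simp [scaleVar]

/-- The substitution `u ↦ cu`, `v ↦ cv`. -/
noncomputable def doubleScale (A : Type*) [Ring A] [Algebra ℂ A] (c : ℂ) : A⟦X⟧⟦X⟧ →+* A⟦X⟧⟦X⟧ :=
  (scaleHom A⟦X⟧ c).comp (PowerSeries.map (scaleHom A c))

theorem coeff_doubleScale (c : ℂ) (f : A⟦X⟧⟦X⟧) (m n : ℕ) :
    coeff m (coeff n (doubleScale A c f)) = (c⁻¹ ^ (n + m)) • coeff m (coeff n f) := by
  simp [doubleScale, scaleHom_apply, scaleVar, pow_add, smul_smul]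

theorem doubleScale_smul (c : ℂ) (k : ℂ⟦X⟧⟦X⟧) (f : A⟦X⟧⟦X⟧) :
    doubleScale A c (k • f) = doubleScale ℂ c k • doubleScale A c f := by
  rw [Algebra.smul_def, Algebra.smul_def, map_mul]
  congr 1
  ext n m
  rw [coeff_doubleScale]
  simp only [RingHom.algebraMap_toAlgebra', coeff_map, coeff_doubleScale, smul_eq_mul, map_mul,
    Algebra.smul_def]

theorem doubleScale_C (c : ℂ) (f : A⟦X⟧) : doubleScale A c (C f) = C (scaleVar c f) := by
  ext n m
  rw [coeff_doubleScale, coeff_C, coeff_C]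
  split_ifs with h
  · simp [h, scaleVar]
  · simp

theorem doubleScale_map_C (c : ℂ) (f : A⟦X⟧) :
    doubleScale A c (PowerSeries.map C f) = PowerSeries.map C (scaleVar c f) := by
  ext n m
  rw [coeff_doubleScale, coeff_map, coeff_map, coeff_C, coeff_C]
  split_ifs with h
  · simp [h, scaleVar]
  · simp

variable {N M : ℕ}

theorem map_schur {E E' : Type*} [Ring E] [Ring E'] (f : E →+* E')
    (S : Matrix (Fin (N + M)) (Fin (N + M)) E) (G : Matrix (Fin M) (Fin M) E) (i j : Fin N) :
    schur (S.map f) (G.map f) i j = f (schur S G i j) := by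
  simp [schur]

/-- The reflection relation for a Schur complement. -/
theorem seriesReflects_schur {q : ℂ} (hq : q ≠ 0) {S T : Matrix (Fin (N + M)) (Fin (N + M)) A⟦X⟧}
    (hS : SeriesReflects q S) (hST : S * T = 1) (hTS : T * S = 1) {G : Matrix (Fin M) (Fin M) A⟦X⟧}
    (hG : subLast S * G = 1) (hG' : G * subLast S = 1) :
    SeriesReflects q (Matrix.of fun i j => scaleVar (q ^ M)⁻¹ (schur S G i j)) := by
  obtain ⟨B, hB⟩ := exists_crossMatrix_inverse hq (N + M)
  obtain ⟨w, hw⟩ := exists_inverse_sub_one X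
  obtain ⟨v, hv⟩ := exists_inverse_sub_one (C (q⁻¹ ^ (2 * M)) * X)
  have hy : (C (C (q⁻¹ ^ (2 * M)) * X) * X : ℂ⟦X⟧⟦X⟧) =
      algebraMap ℂ ℂ⟦X⟧⟦X⟧ (q⁻¹ ^ (2 * M)) * (C X * X) := by
    rw [algebraMap_series, map_mul, mul_assoc]
  have hm : ∀ {n : ℕ} (f : A⟦X⟧ →+* A⟦X⟧⟦X⟧) {P Q : Matrix (Fin n) (Fin n) A⟦X⟧}, P * Q = 1 →
      P.map f * Q.map f = 1 := fun f P Q h => by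
    rw [← Matrix.map_mul, h, Matrix.map_one _ (map_zero _) (map_one _)]
  have h := Reflects.schur (K := ℂ⟦X⟧⟦X⟧) (a := S.map C) (b := S.map (PowerSeries.map C)) hq hS hy hv
    hw hB (hm C hTS) (hm C hST) (hm (PowerSeries.map C) hTS) (hm (PowerSeries.map C) hST)
    (hm C hG') (hm C hG) (hm (PowerSeries.map C) hG') (hm (PowerSeries.map C) hG)
  -- The substitution u ↦ q^{-M}u, v ↦ q^{-M}v turns the parameter q^{-2M}u⁻¹v⁻¹ back into u⁻¹v⁻¹
  -- and multiplies both arguments of R by q^M, which cancels by homogeneity.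
  have h2 := h.map (doubleScale ℂ (q ^ M)⁻¹) (doubleScale A (q ^ M)⁻¹)
    (fun c => by rw [algebraMap_series, doubleScale_C, scaleVar_C]) (doubleScale_smul _)
  have hX : doubleScale ℂ (q ^ M)⁻¹ X = algebraMap ℂ ℂ⟦X⟧⟦X⟧ (q ^ M) * X := by
    rw [← map_X C, doubleScale_map_C, scaleVar_X, inv_inv, algebraMap_series, map_mul, map_C]
  have hX' : doubleScale ℂ (q ^ M)⁻¹ (C X) = algebraMap ℂ ℂ⟦X⟧⟦X⟧ (q ^ M) * C X := by
    rw [doubleScale_C, scaleVar_X, inv_inv, algebraMap_series, map_mul]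
  have hx : doubleScale ℂ (q ^ M)⁻¹ (C (C (q⁻¹ ^ (2 * M)) * X) * X) = C X * X := by
    have hc : (C (C (q⁻¹ ^ (2 * M))) * (C (C (q ^ M)) * C (C (q ^ M))) : ℂ⟦X⟧⟦X⟧) = 1 := by
      rw [← map_mul, ← map_mul, ← map_mul, ← map_mul, ← pow_add, ← two_mul, inv_pow,
        inv_mul_cancel₀ (pow_ne_zero _ hq), map_one, map_one]
    rw [map_mul, map_mul, map_mul, hX, hX', doubleScale_C, scaleVar_C, algebraMap_series]
    linear_combination C X * X * hc
  rw [hX, hX', hx] at h2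
  intro i
  have h3 := h2 i
  rw [rop_mul_param, rop_mul_param] at h3
  have h4 := smul_double_series_injective (by
    rw [algebraMap_series]
    exact fun h0 => pow_ne_zero M hq (C_injective (C_injective (h0.trans (by simp))))) h3
  simp only [map_schur, doubleScale_C, doubleScale_map_C] at h4
  exact h4

theorem commute_map_C_C {A : Type*} [Ring A] {f g : A⟦X⟧} (h : PowerSeries.map C f * C g = C g * PowerSeries.map C f)
    (m n : ℕ) : Commute (coeff m f) (coeff n g) := by
  have h1 := congrArg (fun z => coeff n (coeff m z)) h
  simp only [coeff_mul_C, coeff_C_mul, coeff_map] at h1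
  exact h1

theorem commute_C_iff {A : Type*} [Ring A] {f : A⟦X⟧} {e : A} : Commute f (C e) ↔ ∀ n, Commute (coeff n f) e := by
  simp only [commute_iff_eq, PowerSeries.ext_iff, coeff_mul_C, coeff_C_mul]

theorem commute_of_coeff {A : Type*} [Ring A] {f g : A⟦X⟧} (h : ∀ m n, Commute (coeff m f) (coeff n g)) :
    Commute f g := by
  ext n
  rw [coeff_mul, coeff_mul, ← Finset.Nat.sum_antidiagonal_swap]
  exact Finset.sum_congr rfl fun p _ => (h _ _).eq

/-- Commuting entrywise with z means commuting with the scalar matrix z, a property inherited by the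
inverse matrix. -/
theorem commute_of_mul_eq_one {n R : Type*} [Fintype n] [DecidableEq n] [Ring R]
    {T P : Matrix n n R} (h : T * P = 1) (h' : P * T = 1) {z : R} (hz : ∀ i j, Commute (T i j) z)
    (i j : n) : Commute (P i j) z := by
  have h1 : T * Matrix.diagonal (fun _ => z) = Matrix.diagonal (fun _ => z) * T := by
    ext i j
    rw [Matrix.mul_diagonal, Matrix.diagonal_mul, (hz i j).eq]
  have h2 : P * Matrix.diagonal (fun _ => z) = Matrix.diagonal (fun _ => z) * P := by
    calc P * Matrix.diagonal (fun _ => z) = P * (Matrix.diagonal (fun _ => z) * T) * P := by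
          rw [Matrix.mul_assoc, Matrix.mul_assoc, h, Matrix.mul_one]
      _ = _ := by rw [← h1, ← Matrix.mul_assoc P, h', Matrix.one_mul]
  have h3 := congrFun (congrFun h2 i) j
  rwa [Matrix.mul_diagonal, Matrix.diagonal_mul] at h3

/-- A Schur complement commutes with the block on which it is formed. -/
theorem commute_schur {q : ℂ} {S T : Matrix (Fin (N + M)) (Fin (N + M)) A⟦X⟧}
    (hS : SeriesReflects q S) (hST : S * T = 1) (hTS : T * S = 1) {G : Matrix (Fin M) (Fin M) A⟦X⟧}
    (hG : subLast S * G = 1) (hG' : G * subLast S = 1) (i j : Fin N) (a b : Fin M) (m n : ℕ) :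
    Commute (coeff m (schur S G i j)) (coeff n (S (Fin.natAdd N a) (Fin.natAdd N b))) := by
  have hm : ∀ {P Q : Matrix (Fin (N + M)) (Fin (N + M)) A⟦X⟧}, P * Q = 1 →
      P.map (PowerSeries.map C) * Q.map (PowerSeries.map C) = (1 : Matrix _ _ A⟦X⟧⟦X⟧) :=
    fun {P Q} h => by
      rw [← Matrix.map_mul, h, Matrix.map_one _ (map_zero _) (map_one _)]
  have hk : ((X - C X) * (C X * X - 1) : ℂ⟦X⟧⟦X⟧) ≠ 0 := by
    refine mul_ne_zero ?_ ?_
    · intro h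
      have := congrArg (fun z => coeff 0 (coeff 1 z)) h
      simp at this
    · intro h
      have := congrArg (fun z => coeff 0 (coeff 0 z)) h
      simp at this
  -- Entries of S⁻¹ in I and of S in J have disjoint indices. Their commutation passes to the Schur
  -- complement as the inverse of the I-block of S⁻¹.
  have h1 : ∀ i j m, Commute (T (Fin.castAdd M i) (Fin.castAdd M j))
      (C (coeff m (S (Fin.natAdd N a) (Fin.natAdd N b)))) := by
    intro i j m
    refine commute_C_iff.2 fun k => commute_map_C_C (smul_double_series_injective hk
      (Reflects.smul_commute_inverse (K := ℂ⟦X⟧⟦X⟧) (a := S.map C) (b := S.map (PowerSeries.map C))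
        (b' := T.map (PowerSeries.map C)) hS (hm hTS) (hm hST) ?_ ?_ ?_ ?_)) k m <;>
    exact (castAdd_lt_natAdd _ _).ne'
  exact commute_C_iff.1 (commute_of_mul_eq_one (subI_inv_mul_schur hTS hG)
    (schur_mul_subI_inv hST hG') (fun i j => h1 i j n) i j) m

end PowerSeries

end TwistedYangian

namespace TwistedYangian

open Sum

/-! ### Products of R-matrices acting on q-antisymmetric functions by scalars -/

section Chain

variable {N : ℕ} {K E : Type*} [CommRing K] [Algebra ℂ K] [Ring E] [Algebra K E] {ι : Type*}
  [DecidableEq ι] {q : ℂ} {U V : ℕ → K} {p : ℕ → ι} {a : ι}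

/-- The product `R_{a,p_{m-1}} ⋯ R_{a,p_0}`. -/
noncomputable def chainDown (q : ℂ) (U V : ℕ → K) (p : ℕ → ι) (a : ι) :
    ℕ → ((ι → Fin N) → E) →ₗ[K] ((ι → Fin N) → E)
  | 0 => LinearMap.id
  | m + 1 => rop q a (p m) (U m) (V m) ∘ₗ chainDown q U V p a m

/-- The product `R_{p_0,a} ⋯ R_{p_{m-1},a}`. -/
noncomputable def chainUp (q : ℂ) (U V : ℕ → K) (p : ℕ → ι) (a : ι) :
    ℕ → ((ι → Fin N) → E) →ₗ[K] ((ι → Fin N) → E)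
  | 0 => LinearMap.id
  | m + 1 => chainUp q U V p a m ∘ₗ rop q (p m) a (U m) (V m)

theorem rop_chainDown_comm (u v : K) {b c : ι} {m : ℕ} (hb : b ≠ a) (hc : c ≠ a)
    (hb' : ∀ k < m, b ≠ p k) (hc' : ∀ k < m, c ≠ p k) (g : (ι → Fin N) → E) :
    rop q b c u v (chainDown q U V p a m g) = chainDown q U V p a m (rop q b c u v g) := by
  induction m generalizing g with
  | zero => rfl
  | succ m ih =>
    rw [chainDown, LinearMap.comp_apply, LinearMap.comp_apply,
      rop_comm q _ _ _ _ hb (hb' m m.lt_succ_self) hc (hc' m m.lt_succ_self),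
      ih (fun k hk => hb' k (hk.trans m.lt_succ_self)) fun k hk => hc' k (hk.trans m.lt_succ_self)]

theorem rop_chainUp_comm (u v : K) {b c : ι} {m : ℕ} (hb : b ≠ a) (hc : c ≠ a)
    (hb' : ∀ k < m, b ≠ p k) (hc' : ∀ k < m, c ≠ p k) (g : (ι → Fin N) → E) :
    rop q b c u v (chainUp q U V p a m g) = chainUp q U V p a m (rop q b c u v g) := by
  induction m generalizing g with
  | zero => rfl
  | succ m ih =>
    rw [chainUp, LinearMap.comp_apply, LinearMap.comp_apply,
      ih (fun k hk => hb' k (hk.trans m.lt_succ_self)) fun k hk => hc' k (hk.trans m.lt_succ_self),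
      rop_comm q _ _ _ _ (hb' m m.lt_succ_self) hb (hc' m m.lt_succ_self) hc]

/-- Yang–Baxter moves R(q²,1) past the two operators of the chain that involve its positions, and
the others commute with it. The condition `hUV` is the compatibility of the parameters. -/
theorem exists_chainDown_rop (hq : q ≠ 0) (hp : Function.Injective p) {k m : ℕ} (hk : k + 2 ≤ m)
    (ha : ∀ k < m, a ≠ p k) (hUV : U (k + 1) * algebraMap ℂ K (q ^ 2) * V k = V (k + 1) * U k)
    (g : (ι → Fin N) → E) :
    ∃ g' : (ι → Fin N) → E, chainDown q U V p a m
        (rop q (p (k + 1)) (p k) (algebraMap ℂ K (q ^ 2)) 1 g) =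
      rop q (p (k + 1)) (p k) (algebraMap ℂ K (q ^ 2)) 1 g' := by
  induction m, hk using Nat.le_induction with
  | base =>
    refine ⟨rop q a (p k) (U k) (V k) (rop q a (p (k + 1)) (U (k + 1)) (V (k + 1))
      (chainDown q U V p a k g)), ?_⟩
    rw [chainDown, chainDown, LinearMap.comp_apply, LinearMap.comp_apply, ← rop_chainDown_comm,
      yang_baxter hq (ha _ (by omega)) (ha _ (by omega)) (hp.ne (by omega))]
    · rw [mul_one, hUV]
    · exact (ha _ (by omega)).symm
    · exact (ha _ (by omega)).symm
    · exact fun c hc => hp.ne (by omega)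
    · exact fun c hc => hp.ne (by omega)
  | succ m hm ih =>
    obtain ⟨g', hg'⟩ := ih fun k hk => ha k (hk.trans m.lt_succ_self)
    refine ⟨rop q a (p m) (U m) (V m) g', ?_⟩
    rw [chainDown, LinearMap.comp_apply, hg', rop_comm]
    · exact ha _ (by omega)
    · exact ha _ (by omega)
    · exact hp.ne (by omega)
    · exact hp.ne (by omega)

theorem exists_chainUp_rop (hq : q ≠ 0) (hp : Function.Injective p) {k m : ℕ} (hk : k + 2 ≤ m)
    (ha : ∀ k < m, a ≠ p k) (hUV : algebraMap ℂ K (q ^ 2) * U k * V (k + 1) = V k * U (k + 1))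
    (g : (ι → Fin N) → E) :
    ∃ g' : (ι → Fin N) → E, chainUp q U V p a m
        (rop q (p (k + 1)) (p k) (algebraMap ℂ K (q ^ 2)) 1 g) =
      rop q (p (k + 1)) (p k) (algebraMap ℂ K (q ^ 2)) 1 g' := by
  induction m, hk using Nat.le_induction generalizing g with
  | base =>
    refine ⟨chainUp q U V p a k (rop q (p (k + 1)) a (U (k + 1)) (V (k + 1))
      (rop q (p k) a (U k) (V k) g)), ?_⟩
    rw [chainUp, chainUp, LinearMap.comp_apply, LinearMap.comp_apply, rop_chainUp_comm,
      yang_baxter hq (hp.ne (by omega)) (ha _ (by omega)).symm (ha _ (by omega)).symm]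
    · rw [hUV, one_mul]
    · exact (ha _ (by omega)).symm
    · exact (ha _ (by omega)).symm
    · exact fun c hc => hp.ne (by omega)
    · exact fun c hc => hp.ne (by omega)
  | succ m hm ih =>
    obtain ⟨g', hg'⟩ := ih (fun k hk => ha k (hk.trans m.lt_succ_self)) (rop q (p m) a (U m) (V m) g)
    refine ⟨g', ?_⟩
    rw [chainUp, LinearMap.comp_apply, rop_comm, hg']
    · exact hp.ne (by omega)
    · exact hp.ne (by omega)
    · exact ha _ (by omega)
    · exact ha _ (by omega)

/-- P^q acts on antisymmetric functions as −1, so up to a nonzero scalar they are fixed by R(q²,1)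
and lie in its image. -/
theorem AntiOn.rop_eq (hq : q ≠ 0) {m : ℕ} {g : (ι → Fin N) → E} (hg : AntiOn K q p m g) {k : ℕ}
    (hk : k + 1 < m) : rop q (p (k + 1)) (p k) (algebraMap ℂ K (q ^ 2)) 1 g =
      algebraMap ℂ K (2 * (q ^ 2 - 1)) • g := by
  have hqq : algebraMap ℂ K q * algebraMap ℂ K q⁻¹ = 1 := by
    rw [← map_mul, mul_inv_cancel₀ hq, map_one]
  funext i
  rw [rop_sq hq, permCoeff, Pi.smul_apply, Equiv.swap_comm]
  rcases lt_trichotomy (i (p k)) (i (p (k + 1))) with h | h | h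
  · rw [(hg k hk i).2 h, if_neg h.ne', if_pos h, map_mul, map_ofNat]
    rw [smul_smul, mul_neg, hqq]
    module
  · have hs : i ∘ Equiv.swap (p k) (p (k + 1)) = i := by
      funext n
      rw [Function.comp_apply, Equiv.swap_apply_def]
      split_ifs <;> simp_all
    rw [hs, (hg k hk i).1 h]
    simp
  · have h1 := (hg k hk (i ∘ Equiv.swap (p k) (p (k + 1)))).2 (by simpa using h)
    have hs : (i ∘ Equiv.swap (p k) (p (k + 1))) ∘ Equiv.swap (p k) (p (k + 1)) = i := by
      funext n
      simp
    rw [hs] at h1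
    rw [if_neg h.ne, if_neg h.not_gt, h1, map_mul, map_ofNat]
    module

theorem antiOn_of_exists (hq0 : q ≠ 0) (hq : ∀ k : ℕ, 0 < k → q ^ k ≠ 1) {m : ℕ}
    {g : (ι → Fin N) → E} (hg : AntiOn K q p m g)
    {F : ((ι → Fin N) → E) →ₗ[K] ((ι → Fin N) → E)}
    (hF : ∀ k, k + 1 < m → ∀ g : (ι → Fin N) → E, ∃ g' : (ι → Fin N) → E,
      F (rop q (p (k + 1)) (p k) (algebraMap ℂ K (q ^ 2)) 1 g) =
        rop q (p (k + 1)) (p k) (algebraMap ℂ K (q ^ 2)) 1 g') : AntiOn K q p m (F g) := by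
  intro k hk i
  obtain ⟨g', hg'⟩ := hF k hk g
  refine anti_of_rop hq0 (c := 2 * (q ^ 2 - 1)) (mul_ne_zero two_ne_zero (sq_sub_one_ne_zero hq))
    (g' := g') ?_ i
  rw [← hg', hg.rop_eq hq0 hk, map_smul]

theorem AntiOn.smul {m : ℕ} {g : (ι → Fin N) → E} (hg : AntiOn K q p m g) (c : K) :
    AntiOn K q p m (c • g) := by
  intro k hk i
  refine ⟨fun h => ?_, fun h => ?_⟩
  · rw [Pi.smul_apply, (hg k hk i).1 h, smul_zero]
  · rw [Pi.smul_apply, (hg k hk i).2 h, Pi.smul_apply, smul_comm]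

theorem AntiOn.sub {m : ℕ} {g h : (ι → Fin N) → E} (hg : AntiOn K q p m g)
    (hh : AntiOn K q p m h) : AntiOn K q p m (g - h) := by
  intro k hk i
  refine ⟨fun e => ?_, fun e => ?_⟩
  · rw [Pi.sub_apply, (hg k hk i).1 e, (hh k hk i).1 e, sub_zero]
  · rw [Pi.sub_apply, (hg k hk i).2 e, (hh k hk i).2 e, Pi.sub_apply, smul_sub]

/-- A q-antisymmetric function of `N` indices with values in a set of `N` elements vanishes as soon as
it does for a prescribed position of a given value. -/
theorem AntiOn.eq_zero_of_position (hq : q ≠ 0) (hp : Function.Injective p) {g : (ι → Fin N) → E}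
    (hg : AntiOn K q p N g) (ha : ∀ k < N, a ≠ p k) {l : ℕ} (hl : l < N)
    (h : ∀ i : ι → Fin N, (∀ k < N, k ≠ l → i (p k) ≠ i a) → i (p l) = i a → g i = 0)
    (i : ι → Fin N) : g i = 0 := by
  by_cases hi : Function.Injective fun k : Fin N => i (p k)
  · obtain ⟨k, hk⟩ := Finite.injective_iff_surjective.1 hi (i a)
    obtain ⟨k, hkN⟩ := k
    dsimp only at hk
    replace hi : ∀ b < N, b ≠ k → i (p b) ≠ i a := fun b hb hbk hba =>
      hbk (Fin.mk.inj_iff.1 (hi (a₁ := ⟨b, hb⟩) (a₂ := ⟨k, hkN⟩) (hba.trans hk.symm)))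
    have hswap : ∀ c, c + 1 < N → ∀ i : ι → Fin N,
        (i ∘ Equiv.swap (p c) (p (c + 1))) a = i a ∧
        ∀ b, (i ∘ Equiv.swap (p c) (p (c + 1))) (p b) = i (p (Equiv.swap c (c + 1) b)) := by
      intro c hc i
      refine ⟨?_, fun b => ?_⟩
      · rw [Function.comp_apply, Equiv.swap_apply_of_ne_of_ne (ha _ (by omega)) (ha _ (by omega))]
      · rw [Function.comp_apply, hp.swap_apply]
    -- The value `i a` is carried from its position k to l by adjacent swaps, each of which
    -- multiplies g by a scalar.
    rcases le_total k l with hkl | hkl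
    · induction hkl using Nat.decreasingInduction generalizing i with
      | self => exact h i hi hk
      | of_succ k hkl ih =>
        obtain ⟨c, hc⟩ := exists_smul_of_antiOn (K := K) (E := E) (p := p) hq
          (show k + 1 < N by omega) i
        obtain ⟨h1, h2⟩ := hswap k (by omega) i
        rw [hc g hg, ih _ (by omega), smul_zero]
        · rw [h1, h2, Equiv.swap_apply_right, hk]
        · intro b hb hbk
          rw [h1, h2]
          refine hi _ ?_ ?_ <;> rw [Equiv.swap_apply_def] <;> split_ifs <;> omega
    · induction k, hkl using Nat.le_induction generalizing i with
      | base => exact h i hi hk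
      | succ k hkl ih =>
        obtain ⟨c, hc⟩ := exists_smul_of_antiOn (K := K) (E := E) (p := p) hq hkN i
        obtain ⟨h1, h2⟩ := hswap k (by omega) i
        rw [hc g hg, ih _ (by omega), smul_zero]
        · rw [h1, h2, Equiv.swap_apply_left, hk]
        · intro b hb hbk
          rw [h1, h2]
          refine hi _ ?_ ?_ <;> rw [Equiv.swap_apply_def] <;> split_ifs <;> omega
  · rw [Function.Injective] at hi
    push Not at hi
    obtain ⟨b, c, hbc, hne⟩ := hi
    have hne' : b.val ≠ c.val := fun h => hne (Fin.ext h)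
    rcases lt_or_gt_of_ne hne' with hlt | hlt
    · exact hg.eq_zero hq hp hlt c.2 hbc
    · exact hg.eq_zero hq hp hlt b.2 hbc.symm

theorem chainDown_eq_zero {m b c : ℕ} (hp : Function.Injective p) (hb : m ≤ b) (hc : m ≤ c)
    (hba : a ≠ p b) (hca : a ≠ p c) {g : (ι → Fin N) → E}
    (hg : ∀ i : ι → Fin N, i (p b) = i (p c) → g i = 0) (i : ι → Fin N) (hi : i (p b) = i (p c)) :
    chainDown q U V p a m g i = 0 := by
  induction m generalizing i with
  | zero => exact hg i hi
  | succ m ih =>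
    have h1 : p b ≠ p m := hp.ne (by omega)
    have h2 : p c ≠ p m := hp.ne (by omega)
    rw [chainDown, LinearMap.comp_apply, rop_apply, ih (by omega) (by omega) i hi,
      ih (by omega) (by omega), smul_zero, smul_zero, add_zero]
    rw [Function.comp_apply, Function.comp_apply, Equiv.swap_apply_of_ne_of_ne hba.symm h1,
      Equiv.swap_apply_of_ne_of_ne hca.symm h2, hi]

/-- When `p m` already carries the value of a, every exchange of a with an earlier position repeats
that value and gives zero, so only the diagonal coefficients U − V contribute. -/
theorem chainDown_of_eq {m : ℕ} (hp : Function.Injective p) {g : (ι → Fin N) → E}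
    (hg : ∀ b c, b < c → c ≤ m → ∀ i : ι → Fin N, i (p b) = i (p c) → g i = 0)
    (ha : ∀ k ≤ m, a ≠ p k) {i : ι → Fin N} (hi : i (p m) = i a) {l : ℕ} (hl : l ≤ m) 
    (hne : ∀ k < l, i (p k) ≠ i a) :
    chainDown q U V p a l g i = (∏ k ∈ Finset.range l, (U k - V k)) • g i := by
  induction l with
  | zero => rw [Finset.range_zero, Finset.prod_empty, one_smul]; rfl
  | succ l ih =>
    have h1 : p m ≠ p l := hp.ne (by omega)
    rw [chainDown, LinearMap.comp_apply, rop_apply, ih (by omega) fun k hk => hne k (by omega),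
      chainDown_eq_zero hp le_rfl (c := m) (by omega) (ha l (by omega)) (ha m le_rfl)
        (hg l m (by omega) le_rfl), smul_zero, add_zero, smul_smul, diagCoeff,
      if_neg (hne l (by omega)).symm, Finset.prod_range_succ, mul_comm]
    rw [Function.comp_apply, Function.comp_apply, Equiv.swap_apply_right,
      Equiv.swap_apply_of_ne_of_ne (ha m le_rfl).symm h1, hi]

/-- The scalar by which `R_{a,p_n} ⋯ R_{a,p_0}` acts on q-antisymmetric functions. -/
noncomputable def downScalar (q : ℂ) (U V : ℕ → K) (n : ℕ) : K :=
  (algebraMap ℂ K q⁻¹ * U n - algebraMap ℂ K q * V n) * ∏ k ∈ Finset.range n, (U k - V k)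

/-- The chain preserves antisymmetry, and an antisymmetric function of N indices with N values is
determined by any one position of the value at a. For the last position p_n the scalar can be read
off. -/
theorem chainDown_antiOn {n : ℕ} (hn : N = n + 1) (hq0 : q ≠ 0) (hq : ∀ k : ℕ, 0 < k → q ^ k ≠ 1)
    (hp : Function.Injective p) (ha : ∀ k < N, a ≠ p k)
    (hUV : ∀ k, U (k + 1) * algebraMap ℂ K (q ^ 2) * V k = V (k + 1) * U k) {g : (ι → Fin N) → E}
    (hg : AntiOn K q p N g) : chainDown q U V p a N g = downScalar q U V n • g := by
  rw [← sub_eq_zero]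
  funext i
  refine ((antiOn_of_exists hq0 hq hg fun k hk g => exists_chainDown_rop hq0 hp (by omega) ha (hUV k)
    g).sub (hg.smul _)).eq_zero_of_position hq0 hp ha (l := n) (by omega) (fun i hne hi => ?_) i
  have hz : ∀ b c, b < c → c ≤ n → ∀ i : ι → Fin N, i (p b) = i (p c) → g i = 0 :=
    fun b c hbc hc i hi => hg.eq_zero hq0 hp hbc (by omega) hi
  subst hn
  rw [Pi.sub_apply, sub_eq_zero, chainDown, LinearMap.comp_apply, rop_apply, diagCoeff, if_pos hi.symm,
    swapCoeff, hi, if_neg (lt_irrefl _), if_neg (lt_irrefl _), zero_smul, add_zero, Pi.smul_apply,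
    downScalar, mul_smul]
  congr 1
  exact chainDown_of_eq hp hz (fun k hk => ha k (by omega)) hi le_rfl fun k hk =>
    hne k (by omega) (by omega)

theorem chainUp_of_eq {m : ℕ} (hp : Function.Injective p) {g : (ι → Fin N) → E}
    (hg : ∀ b c, b < c → c ≤ m → ∀ i : ι → Fin N, i (p b) = i (p c) → g i = 0)
    (ha : ∀ k ≤ m, a ≠ p k) {i : ι → Fin N} (hi : i (p 0) = i a)
    (hne : ∀ k ≤ m, k ≠ 0 → i (p k) ≠ i a) :
    chainUp q U V p a (m + 1) g i = ((algebraMap ℂ K q⁻¹ * U 0 - algebraMap ℂ K q * V 0) *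
      ∏ k ∈ Finset.range m, (U (k + 1) - V (k + 1))) • g i := by
  induction m generalizing g with
  | zero =>
    rw [Finset.range_zero, Finset.prod_empty, mul_one, chainUp, LinearMap.comp_apply, chainUp,
      LinearMap.id_apply, rop_apply, diagCoeff, if_pos hi, swapCoeff, hi, if_neg (lt_irrefl _),
      if_neg (lt_irrefl _), zero_smul, add_zero]
  | succ m ih =>
    have h1 : p 0 ≠ p (m + 1) := hp.ne (by omega)
    rw [chainUp, LinearMap.comp_apply, ih _ (fun k hk => ha k (by omega))
      fun k hk => hne k (by omega), rop_apply, diagCoeff, if_neg (hne _ le_rfl (by omega)),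
      hg 0 (m + 1) (by omega) le_rfl (i ∘ _), smul_zero, add_zero, smul_smul, Finset.prod_range_succ,
      mul_assoc]
    · rw [Function.comp_apply, Function.comp_apply, Equiv.swap_apply_left,
        Equiv.swap_apply_of_ne_of_ne h1 (ha 0 (by omega)).symm, hi]
    · intro b c hbc hcm j hj
      have h2 : p b ≠ p (m + 1) := hp.ne (by omega)
      have h3 : p c ≠ p (m + 1) := hp.ne (by omega)
      rw [rop_apply, hg b c hbc (by omega) j hj, hg b c hbc (by omega), smul_zero, smul_zero, add_zero]
      rw [Function.comp_apply, Function.comp_apply,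
        Equiv.swap_apply_of_ne_of_ne h2 (ha b (by omega)).symm,
        Equiv.swap_apply_of_ne_of_ne h3 (ha c (by omega)).symm, hj]

/-- The scalar by which `R_{p_0,a} ⋯ R_{p_n,a}` acts on q-antisymmetric functions. -/
noncomputable def upScalar (q : ℂ) (U V : ℕ → K) (n : ℕ) : K :=
  (algebraMap ℂ K q⁻¹ * U 0 - algebraMap ℂ K q * V 0) *
    ∏ k ∈ Finset.range n, (U (k + 1) - V (k + 1))

/-- As for the opposite order, but with the value of a placed at p_0, the outermost operator of this
chain. -/
theorem chainUp_antiOn {n : ℕ} (hn : N = n + 1) (hq0 : q ≠ 0) (hq : ∀ k : ℕ, 0 < k → q ^ k ≠ 1)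
    (hp : Function.Injective p) (ha : ∀ k < N, a ≠ p k)
    (hUV : ∀ k, algebraMap ℂ K (q ^ 2) * U k * V (k + 1) = V k * U (k + 1)) {g : (ι → Fin N) → E}
    (hg : AntiOn K q p N g) : chainUp q U V p a N g = upScalar q U V n • g := by
  rw [← sub_eq_zero]
  funext i
  refine ((antiOn_of_exists hq0 hq hg fun k hk g => exists_chainUp_rop hq0 hp (by omega) ha (hUV k)
    g).sub (hg.smul _)).eq_zero_of_position hq0 hp ha (l := 0) (by omega) (fun i hne hi => ?_) i
  have hz : ∀ b c, b < c → c ≤ n → ∀ i : ι → Fin N, i (p b) = i (p c) → g i = 0 :=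
    fun b c hbc hc i hi => hg.eq_zero hq0 hp hbc (by omega) hi
  subst hn
  rw [Pi.sub_apply, sub_eq_zero, Pi.smul_apply, upScalar]
  exact chainUp_of_eq hp hz (fun k hk => ha k (by omega)) hi fun k hk => hne k (by omega)

end Chain
end TwistedYangian

namespace TwistedYangian

open Sum

/-! ### The row antisymmetrizer as a pairing, and its effect on products of R-matrices -/

section Alternation

variable {N : ℕ} {K E : Type*} [CommRing K] [Algebra ℂ K] [Ring E] [Algebra K E] {q : ℂ}

/-- The family `i` with the first `N` row indices replaced. -/
def withRows (r : Fin N → Fin N) (i : ℕ ⊕ ℕ → Fin N) : ℕ ⊕ ℕ → Fin N :=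
  Sum.elim (fun n => if h : n < N then r ⟨n, h⟩ else i (inl n)) (i ∘ inr)

theorem withRows_row (r : Fin N → Fin N) (i : ℕ ⊕ ℕ → Fin N) (k : Fin N) :
    withRows r i (inl k) = r k := dif_pos k.2

theorem withRows_of_ne (r : Fin N → Fin N) (i : ℕ ⊕ ℕ → Fin N) {a : ℕ ⊕ ℕ}
    (ha : ∀ k < N, a ≠ inl k) : withRows r i a = i a := by
  rcases a with n | n
  · exact dif_neg fun h => ha n h rfl
  · rfl

theorem withRows_comp_swap (r : Fin N → Fin N) (i : ℕ ⊕ ℕ → Fin N) {a b : ℕ ⊕ ℕ}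
    (ha : ∀ k < N, a ≠ inl k) (hb : ∀ k < N, b ≠ inl k) :
    withRows r (i ∘ Equiv.swap a b) = withRows r i ∘ Equiv.swap a b := by
  funext p
  by_cases hp : ∃ k : Fin N, p = inl k.val
  · obtain ⟨k, rfl⟩ := hp
    rw [Function.comp_apply, Equiv.swap_apply_of_ne_of_ne (ha k k.2).symm (hb k k.2).symm,
      withRows_row, withRows_row]
  · have hp' : ∀ k < N, p ≠ inl k := fun k hk h => hp ⟨⟨k, hk⟩, h⟩
    have hs : ∀ k < N, Equiv.swap a b p ≠ inl k := by
      intro k hk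
      rw [Equiv.swap_apply_def]
      split_ifs
      · exact hb k hk
      · exact ha k hk
      · exact hp' k hk
    rw [Function.comp_apply, withRows_of_ne _ _ hp', withRows_of_ne _ _ hs, Function.comp_apply]

/-- The coefficients of the q-antisymmetrization over `N` indices with values in `Fin N`. -/
noncomputable def signCoeff (q : ℂ) (σ : Equiv.Perm (Fin N)) : ℂ :=
  ((Equiv.Perm.sign σ : ℤ) : ℂ) * (q ^ inversions (σ : Fin N → Fin N))⁻¹

/-- The value at rows `0, …, N-1` of the q-antisymmetrization over the first `N` rows. -/
noncomputable def alt (K : Type*) [CommRing K] [Algebra ℂ K] [Algebra K E] (q : ℂ)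
    (H : (ℕ ⊕ ℕ → Fin N) → E) (i : ℕ ⊕ ℕ → Fin N) : E :=
  ∑ σ : Equiv.Perm (Fin N), algebraMap ℂ K (signCoeff q σ) • H (withRows σ i)

theorem alt_rop {a b : ℕ ⊕ ℕ} (ha : ∀ k < N, a ≠ inl k) (hb : ∀ k < N, b ≠ inl k) (u v : K)
    (H : (ℕ ⊕ ℕ → Fin N) → E) : alt K q (rop q a b u v H) = rop q a b u v (alt K q H) := by
  funext i
  simp only [alt, rop_apply, withRows_of_ne _ _ ha, withRows_of_ne _ _ hb,
    withRows_comp_swap _ _ ha hb, smul_add, Finset.sum_add_distrib, Finset.smul_sum]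
  simp only [smul_comm (algebraMap ℂ K (signCoeff _ _))]

theorem alt_smul (c : K) (H : (ℕ ⊕ ℕ → Fin N) → E) : alt K q (c • H) = c • alt K q H := by
  funext i
  simp only [alt, Pi.smul_apply, Finset.smul_sum, smul_comm c]

theorem alt_mul_right (H : (ℕ ⊕ ℕ → Fin N) → E) {f : (ℕ ⊕ ℕ → Fin N) → E}
    (hf : ∀ r i, f (withRows r i) = f i) : alt K q (H * f) = alt K q H * f := by
  funext i
  simp only [alt, Pi.mul_apply, hf, Finset.sum_mul, smul_mul_assoc]

theorem alt_mul_left (H : (ℕ ⊕ ℕ → Fin N) → E) {f : (ℕ ⊕ ℕ → Fin N) → E}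
    (hf : ∀ r i, f (withRows r i) = f i) : alt K q (f * H) = f * alt K q H := by
  funext i
  simp only [alt, Pi.mul_apply, hf, Finset.mul_sum, mul_smul_comm]

theorem alt_brk {x w : ℕ → ℕ → K} {S : ℕ → Fin N → Fin N → E} {R : ℕ → Fin N}
    (hR : ∀ k : Fin N, R k = k) (i : ℕ ⊕ ℕ → Fin N) :
    alt K q (brk q x w S N) i = minor q x w S N R (i ∘ inr) := by
  rw [alt, minor, rowAlt]
  refine Finset.sum_congr rfl fun σ _ => ?_
  have h1 : (fun k : Fin N => permute R σ k) = σ := by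
    rw [permute_fin]
    funext k
    exact hR _
  refine congrArg₂ (· • ·) ?_ ?_
  · rw [signCoeff, altCoeff, seqInv, h1]
  · refine dependsOn_brk (q := q) (x := x) (w := w) (S := S) N fun p hp => ?_
    rcases p with n | n
    · exact (withRows_row σ i ⟨n, hp⟩).trans (congrFun h1 ⟨n, hp⟩).symm
    · rfl

/-- The sum of `ψ H` over the first `N` row indices and the index at the position `a`. -/
noncomputable def pairing (a : ℕ ⊕ ℕ) (ψ : (ℕ ⊕ ℕ → Fin N) → K) (H : (ℕ ⊕ ℕ → Fin N) → E)
    (i : ℕ ⊕ ℕ → Fin N) : E :=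
  ∑ z : (Fin N → Fin N) × Fin N, ψ (withRows z.1 (Function.update i a z.2)) •
    H (withRows z.1 (Function.update i a z.2))

theorem sum_comp_swap {a : ℕ ⊕ ℕ} (ha : ∀ k < N, a ≠ inl k) {k : ℕ} (hk : k < N)
    (F : (ℕ ⊕ ℕ → Fin N) → E) (i : ℕ ⊕ ℕ → Fin N) :
    ∑ z : (Fin N → Fin N) × Fin N,
        F (withRows z.1 (Function.update i a z.2) ∘ Equiv.swap a (inl k)) =
      ∑ z : (Fin N → Fin N) × Fin N, F (withRows z.1 (Function.update i a z.2)) := by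
  have hinv : Function.Involutive fun z : (Fin N → Fin N) × Fin N =>
      (Function.update z.1 ⟨k, hk⟩ z.2, z.1 ⟨k, hk⟩) := by
    intro z
    simp
  refine Fintype.sum_equiv hinv.toPerm _ _ fun z => congrArg F ?_
  rw [Function.Involutive.coe_toPerm]
  funext p
  rw [Function.comp_apply, Equiv.swap_apply_def]
  split_ifs with h1 h2
  · subst h1
    rw [withRows_row _ _ ⟨k, hk⟩, withRows_of_ne _ _ ha, Function.update_self]
  · subst h2
    rw [withRows_row _ _ ⟨k, hk⟩, withRows_of_ne _ _ ha, Function.update_self]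
    exact (Function.update_self (⟨k, hk⟩ : Fin N) z.2 z.1).symm
  · by_cases hp : ∃ l : Fin N, p = inl l.val
    · obtain ⟨l, rfl⟩ := hp
      rw [withRows_row, withRows_row]
      refine (Function.update_of_ne ?_ _ _).symm
      rintro rfl
      exact h2 rfl
    · have hp' : ∀ k < N, p ≠ inl k := fun k hk h => hp ⟨⟨k, hk⟩, h⟩
      rw [withRows_of_ne _ _ hp', withRows_of_ne _ _ hp', Function.update_of_ne h1,
        Function.update_of_ne h1]

theorem diagCoeff_comm {L : Type*} [LinearOrder L] (u v : K) (a b : L) :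
    diagCoeff q u v a b = diagCoeff q u v b a := by
  simp only [diagCoeff, eq_comm]

/-- With respect to the sum over all values, the transpose of R is R with its positions exchanged:
the swap permutes the terms of the sum. -/
theorem pairing_rop {a b c : ℕ ⊕ ℕ} (ha : ∀ k < N, a ≠ inl k) {k : ℕ} (hk : k < N)
    (hbc : b = a ∧ c = inl k ∨ b = inl k ∧ c = a) (u v : K) (ψ : (ℕ ⊕ ℕ → Fin N) → K)
    (H : (ℕ ⊕ ℕ → Fin N) → E) (i : ℕ ⊕ ℕ → Fin N) :
    pairing a ψ (rop q b c u v H) i = pairing a (rop q c b u v ψ) H i := by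
  have hswap : Equiv.swap b c = Equiv.swap a (inl k) ∧ Equiv.swap c b = Equiv.swap a (inl k) := by
    rcases hbc with ⟨rfl, rfl⟩ | ⟨rfl, rfl⟩
    · exact ⟨rfl, Equiv.swap_comm _ _⟩
    · exact ⟨Equiv.swap_comm _ _, rfl⟩
  have h1 := sum_comp_swap ha hk (fun j => (swapCoeff q u v (j c) (j b) *
    ψ (j ∘ Equiv.swap a (inl k))) • H j) i
  simp only [pairing, rop_apply, smul_add, Finset.sum_add_distrib, add_smul, hswap.1, hswap.2]
  congr 1
  · refine Finset.sum_congr rfl fun z _ => ?_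
    rw [diagCoeff_comm, smul_smul, smul_eq_mul, mul_comm]
  · simp only [smul_eq_mul]
    rw [← h1]
    refine Finset.sum_congr rfl fun z _ => ?_
    rw [smul_smul, mul_comm]
    have h2 : ∀ j : ℕ ⊕ ℕ → Fin N, (j ∘ Equiv.swap a (inl k)) c = j b ∧
        (j ∘ Equiv.swap a (inl k)) b = j c := by
      intro j
      rw [← hswap.1]
      simp
    rw [(h2 _).1, (h2 _).2]
    congr 3
    funext p
    simp

theorem pairing_chainUp {a : ℕ ⊕ ℕ} (ha : ∀ k < N, a ≠ inl k) {U V : ℕ → K} {m : ℕ} (hm : m ≤ N)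
    (ψ : (ℕ ⊕ ℕ → Fin N) → K) (H : (ℕ ⊕ ℕ → Fin N) → E) (i : ℕ ⊕ ℕ → Fin N) :
    pairing a ψ (chainUp q U V inl a m H) i = pairing a (chainDown q U V inl a m ψ) H i := by
  induction m generalizing H with
  | zero => rfl
  | succ m ih =>
    rw [chainUp, LinearMap.comp_apply, ih (by omega), pairing_rop ha hm (Or.inr ⟨rfl, rfl⟩)]
    rfl

theorem pairing_chainDown {a : ℕ ⊕ ℕ} (ha : ∀ k < N, a ≠ inl k) {U V : ℕ → K} {m : ℕ} (hm : m ≤ N)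
    (ψ : (ℕ ⊕ ℕ → Fin N) → K) (H : (ℕ ⊕ ℕ → Fin N) → E) (i : ℕ ⊕ ℕ → Fin N) :
    pairing a ψ (chainDown q U V inl a m H) i = pairing a (chainUp q U V inl a m ψ) H i := by
  induction m generalizing ψ with
  | zero => rfl
  | succ m ih =>
    rw [chainDown, LinearMap.comp_apply, pairing_rop ha hm (Or.inl ⟨rfl, rfl⟩), ih (by omega)]
    rfl

/-- The function of which the q-antisymmetrization is the pairing. -/
noncomputable def altKernel (K : Type*) [CommRing K] [Algebra ℂ K] (q : ℂ) (a : ℕ ⊕ ℕ) (y : Fin N)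
    (j : ℕ ⊕ ℕ → Fin N) : K :=
  if j a = y then ∑ σ : Equiv.Perm (Fin N),
    if (fun k : Fin N => j (inl k)) = σ then algebraMap ℂ K (signCoeff q σ) else 0 else 0

theorem pairing_altKernel {a : ℕ ⊕ ℕ} (ha : ∀ k < N, a ≠ inl k) (H : (ℕ ⊕ ℕ → Fin N) → E)
    (i : ℕ ⊕ ℕ → Fin N) : pairing a (altKernel K q a (i a)) H i = alt K q H i := by
  have h1 : ∀ (r : Fin N → Fin N) (i : ℕ ⊕ ℕ → Fin N), (fun k : Fin N => withRows r i (inl k)) = r :=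
    fun r i => funext fun k => withRows_row r i k
  rw [pairing, Fintype.sum_prod_type_right]
  simp only [altKernel, withRows_of_ne _ _ ha, Function.update_self, h1]
  rw [Finset.sum_eq_single (i a)]
  · simp only [if_true, Function.update_eq_self, Finset.sum_smul, ite_smul, zero_smul]
    rw [Finset.sum_comm]
    simp only [Finset.sum_ite_eq', Finset.mem_univ, if_true, alt]
  · intro y _ hy
    simp [hy]
  · simp

theorem inversions_perm_mul_swap (σ : Equiv.Perm (Fin N)) {a b : Fin N} (hab : b.val = a.val + 1)
    (h : σ a < σ b) : inversions (⇑(σ * Equiv.swap a b)) = inversions σ + 1 := by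
  have := inversions_swap (σ : Fin N → Fin N) hab
  rw [if_pos h, if_neg h.not_gt] at this
  rw [Equiv.Perm.coe_mul]
  omega

/-- Since the antisymmetrizer is a pairing with an antisymmetric kernel, operators on rows can be
moved onto the kernel, where they act by scalars. -/
theorem antiOn_altKernel {a : ℕ ⊕ ℕ} (ha : ∀ k < N, a ≠ inl k) (y : Fin N) :
    AntiOn K q inl N (altKernel K q a y) := by
  intro k hk j
  have hs : ∀ j : ℕ ⊕ ℕ → Fin N, (fun l : Fin N =>
      (j ∘ Equiv.swap (inl k) (inl (k + 1))) (inl l.val)) =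
      (fun l : Fin N => j (inl l)) ∘ Equiv.swap (⟨k, by omega⟩ : Fin N) ⟨k + 1, hk⟩ := by
    intro j
    funext l
    simp only [Function.comp_apply, Equiv.swap_apply_def, Fin.ext_iff, inl.injEq]
    split_ifs <;> rfl
  constructor
  · intro h
    rw [altKernel]
    split_ifs
    · refine Finset.sum_eq_zero fun σ _ => if_neg fun hσ => ?_
      have h1 := congrFun hσ ⟨k, by omega⟩
      have h2 := congrFun hσ ⟨k + 1, hk⟩
      have h3 := σ.injective (h1.symm.trans (h.trans h2))
      simp at h3
    · rfl
  · intro h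
    rw [altKernel, altKernel, Function.comp_apply,
      Equiv.swap_apply_of_ne_of_ne (ha _ (by omega)) (ha _ (by omega))]
    split_ifs
    · rw [hs, Finset.smul_sum]
      refine (Fintype.sum_equiv (Equiv.mulRight (Equiv.swap ⟨k, by omega⟩ ⟨k + 1, hk⟩)) _ _
        fun σ => ?_).symm
      rw [Equiv.coe_mulRight]
      by_cases hσ : (fun l : Fin N => j (inl l)) = σ
      · rw [if_pos hσ, hσ, if_pos (by rw [Equiv.Perm.coe_mul]), smul_eq_mul, signCoeff, signCoeff,
          Equiv.Perm.sign_mul, Equiv.Perm.sign_swap (by simp [Fin.ext_iff]),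
          inversions_perm_mul_swap σ rfl
            (by rw [← congrFun hσ ⟨k, by omega⟩, ← congrFun hσ ⟨k + 1, hk⟩]; exact h), pow_succ,
          ← map_neg, ← map_mul]
        congr 1
        push_cast
        rw [mul_inv]
        ring
      · rw [if_neg hσ, if_neg, smul_zero]
        intro h
        apply hσ
        rw [Equiv.Perm.coe_mul] at h
        funext l
        have := congrFun h (Equiv.swap (⟨k, by omega⟩ : Fin N) ⟨k + 1, hk⟩ l)
        simpa using this
    · rw [smul_zero]

theorem pairing_smul {a : ℕ ⊕ ℕ} (c : K) (ψ : (ℕ ⊕ ℕ → Fin N) → K) (H : (ℕ ⊕ ℕ → Fin N) → E)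
    (i : ℕ ⊕ ℕ → Fin N) : pairing a (c • ψ) H i = c • pairing a ψ H i := by
  simp only [pairing, Finset.smul_sum, Pi.smul_apply, smul_smul, smul_eq_mul]

/-- Under the pairing the chain becomes the chain in the opposite order acting on the antisymmetric
kernel. -/
theorem alt_chainUp {n : ℕ} (hn : N = n + 1) (hq0 : q ≠ 0) (hq : ∀ k : ℕ, 0 < k → q ^ k ≠ 1)
    {a : ℕ ⊕ ℕ} (ha : ∀ k < N, a ≠ inl k) {U V : ℕ → K}
    (hUV : ∀ k, U (k + 1) * algebraMap ℂ K (q ^ 2) * V k = V (k + 1) * U k)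
    (H : (ℕ ⊕ ℕ → Fin N) → E) :
    alt K q (chainUp q U V inl a N H) = downScalar q U V n • alt K q H := by
  funext i
  rw [← pairing_altKernel ha, pairing_chainUp ha le_rfl,
    chainDown_antiOn hn hq0 hq inl_injective ha hUV (antiOn_altKernel ha _), pairing_smul,
    pairing_altKernel ha]
  rfl

theorem alt_chainDown {n : ℕ} (hn : N = n + 1) (hq0 : q ≠ 0) (hq : ∀ k : ℕ, 0 < k → q ^ k ≠ 1)
    {a : ℕ ⊕ ℕ} (ha : ∀ k < N, a ≠ inl k) {U V : ℕ → K}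
    (hUV : ∀ k, algebraMap ℂ K (q ^ 2) * U k * V (k + 1) = V k * U (k + 1))
    (H : (ℕ ⊕ ℕ → Fin N) → E) :
    alt K q (chainDown q U V inl a N H) = upScalar q U V n • alt K q H := by
  funext i
  rw [← pairing_altKernel ha, pairing_chainDown ha le_rfl,
    chainUp_antiOn hn hq0 hq inl_injective ha hUV (antiOn_altKernel ha _), pairing_smul,
    pairing_altKernel ha]
  rfl

end Alternation
end TwistedYangian

namespace TwistedYangian

open Sum

/-! ### Commutation of the Sklyanin determinant with the entries -/

section Central

variable {N : ℕ} {K E : Type*} [CommRing K] [Algebra ℂ K] [Ring E] [Algebra K E] {q : ℂ}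
  {x w : ℕ → ℕ → K} {S : ℕ → Fin N → Fin N → E} {U V : ℕ → K}

theorem rowOps_eq (n m : ℕ) (g : (ℕ ⊕ ℕ → Fin N) → E) :
    rowOps q U V n m g = chainUp q U V inl (inl n) m g := by
  induction m generalizing g with
  | zero => rfl
  | succ m ih => rw [rowOps, LinearMap.comp_apply, ih, chainUp, LinearMap.comp_apply]

theorem colOps_eq (n m : ℕ) (g : (ℕ ⊕ ℕ → Fin N) → E) :
    colOps q U V n m g = chainDown q U V inr (inr n) m g := by
  induction m with
  | zero => rfl
  | succ m ih => rw [colOps, LinearMap.comp_apply, ih, chainDown, LinearMap.comp_apply]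

theorem trans_eq (n m : ℕ) (g : (ℕ ⊕ ℕ → Fin N) → E) : trans q x w n m g =
    (∏ k ∈ Finset.range m, w k n) • chainUp q (fun k => x k n) 1 inr (inl n) m g := by
  induction m generalizing g with
  | zero => rw [Finset.range_zero, Finset.prod_empty, one_smul]; rfl
  | succ m ih =>
    rw [trans_succ, ih, rbar_eq, map_smul, smul_smul, ← Finset.prod_range_succ]
    rfl

theorem leftTrans_eq (n m : ℕ) (g : (ℕ ⊕ ℕ → Fin N) → E) : leftTrans q x w n m g =
    (∏ k ∈ Finset.range m, w k n) • chainDown q (fun k => x k n) 1 inl (inr n) m g := by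
  induction m with
  | zero => rw [Finset.range_zero, Finset.prod_empty, one_smul]; rfl
  | succ m ih =>
    rw [leftTrans, LinearMap.comp_apply, ih, LinearMap.smul_apply, map_smul, smul_smul, mul_comm,
      ← Finset.prod_range_succ]
    rfl

theorem alt_chainUp_comm {a : ℕ ⊕ ℕ} (ha : ∀ k < N, a ≠ inl k) (m : ℕ)
    (H : (ℕ ⊕ ℕ → Fin N) → E) :
    alt K q (chainUp q U V inr a m H) = chainUp q U V inr a m (alt K q H) := by
  induction m generalizing H with
  | zero => rfl
  | succ m ih =>
    rw [chainUp, LinearMap.comp_apply, ih, alt_rop (by simp) ha]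
    rfl

theorem alt_chainDown_comm {a : ℕ ⊕ ℕ} (ha : ∀ k < N, a ≠ inl k) (m : ℕ)
    (H : (ℕ ⊕ ℕ → Fin N) → E) :
    alt K q (chainDown q U V inr a m H) = chainDown q U V inr a m (alt K q H) := by
  induction m generalizing H with
  | zero => rfl
  | succ m ih =>
    rw [chainDown, LinearMap.comp_apply, alt_rop ha (by simp), ih]
    rfl

/-- After antisymmetrization over rows, both sides of `rowOps_trans` contain two chains: row chains
are evaluated by the antisymmetrizer, column chains by the antisymmetry `hanti` of the minor in its
columns. The same scalars arise on both sides. -/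
theorem smul_minor_commute {n : ℕ} (hn : N = n + 1) (hq0 : q ≠ 0)
    (hq : ∀ k : ℕ, 0 < k → q ^ k ≠ 1) (hx : ∀ a < N, ∀ c < a, x c a * U a = V a * x c N)
    (hx' : ∀ a < N, ∀ c < a, U c * x c a = V c * x a N)
    (hS : ∀ a < N, rop q (inl a) (inl N) (U a) (V a) (rbar q x w a N (entry S a * entry S N)) =
      rop q (inr N) (inr a) (U a) (V a)
        (w a N • rop q (inr N) (inl a) (x a N) 1 (entry S N * entry S a)))
    (hUV : ∀ k, U (k + 1) * algebraMap ℂ K (q ^ 2) * V k = V (k + 1) * U k)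
    (hX : ∀ k, algebraMap ℂ K (q ^ 2) * x k N = x (k + 1) N) {R : ℕ → Fin N}
    (hR : ∀ k : Fin N, R k = k) (hanti : AntiOn K q id N (minor q x w S N R)) (C : ℕ → Fin N)
    (r c : Fin N) :
    (downScalar q U V n * ((∏ k ∈ Finset.range N, w k N) * upScalar q (fun k => x k N) 1 n)) •
        (minor q x w S N R C * S N r c) =
      (downScalar q U V n * ((∏ k ∈ Finset.range N, w k N) * upScalar q (fun k => x k N) 1 n)) •
        (S N r c * minor q x w S N R C) := by
  have hX' : ∀ k, algebraMap ℂ K (q ^ 2) * (fun k => x k N) k * (1 : ℕ → K) (k + 1) =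
      (1 : ℕ → K) k * (fun k => x k N) (k + 1) := by
    intro k
    rw [Pi.one_apply, Pi.one_apply, mul_one, one_mul]
    exact hX k
  have hrow : ∀ k < N, (inl N : ℕ ⊕ ℕ) ≠ inl k := by
    intro k hk h
    exact hk.ne' (inl.inj h)
  have hcol : ∀ k < N, (inr N : ℕ ⊕ ℕ) ≠ inr k := by
    intro k hk h
    exact hk.ne' (inr.inj h)
  have hrc : ∀ k < N, (inr N : ℕ ⊕ ℕ) ≠ inl k := fun k _ => by simp
  have hcr : ∀ k < N, (inl N : ℕ ⊕ ℕ) ≠ inr k := fun k _ => by simp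
  have hent : ∀ r i, entry S N (withRows r i) = entry S N i := by
    intro r i
    rw [entry, entry, withRows_of_ne _ _ hrow, withRows_of_ne _ _ hrc]
  have hbrk : ∀ i, alt K q (brk q x w S N) i = minor q x w S N R (i ∘ inr) := alt_brk hR
  have hcs : ∀ (i : ℕ ⊕ ℕ → Fin N) a b, (i ∘ Equiv.swap (inr a) (inr b)) ∘ inr =
      (i ∘ inr) ∘ Equiv.swap a b := by
    intro i a b
    funext l
    simp only [Function.comp_apply, Equiv.swap_apply_def, inr.injEq]
    split_ifs <;> rfl
  have hes : ∀ k, k + 1 < N → ∀ i : ℕ ⊕ ℕ → Fin N,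
      entry S N (i ∘ Equiv.swap (inr k) (inr (k + 1))) = entry S N i := by
    intro k hk i
    rw [entry, entry, Function.comp_apply, Function.comp_apply,
      Equiv.swap_apply_of_ne_of_ne (by simp) (by simp),
      Equiv.swap_apply_of_ne_of_ne (hcol _ (by omega)) (hcol _ (by omega))]
  have hL : AntiOn K q inr N (alt K q (brk q x w S N) * entry S N) := by
    intro k hk i
    obtain ⟨h1, h2⟩ := hanti k hk (i ∘ inr)
    refine ⟨fun h => ?_, fun h => ?_⟩
    · rw [Pi.mul_apply, hbrk, h1 h, zero_mul]
    · rw [Pi.mul_apply, Pi.mul_apply, hbrk, hbrk, hes k hk, hcs]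
      rw [← smul_mul_assoc, ← h2 h]
      rfl
  have hR' : AntiOn K q inr N (entry S N * alt K q (brk q x w S N)) := by
    intro k hk i
    obtain ⟨h1, h2⟩ := hanti k hk (i ∘ inr)
    refine ⟨fun h => ?_, fun h => ?_⟩
    · rw [Pi.mul_apply, hbrk, h1 h, mul_zero]
    · rw [Pi.mul_apply, Pi.mul_apply, hbrk, hbrk, hes k hk, hcs]
      rw [← mul_smul_comm, ← h2 h]
      rfl
  have key := congrArg (alt K q) (rowOps_trans (x := x) (w := w) (S := S) (U := U) (V := V) hq0
    (le_refl N) hx hx' hS)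
  rw [rowOps_eq, colOps_eq, alt_chainUp hn hq0 hq hrow hUV, alt_chainDown_comm hrc, trans_eq,
    leftTrans_eq, alt_smul, alt_smul, alt_chainUp_comm hrow, alt_chainDown hn hq0 hq hrc hX',
    alt_mul_right _ hent, alt_mul_left _ hent, map_smul, map_smul,
    chainUp_antiOn hn hq0 hq inr_injective hcr hX' hL,
    chainDown_antiOn hn hq0 hq inr_injective hcol hUV hR'] at key
  -- The extra matrix has its indices at position N, where the row is r and the column c.
  have h1 := congrFun key (Sum.elim (fun _ => r) fun k => if k < N then C k else c)
  have h2 : minor q x w S N R (Sum.elim (fun _ => r) (fun k => if k < N then C k else c) ∘ (inr : ℕ → ℕ ⊕ ℕ)) =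
      minor q x w S N R C := minor_congr R fun k hk => if_pos hk
  simp only [Pi.smul_apply, Pi.mul_apply, hbrk, h2, entry, Sum.elim_inl, Sum.elim_inr, lt_irrefl,
    if_false, smul_smul] at h1
  rw [mul_smul, smul_smul, h1]
  congr 1
  ring

end Central

/-! ### Minors under homomorphisms and changes of parameters -/

section Naturality

variable {N : ℕ} {K E K' E' : Type*} [CommRing K] [Algebra ℂ K] [Ring E] [Algebra K E] [CommRing K']
  [Algebra ℂ K'] [Ring E'] [Algebra K' E'] {q : ℂ}

theorem trans_map {x w : ℕ → ℕ → K} (fK : K →+* K') (fE : E →+* E')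
    (hK : ∀ c : ℂ, fK (algebraMap ℂ K c) = algebraMap ℂ K' c)
    (hE : ∀ (k : K) (e : E), fE (k • e) = fK k • fE e) (b k : ℕ) (g : (ℕ ⊕ ℕ → Fin N) → E) :
    fE ∘ trans q x w b k g =
      trans q (fun a b => fK (x a b)) (fun a b => fK (w a b)) b k (fE ∘ g) := by
  induction k generalizing g with
  | zero => rfl
  | succ k ih =>
    rw [trans_succ, trans_succ, ih]
    congr 1
    funext i
    rw [rbar_eq, rbar_eq, Function.comp_apply, Pi.smul_apply, hE, rop_map fK fE hK hE, map_one]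
    rfl

theorem brk_map {x w : ℕ → ℕ → K} {S : ℕ → Fin N → Fin N → E} (fK : K →+* K') (fE : E →+* E')
    (hK : ∀ c : ℂ, fK (algebraMap ℂ K c) = algebraMap ℂ K' c)
    (hE : ∀ (k : K) (e : E), fE (k • e) = fK k • fE e) (m : ℕ) :
    fE ∘ brk q x w S m = brk q (fun a b => fK (x a b)) (fun a b => fK (w a b))
      (fun n r c => fE (S n r c)) m := by
  induction m with
  | zero => exact funext fun i => map_one fE
  | succ m ih =>
    rw [brk_succ, brk_succ, trans_map fK fE hK hE, ← ih]
    congr 1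
    exact funext fun i => map_mul fE _ _

theorem minor_map {x w : ℕ → ℕ → K} {S : ℕ → Fin N → Fin N → E} (fK : K →+* K') (fE : E →+* E')
    (hK : ∀ c : ℂ, fK (algebraMap ℂ K c) = algebraMap ℂ K' c)
    (hE : ∀ (k : K) (e : E), fE (k • e) = fK k • fE e) (m : ℕ) (R C : ℕ → Fin N) :
    fE (minor q x w S m R C) = minor q (fun a b => fK (x a b)) (fun a b => fK (w a b))
      (fun n r c => fE (S n r c)) m R C := by
  simp only [minor, rowAlt, map_sum, hE, hK, ← brk_map fK fE hK hE]
  rfl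

theorem trans_congr_param {x w x' w' : ℕ → ℕ → K} {b k : ℕ} (hx : ∀ a < k, x a b = x' a b)
    (hw : ∀ a < k, w a b = w' a b) (g : (ℕ ⊕ ℕ → Fin N) → E) :
    trans q x w b k g = trans q x' w' b k g := by
  induction k generalizing g with
  | zero => rfl
  | succ k ih =>
    rw [trans_succ, trans_succ, ih (fun a ha => hx a (ha.trans k.lt_succ_self))
      (fun a ha => hw a (ha.trans k.lt_succ_self)), rbar_eq, rbar_eq, hx k k.lt_succ_self,
      hw k k.lt_succ_self]

theorem minor_congr_param {x w x' w' : ℕ → ℕ → K} {S S' : ℕ → Fin N → Fin N → E} {m : ℕ}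
    (hx : ∀ a b, a < b → b < m → x a b = x' a b) (hw : ∀ a b, a < b → b < m → w a b = w' a b)
    (hS : ∀ a < m, S a = S' a) (R C : ℕ → Fin N) :
    minor q x w S m R C = minor q x' w' S' m R C := by
  have key : ∀ k ≤ m, brk q x w S k = brk q x' w' S' k := by
    intro k hk
    induction k with
    | zero => rfl
    | succ k ih =>
      rw [brk_succ, brk_succ, trans_congr_param (fun a ha => hx a k ha hk)
        (fun a ha => hw a k ha hk), ih (by omega)]
      congr 2
      funext i
      rw [entry, entry, hS k hk]
  rw [minor, minor, key m le_rfl]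

end Naturality

/-! ### Centrality for series -/

section CentralSeries

open PowerSeries

variable {N : ℕ} {A : Type*} [Ring A] [Algebra ℂ A] {q : ℂ}

theorem scaleVar_C_coeff (c : ℂ) (a : A) : scaleVar c (C a : A⟦X⟧) = C a := by
  ext n
  rw [scaleVar, coeff_mk, coeff_C]
  split_ifs with h
  · subst h
    simp
  · simp

/-- Only u is rescaled, while v stays an independent variable for the matrix that is moved through
the bracket. -/
theorem SeriesReflects.shift_left {S : Matrix (Fin N) (Fin N) A⟦X⟧} (hS : SeriesReflects q S)
    (a : ℕ) : Reflects (K := ℂ⟦X⟧⟦X⟧) (E := A⟦X⟧⟦X⟧) q (fun r c => C (TwistedYangian.shifts q S a r c))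
      (fun r c => PowerSeries.map C (S r c)) X (C (C (q ^ (2 * a)) * X))
      (C (C (q ^ (2 * a)) * X) * X) := by
  have h := hS.map (PowerSeries.map (scaleHom ℂ (q ^ (-2 * (a : ℤ)))))
    (PowerSeries.map (scaleHom A (q ^ (-2 * (a : ℤ)))))
    (fun c => by rw [algebraMap_series, map_C, scaleHom_apply, scaleVar_C])
    (fun k e => by
      rw [Algebra.smul_def, Algebra.smul_def, map_mul]
      congr 1
      ext n m
      simp only [RingHom.algebraMap_toAlgebra', coeff_map, scaleHom_apply, scaleVar, coeff_mk,
        smul_eq_mul, map_mul, Algebra.smul_def])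
  have hX : scaleVar (q ^ (-2 * (a : ℤ))) (X : ℂ⟦X⟧) = C (q ^ (2 * a)) * X := by
    rw [scaleVar_X]
    congr 2
    rw [neg_mul, zpow_neg, inv_inv]
    norm_cast
  have hC : ∀ f : A⟦X⟧, PowerSeries.map (scaleHom A (q ^ (-2 * (a : ℤ)))) (PowerSeries.map C f) =
      PowerSeries.map C f := by
    intro f
    ext n m
    rw [coeff_map, coeff_map, scaleHom_apply, scaleVar_C_coeff]
  simp only [map_mul, map_X, map_C, scaleHom_apply, hX, hC] at h
  rw [map_mul]
  exact h

/-- The Sklyanin determinant is central. -/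
theorem commute_minor_entry (hq0 : q ≠ 0) (hq : ∀ k : ℕ, 0 < k → q ^ k ≠ 1)
    {S : Matrix (Fin N) (Fin N) A⟦X⟧} (hS : SeriesReflects q S) {R : ℕ → Fin N}
    (hR : ∀ k : Fin N, R k = k) (D : ℕ → Fin N) (r c : Fin N) (m n : ℕ) :
    Commute (coeff m (S r c))
      (coeff n (minor q (sklyaninParam q) (sklyaninInv q) (shifts q S) N R D)) := by
  obtain ⟨l, hl⟩ : ∃ l, N = l + 1 := ⟨N - 1, by have := r.pos; omega⟩
  choose wt hwt using fun a : ℕ => exists_inverse_sub_one (C (q ^ (2 * a)) * X)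
  -- The factors 0, …, N−1 carry the parameters q^{-2a}u of the determinant, and the factor N
  -- carries v.
  let x : ℕ → ℕ → ℂ⟦X⟧⟦X⟧ := fun a b =>
    if b < N then C (sklyaninParam q a b) else C (C (q ^ (2 * a)) * X) * X
  let w : ℕ → ℕ → ℂ⟦X⟧⟦X⟧ := fun a b => if b < N then C (sklyaninInv q a b) else wt a
  let T : ℕ → Fin N → Fin N → A⟦X⟧⟦X⟧ := fun a =>
    if a < N then fun r c => C (shifts q S a r c) else fun r c => PowerSeries.map C (S r c)
  have hxN : ∀ a, x a N = C (C (q ^ (2 * a)) * X) * X := fun a => if_neg (lt_irrefl N)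
  have hwN : ∀ a, w a N = wt a := fun a => if_neg (lt_irrefl N)
  have hTN : T N = fun r c => PowerSeries.map C (S r c) := if_neg (lt_irrefl N)
  have hq2 : algebraMap ℂ ℂ⟦X⟧⟦X⟧ (q ^ 2) = C (C (q ^ 2)) := algebraMap_series _
  have hpow : ∀ a, (C (C (q ^ (2 * (a + 1)))) : ℂ⟦X⟧⟦X⟧) = C (C (q ^ 2)) * C (C (q ^ (2 * a))) := by
    intro a
    rw [← map_mul, ← map_mul, ← pow_add, mul_add, add_comm, mul_one]
  have hparam : ∀ a b, (C (sklyaninParam q a b) : ℂ⟦X⟧⟦X⟧) =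
      C (C (q ^ (2 * a))) * C (C (q ^ (2 * b))) * C X * C X := by
    intro a b
    rw [sklyaninParam, pow_add, sq]
    simp only [map_mul]
    ring
  have hsmul : ∀ (k : ℂ⟦X⟧) (e : A⟦X⟧), (C (k • e) : A⟦X⟧⟦X⟧) = (C k : ℂ⟦X⟧⟦X⟧) • C e := by
    intro k e
    rw [Algebra.smul_def, Algebra.smul_def, map_mul]
    congr 1
    exact (map_C _ _).symm
  have hmin : ∀ D, minor q x w T N R D =
      C (minor q (sklyaninParam q) (sklyaninInv q) (shifts q S) N R D) := by
    intro D
    refine (minor_congr_param (fun a b _ hb => if_pos hb) (fun a b _ hb => if_pos hb)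
      (fun a ha => if_pos ha) R D).trans (minor_map (K' := ℂ⟦X⟧⟦X⟧) (E' := A⟦X⟧⟦X⟧) (q := q) C C
        (fun c => (algebraMap_series c).symm) hsmul N R D).symm
  have hanti : AntiOn ℂ⟦X⟧⟦X⟧ q id N (minor q x w T N R) := by
    intro k hk i
    obtain ⟨h1, h2⟩ := antiOn_minor hq0 hq (fusion_shifts hq0 hS) N R k hk i
    refine ⟨fun h => ?_, fun h => ?_⟩
    · rw [hmin, h1 h, map_zero]
    · rw [hmin, hmin, h2 h, hsmul, map_neg, algebraMap_series]
      rfl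
  have h1 := smul_minor_commute (K := ℂ⟦X⟧⟦X⟧) (x := x) (w := w) (S := T) (U := fun _ => X)
    (V := fun a => C (C (q ^ (2 * a)) * X)) hl hq0 hq ?_ ?_ ?_ ?_ ?_ hR hanti D r c
  · have hne : ∀ f : ℂ⟦X⟧⟦X⟧, (∃ a b, coeff a (coeff b f) ≠ 0) → f ≠ 0 := by
      rintro f ⟨a, b, h⟩ rfl
      simp at h
    -- The scalars can be cancelled over the domain of series in two variables: the chain scalars
    -- have nonzero coefficients of low degree, and the factors `w` are invertible.
    have h2 := smul_double_series_injective (mul_ne_zero ?_ (mul_ne_zero ?_ ?_)) h1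
    · rw [hmin, hTN] at h2
      exact commute_map_C_C h2.symm m n
    · rw [downScalar]
      refine mul_ne_zero (hne _ ⟨0, 1, ?_⟩) (Finset.prod_ne_zero_iff.2 fun k _ => hne _ ⟨0, 1, ?_⟩)
      · simp [algebraMap_series, coeff_C, hq0]
      · simp [coeff_C]
    · refine Finset.prod_ne_zero_iff.2 fun k _ h => ?_
      have := hwt k
      rw [← hwN, h, zero_mul] at this
      exact zero_ne_one this
    · rw [upScalar]
      simp only [hxN]
      refine mul_ne_zero (hne _ ⟨0, 0, ?_⟩) (Finset.prod_ne_zero_iff.2 fun k _ => hne _ ⟨0, 0, ?_⟩)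
      · simp [algebraMap_series, hq0]
      · simp
  · intro a ha b hb
    rw [hxN]
    simp only [x, if_pos ha, hparam, map_mul]
    ring
  · intro a ha b hb
    rw [hxN]
    simp only [x, if_pos ha, hparam, map_mul]
    ring
  · intro a ha
    have h2 := Reflects.entry (S := T) (m := a) (n := N) ha.ne (U := X)
      (V := C (C (q ^ (2 * a)) * X)) (x := C (C (q ^ (2 * a)) * X) * X) (by
        rw [hTN]
        simp only [T, if_pos ha]
        exact hS.shift_left a)
    rw [rbar_eq, hxN, map_smul, map_smul]
    exact congrArg _ h2
  · intro k
    rw [hq2]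
    simp only [map_mul, hpow]
    ring
  · intro k
    rw [hxN, hxN, hq2]
    simp only [map_mul, hpow]
    ring

end CentralSeries
end TwistedYangian

namespace TwistedYangian

open Sum PowerSeries

/-! ### Factorization of S̃(u) and of the Sklyanin determinant of S(u) -/

section Sylvester

variable {A : Type*} [Ring A] [Algebra ℂ A] {q : ℂ}

theorem inversions_eq_zero {N m : ℕ} {i : Fin m → Fin N} (hi : StrictMono i) : inversions i = 0 := by
  rw [inversions, Finset.card_eq_zero, Finset.filter_eq_empty_iff]
  rintro p - ⟨h1, h2⟩
  exact (hi h1).not_gt h2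

theorem sklyaninMinor_of_strictMono {N m : ℕ} (hq : q ≠ 0) (S : Matrix (Fin N) (Fin N) A⟦X⟧)
    {r c : Fin m → Fin N} (hr : StrictMono r) {R C : ℕ → Fin N} (hR : ∀ a : Fin m, R a = r a)
    (hC : ∀ a : Fin m, C a = c a) :
    sklyaninMinor q S r c = minor q (sklyaninParam q) (sklyaninInv q) (shifts q S) m R C := by
  have h := sklyaninMinor_eq hq S m R C
  have hr' : (fun a : Fin m => R a) = r := funext hR
  have hc' : (fun a : Fin m => C a) = c := funext hC
  rw [seqInv, hr', hc', inversions_eq_zero hr, pow_zero, one_smul] at h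
  exact h

theorem sdet_eq {N : ℕ} (hq : q ≠ 0) (S : Matrix (Fin N) (Fin N) A⟦X⟧) {R C : ℕ → Fin N}
    (hR : ∀ a : Fin N, R a = a) (hC : ∀ a : Fin N, C a = a) :
    sdet q S = minor q (sklyaninParam q) (sklyaninInv q) (shifts q S) N R C :=
  sklyaninMinor_of_strictMono hq S strictMono_id hR hC

theorem minor_one {N : ℕ} {K E : Type*} [CommRing K] [Algebra ℂ K] [Ring E] [Algebra K E]
    {x w : ℕ → ℕ → K} {S : ℕ → Fin N → Fin N → E} (R C : ℕ → Fin N) :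
    minor q x w S 1 R C = S 0 (R 0) (C 0) := by
  have h0 : ∀ R : ℕ → Fin N, seqInv 1 R = 0 := fun R =>
    inversions_eq_zero (Subsingleton.strictMono _)
  have h1 : ∀ R : ℕ → Fin N, permute R (1 : Equiv.Perm (Fin 1)) = R := fun R => by
    funext n
    simp only [permute, Equiv.Perm.coe_one, id]
    split_ifs <;> rfl
  rw [minor, rowAlt, Fintype.sum_unique, Subsingleton.elim default (1 : Equiv.Perm (Fin 1)), altCoeff,
    h0, h1, brk_succ]
  simp [brk, trans_zero, entry]

variable {N M : ℕ}

/-- The Schur complement of the block of the last indices, at `q^{-M} u`. -/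
noncomputable def scaledSchur (q : ℂ) (S : Matrix (Fin (N + M)) (Fin (N + M)) A⟦X⟧)
    (G : Matrix (Fin M) (Fin M) A⟦X⟧) : Matrix (Fin N) (Fin N) A⟦X⟧ :=
  Matrix.of fun i j => scaleVar (q ^ M)⁻¹ (schur S G i j)

/-- The shifted parameters of the Schur complement minor are those of an ordinary minor after u ↦
q^{-M}u. Of the shift q^{-2M} of its entries, one half is this substitution and the other is
contained in `scaledSchur`. -/
theorem minor_append_shifts (hq0 : q ≠ 0) (hq : ∀ k : ℕ, 0 < k → q ^ k ≠ 1)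
    {S : Matrix (Fin (N + M)) (Fin (N + M)) A⟦X⟧} (hS : SeriesReflects q S)
    {G : Matrix (Fin M) (Fin M) A⟦X⟧} (hG : subLast S * G = 1) {j : ℕ → Fin M}
    (hj : ∀ a : Fin M, j a = a) (k : ℕ) (R C : ℕ → Fin N) :
    minor q (sklyaninParam q) (sklyaninInv q) (shifts q S) (k + M) (append j k R) (append j k C) =
      sdet q (subJ S) * scaleVar (q ^ M)⁻¹ (minor q (sklyaninParam q) (sklyaninInv q)
        (shifts q (scaledSchur q S G)) k R C) := by
  have hG' : ∀ n : ℕ, (Matrix.of fun a b => shifts q S n (Fin.natAdd N a) (Fin.natAdd N b)) *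
      G.map (scaleHom A (q ^ (-2 * (n : ℤ)))) = 1 := by
    intro n
    have : (Matrix.of fun a b => shifts q S n (Fin.natAdd N a) (Fin.natAdd N b)) =
        (subLast S).map (scaleHom A (q ^ (-2 * (n : ℤ)))) := rfl
    rw [this, ← Matrix.map_mul, hG, Matrix.map_one _ (map_zero _) (map_one _)]
  rw [minor_append hq0 hq (fusion_shifts hq0 hS) (sklyaninInv_mul q) hj hG', sdet_eq hq0 _ hj hj,
    ← scaleHom_apply, minor_map (scaleHom ℂ (q ^ M)⁻¹) (scaleHom A (q ^ M)⁻¹)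
      (fun c => scaleVar_C _ c) (scaleHom_smul _)]
  have hx : ∀ a b, sklyaninParam q a (b + M) = scaleHom ℂ (q ^ M)⁻¹ (sklyaninParam q a b) := by
    intro a b
    rw [sklyaninParam, sklyaninParam, sq X, map_mul, map_mul, scaleHom_apply, scaleHom_apply,
      scaleVar_C, scaleVar_X, inv_inv, mul_mul_mul_comm, ← map_mul,
      ← mul_assoc (PowerSeries.C (q ^ (2 * a + 2 * b))), ← map_mul]
    congr 2
    ring
  have hw : ∀ a b, sklyaninInv q a (b + M) = scaleHom ℂ (q ^ M)⁻¹ (sklyaninInv q a b) := by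
    intro a b
    have h1 := sklyaninInv_mul q a (b + M)
    have h2 := congrArg (scaleHom ℂ (q ^ M)⁻¹) (sklyaninInv_mul q a b)
    rw [map_mul, map_sub, map_one, ← hx] at h2
    linear_combination scaleHom ℂ (q ^ M)⁻¹ (sklyaninInv q a b) * h1 - sklyaninInv q a (b + M) * h2
  congr 1
  refine minor_congr_param (fun a b _ _ => hx a b) (fun a b _ _ => hw a b) (fun a _ => ?_) R C
  funext r c
  have h1 : schur (shifts q S (a + M)) (G.map (scaleHom A (q ^ (-2 * ((a + M : ℕ) : ℤ))))) r c =
      scaleHom A (q ^ (-2 * ((a + M : ℕ) : ℤ))) (schur S G r c) := map_schur (scaleHom A (q ^ (-2 * ((a + M : ℕ) : ℤ)))) S G r c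
  rw [h1, shifts, scaledSchur, Matrix.of_apply, scaleHom_apply, scaleHom_apply, scaleVar_scaleVar,
    scaleVar_scaleVar]
  congr 1
  rw [← zpow_natCast, ← zpow_neg, ← zpow_add₀ hq0, ← zpow_add₀ hq0]
  congr 1
  push_cast
  ring

/-- The factor by which `S̃(u)` differs from the Schur complement. -/
noncomputable def sdetFactor (q : ℂ) (S : Matrix (Fin (N + M)) (Fin (N + M)) A⟦X⟧) : A⟦X⟧ :=
  scaleVar (q ^ M) (sdet q (subJ S))

theorem strictMono_bordered (i : Fin N) : StrictMono (bordered M i) := by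
  intro a b hab
  obtain ⟨b, rfl⟩ := Fin.exists_succ_eq.2 (Fin.ne_zero_of_lt hab)
  induction a using Fin.cases with
  | zero => exact castAdd_lt_natAdd _ _
  | succ a => exact Fin.strictMono_natAdd N (Fin.succ_lt_succ_iff.1 hab)

theorem scaleVar_scaleVar_inv {c : ℂ} (hc : c ≠ 0) (f : A⟦X⟧) : scaleVar c (scaleVar c⁻¹ f) = f := by
  rw [scaleVar_scaleVar, mul_inv_cancel₀ hc, scaleVar_one]

theorem scaleVar_mul (c : ℂ) (f g : A⟦X⟧) : scaleVar c (f * g) = scaleVar c f * scaleVar c g :=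
  map_mul (scaleHom A c) f g

theorem tildeS_eq (hq0 : q ≠ 0) (hq : ∀ k : ℕ, 0 < k → q ^ k ≠ 1) (hM : 0 < M)
    {S : Matrix (Fin (N + M)) (Fin (N + M)) A⟦X⟧} (hS : SeriesReflects q S)
    {G : Matrix (Fin M) (Fin M) A⟦X⟧} (hG : subLast S * G = 1) (i j : Fin N) :
    tildeS q S i j = sdetFactor q S * scaledSchur q S G i j := by
  let s : ℕ → Fin M := fun n => if h : n < M then ⟨n, h⟩ else ⟨0, hM⟩
  have hs : ∀ a : Fin M, s a = a := fun a => dif_pos a.2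
  have hb : ∀ (i : Fin N) (a : Fin (M + 1)), append s 1 (fun _ => i) a = bordered M i a := by
    intro i a
    induction a using Fin.cases with
    | zero => exact append_of_lt one_pos _
    | succ a =>
      refine (append_of_le (Nat.le_add_left 1 a) _).trans ?_
      rw [bordered, Fin.cons_succ, Nat.add_sub_cancel, hs]
  rw [tildeS, sklyaninMinor_of_strictMono hq0 S (strictMono_bordered i) (hb i) (hb j),
    Nat.add_comm M 1, minor_append_shifts hq0 hq hS hG hs, minor_one, scaleVar_mul,
    scaleVar_scaleVar_inv (pow_ne_zero M hq0), shifts]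
  simp only [Nat.cast_zero, mul_zero, zpow_zero, scaleVar_one]
  rfl

theorem scaleVar_sdet (hq0 : q ≠ 0) (hq : ∀ k : ℕ, 0 < k → q ^ k ≠ 1) (hN : 0 < N) (hM : 0 < M)
    {S : Matrix (Fin (N + M)) (Fin (N + M)) A⟦X⟧} (hS : SeriesReflects q S)
    {G : Matrix (Fin M) (Fin M) A⟦X⟧} (hG : subLast S * G = 1) :
    scaleVar (q ^ M) (sdet q S) = sdetFactor q S * sdet q (scaledSchur q S G) := by
  let s : ℕ → Fin M := fun n => if h : n < M then ⟨n, h⟩ else ⟨0, hM⟩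
  have hs : ∀ a : Fin M, s a = a := fun a => dif_pos a.2
  let t : ℕ → Fin N := fun n => if h : n < N then ⟨n, h⟩ else ⟨0, hN⟩
  have ht : ∀ a : Fin N, t a = a := fun a => dif_pos a.2
  have hst : ∀ a : Fin (N + M), append s N t a = a := by
    intro a
    induction a using Fin.addCases with
    | left a =>
      refine (append_of_lt a.2 _).trans ?_
      exact congrArg _ (ht a)
    | right a =>
      refine (append_of_le (Nat.le_add_right N a) _).trans ?_
      rw [Nat.add_sub_cancel_left, hs]
  rw [sdet_eq hq0 S hst hst, minor_append_shifts hq0 hq hS hG hs, scaleVar_mul,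
    scaleVar_scaleVar_inv (pow_ne_zero M hq0), ← sdet_eq hq0 _ ht ht]
  rfl

end Sylvester
end TwistedYangian

namespace TwistedYangian

open Sum PowerSeries

/-! ### Reflection relations for submatrices and scalar multiples -/

section Restrict

variable {K E : Type*} [CommRing K] [Algebra ℂ K] [Ring E] [Algebra K E] {q : ℂ}

theorem rop_comp_strictMono {ι : Type*} [DecidableEq ι] {N N' : ℕ} {e : Fin N → Fin N'}
    (he : StrictMono e) (u v : K) (a b : ι) (g : (ι → Fin N') → E) :
    (rop q a b u v g) ∘ (e ∘ ·) = rop q a b u v (g ∘ (e ∘ ·)) :=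
  funext fun i => rop_comp (i := i) (Ψ := (e ∘ ·)) q u v he rfl rfl rfl g

theorem Reflects.comp {N N' : ℕ} {a b : Fin N' → Fin N' → E} {U V x : K}
    (h : Reflects q a b U V x) {e : Fin N → Fin N'} (he : StrictMono e) :
    Reflects q (fun r c => a (e r) (e c)) (fun r c => b (e r) (e c)) U V x := by
  intro i
  have h1 := h (e ∘ i)
  have h2 := fun (a b : Fin 2 ⊕ Fin 2) (g : (Fin 2 ⊕ Fin 2 → Fin N') → E) =>
    congrFun (rop_comp_strictMono (q := q) he U V a b g) i
  simp only [Function.comp_apply] at h2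
  rw [h2, h2, rop_comp_strictMono he, rop_comp_strictMono he] at h1
  exact h1

theorem rop_const_mul {ι L : Type*} [DecidableEq ι] [LinearOrder L] (u v : K) (a b : ι) (e : E)
    (g : (ι → L) → E) : rop q a b u v (fun i => e * g i) = fun i => e * rop q a b u v g i :=
  exchange_mul_left (f := fun _ => e) _ _ g (s := ∅) (fun _ _ _ => rfl) (Set.notMem_empty _)
    (Set.notMem_empty _)

/-- The product e f comes out of both sides on the left. This requires each factor to pass the other
matrix and e and f to commute. -/
theorem Reflects.const_mul {N : ℕ} {a b : Fin N → Fin N → E} {U V x : K} (h : Reflects q a b U V x)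
    {e f : E} (hef : Commute e f) (he : ∀ r c, Commute e (b r c)) (hf : ∀ r c, Commute f (a r c)) :
    Reflects q (fun r c => e * a r c) (fun r c => f * b r c) U V x := by
  have h1 : (pairLeft (fun r c => e * a r c) fun r c => f * b r c) =
      fun i => e * f * pairLeft a b i := by
    funext i
    simp only [pairLeft]
    rw [mul_assoc, ← mul_assoc (a _ _), ← (hf _ _).eq]
    noncomm_ring
  have h2 : (pairRight (fun r c => e * a r c) fun r c => f * b r c) =
      fun i => e * f * pairRight a b i := by
    funext i
    simp only [pairRight]
    rw [mul_assoc, ← mul_assoc (b _ _), ← (he _ _).eq, hef.eq]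
    noncomm_ring
  intro i
  simp only [h1, h2, rop_const_mul, h i]

end Restrict

/-! ### The factor d(u), the reflection relation for S̃(u), and Sylvester's identity -/

section Commutation

variable {A : Type*} [Ring A] [Algebra ℂ A] {q : ℂ} {N M : ℕ}

theorem SeriesReflects.submatrix {N' : ℕ} {S : Matrix (Fin N') (Fin N') A⟦X⟧}
    (hS : SeriesReflects q S) {e : Fin N → Fin N'} (he : StrictMono e) :
    SeriesReflects q (S.submatrix e e) :=
  Reflects.comp hS he

theorem commute_C_map_C {f g : A⟦X⟧} (h : ∀ m n, Commute (coeff m f) (coeff n g)) :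
    Commute (C f) (PowerSeries.map C g) := by
  rw [commute_iff_eq]
  ext n m
  simp only [coeff_mul_C, coeff_C_mul, coeff_map]
  exact (h m n).eq

theorem SeriesReflects.const_mul {S : Matrix (Fin N) (Fin N) A⟦X⟧} (hS : SeriesReflects q S)
    {d : A⟦X⟧} (hd : ∀ m n, Commute (coeff m d) (coeff n d))
    (h : ∀ r c m n, Commute (coeff m d) (coeff n (S r c))) :
    SeriesReflects q (Matrix.of fun r c => d * S r c) := by
  have h1 := Reflects.const_mul hS (commute_C_map_C hd) (fun r c => commute_C_map_C (h r c))
    (fun r c => (commute_C_map_C fun m n => (h r c n m).symm).symm)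
  simp only [← map_mul] at h1
  exact h1

theorem coeff_scaleVar (c : ℂ) (f : A⟦X⟧) (n : ℕ) :
    coeff n (scaleVar c f) = c⁻¹ ^ n • coeff n f := coeff_mk _ _

theorem commute_coeff_sdet (hq0 : q ≠ 0) (hN : 0 < N) {S : Matrix (Fin N) (Fin N) A⟦X⟧} {e : A}
    (h : ∀ r c n, Commute e (coeff n (S r c))) (n : ℕ) : Commute e (coeff n (sdet q S)) := by
  let t : ℕ → Fin N := fun n => if h : n < N then ⟨n, h⟩ else ⟨0, hN⟩
  have ht : ∀ a : Fin N, t a = a := fun a => dif_pos a.2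
  rw [sdet_eq hq0 S ht ht]
  refine (commute_C_iff.1 (commute_minor N (fun a r c => ?_) t t).symm n).symm
  refine (commute_C_iff.2 fun k => ?_).symm
  rw [shifts, coeff_scaleVar]
  exact (h r c k).symm.smul_left _

/-- The coefficients of the determinant commute with the entries, hence with the determinant formed
from those entries. -/
theorem commute_sdet_self (hq0 : q ≠ 0) (hq : ∀ k : ℕ, 0 < k → q ^ k ≠ 1) (hN : 0 < N)
    {S : Matrix (Fin N) (Fin N) A⟦X⟧} (hS : SeriesReflects q S) (m n : ℕ) :
    Commute (coeff m (sdet q S)) (coeff n (sdet q S)) := by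
  let t : ℕ → Fin N := fun n => if h : n < N then ⟨n, h⟩ else ⟨0, hN⟩
  have ht : ∀ a : Fin N, t a = a := fun a => dif_pos a.2
  refine commute_coeff_sdet hq0 hN (fun r c k => ?_) n
  rw [sdet_eq hq0 S ht ht]
  exact (commute_minor_entry hq0 hq hS ht t r c k m).symm

theorem sdet_const_mul (hq0 : q ≠ 0) (hN : 0 < N) (S : Matrix (Fin N) (Fin N) A⟦X⟧) {d : A⟦X⟧}
    (h : ∀ r c m n, Commute (coeff m d) (coeff n (S r c))) :
    sdet q (Matrix.of fun r c => d * S r c) =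
      ((List.range N).map fun a : ℕ => scaleVar (q ^ (-2 * (a : ℤ))) d).prod * sdet q S := by
  let t : ℕ → Fin N := fun n => if h : n < N then ⟨n, h⟩ else ⟨0, hN⟩
  have ht : ∀ a : Fin N, t a = a := fun a => dif_pos a.2
  rw [sdet_eq hq0 S ht ht, sdet_eq hq0 _ ht ht, ← minor_mul]
  · congr 1
    funext a r c
    exact scaleVar_mul _ _ _
  · intro n a r c
    refine commute_of_coeff fun k l => ?_
    rw [shifts, coeff_scaleVar, coeff_scaleVar]
    exact ((h r c k l).smul_left _).smul_right _

variable {S T : Matrix (Fin (N + M)) (Fin (N + M)) A⟦X⟧} {G : Matrix (Fin M) (Fin M) A⟦X⟧}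

theorem SeriesReflects.subJ (hS : SeriesReflects q S) : SeriesReflects q (subJ S) :=
  hS.submatrix (Fin.strictMono_natAdd N)

theorem commute_sdetFactor_self (hq0 : q ≠ 0) (hq : ∀ k : ℕ, 0 < k → q ^ k ≠ 1) (hM : 0 < M)
    (hS : SeriesReflects q S) (m n : ℕ) :
    Commute (coeff m (sdetFactor q S)) (coeff n (sdetFactor q S)) := by
  rw [sdetFactor, coeff_scaleVar, coeff_scaleVar]
  exact ((commute_sdet_self hq0 hq hM hS.subJ m n).smul_left _).smul_right _

theorem commute_sdetFactor_scaledSchur (hq0 : q ≠ 0) (hM : 0 < M) (hS : SeriesReflects q S)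
    (hST : S * T = 1) (hTS : T * S = 1) (hG : subLast S * G = 1) (hG' : G * subLast S = 1)
    (r c : Fin N) (m n : ℕ) :
    Commute (coeff m (sdetFactor q S)) (coeff n (scaledSchur q S G r c)) := by
  rw [sdetFactor, scaledSchur, Matrix.of_apply, coeff_scaleVar, coeff_scaleVar]
  refine ((commute_coeff_sdet hq0 hM (fun a b k => ?_) m).symm.smul_left _).smul_right _
  exact commute_schur hS hST hTS hG hG' r c a b n k

theorem tildeS_eq_of (hq0 : q ≠ 0) (hq : ∀ k : ℕ, 0 < k → q ^ k ≠ 1) (hM : 0 < M)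
    (hS : SeriesReflects q S) (hG : subLast S * G = 1) :
    tildeS q S = Matrix.of fun i j => sdetFactor q S * scaledSchur q S G i j := by
  ext1 i j
  exact tildeS_eq hq0 hq hM hS hG i j

theorem seriesReflects_tildeS (hq0 : q ≠ 0) (hq : ∀ k : ℕ, 0 < k → q ^ k ≠ 1) (hM : 0 < M)
    (hS : SeriesReflects q S) (hST : S * T = 1) (hTS : T * S = 1) (hG : subLast S * G = 1)
    (hG' : G * subLast S = 1) (c : ℂ) : SeriesReflects q (c • tildeS q S) := by
  have h1 : c • tildeS q S =
      Matrix.of fun i j => (c • sdetFactor q S) * scaledSchur q S G i j := by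
    rw [tildeS_eq_of hq0 hq hM hS hG]
    ext1 i j
    rw [Matrix.smul_apply, Matrix.of_apply, Matrix.of_apply, smul_mul_assoc]
  have h2 : ∀ n, coeff n (c • sdetFactor q S) = c • coeff n (sdetFactor q S) := fun n => rfl
  rw [h1]
  refine SeriesReflects.const_mul (seriesReflects_schur hq0 hS hST hTS hG hG') (fun m n => ?_)
    fun i j m n => ?_
  · rw [h2, h2]
    exact ((commute_sdetFactor_self hq0 hq hM hS m n).smul_left _).smul_right _
  · rw [h2]
    exact (commute_sdetFactor_scaledSchur hq0 hM hS hST hTS hG hG' i j m n).smul_left _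

/-- Sylvester's identity for the Sklyanin determinant. -/
theorem sdet_tildeS (hq0 : q ≠ 0) (hq : ∀ k : ℕ, 0 < k → q ^ k ≠ 1) (hN : 0 < N) (hM : 0 < M)
    (hS : SeriesReflects q S) (hST : S * T = 1) (hTS : T * S = 1) (hG : subLast S * G = 1)
    (hG' : G * subLast S = 1) : sdet q (tildeS q S) = sylvesterProduct q S := by
  obtain ⟨n, rfl⟩ : ∃ n, N = n + 1 := ⟨N - 1, by omega⟩
  -- The factor d(q^{-2a}u) with a = 0 is split off from the product, to be joined with sdet S°(u)
  -- into sdet S(q^M u).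
  rw [tildeS_eq_of hq0 hq hM hS hG, sdet_const_mul hq0 hN _
    (commute_sdetFactor_scaledSchur hq0 hM hS hST hTS hG hG'), List.prod_range_succ',
    sylvesterProduct, scaleVar_sdet hq0 hq hN hM hS hG, Nat.add_sub_cancel]
  have h1 : ∀ k : ℕ, scaleVar (q ^ (-2 * ((k + 1 : ℕ) : ℤ))) (sdetFactor q S) =
      scaleVar (q ^ ((M : ℤ) - 2 * ((k : ℤ) + 1))) (sdet q (subJ S)) := by
    intro k
    rw [sdetFactor, scaleVar_scaleVar, ← zpow_natCast, ← zpow_add₀ hq0]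
    congr 2
  -- The index of `sylvesterProduct` is an integer, obtained by casting the range, and has to be
  -- brought back to natural numbers.
  have h2 : (List.range n).map (fun k : ℕ => scaleVar (q ^ ((M : ℤ) - 2 * ((k : ℤ) + 1)))
      (sdet q (subJ S))) = (do let a ← List.range n; pure (a : ℤ)).map fun k : ℤ =>
        scaleVar (q ^ ((M : ℤ) - 2 * (k + 1))) (sdet q (subJ S)) := by
    simp [← List.map_eq_flatMap]
  simp only [h1, Nat.succ_eq_add_one, Nat.cast_zero, mul_zero, zpow_zero, scaleVar_one]
  rw [← mul_assoc, ← h2]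
  congr 1
  refine (Commute.list_prod_right _ _ fun z hz => ?_).eq
  obtain ⟨k, -, rfl⟩ := List.mem_map.1 hz
  rw [← h1]
  refine commute_of_coeff fun i j => ?_
  rw [coeff_scaleVar]
  exact (commute_sdetFactor_self hq0 hq hM hS i j).smul_right _

end Commutation
end TwistedYangian

namespace TwistedYangian

open Sum PowerSeries

/-! ### Inverses of block triangular matrices -/

section Triangular

variable {R : Type*} [Ring R] {N M : ℕ}

/-- Invertibility of a block lower triangular matrix. -/
theorem exists_inverse_of_blocks {S : Matrix (Fin (N + M)) (Fin (N + M)) R}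
    (h0 : ∀ i j, S (Fin.castAdd M i) (Fin.natAdd N j) = 0)
    (h1 : ∃ T, subI S * T = 1 ∧ T * subI S = 1) (h2 : ∃ T, subLast S * T = 1 ∧ T * subLast S = 1) :
    ∃ T, S * T = 1 ∧ T * S = 1 := by
  obtain ⟨A, hA, hA'⟩ := h1
  obtain ⟨D, hD, hD'⟩ := h2
  let L : Matrix (Fin M) (Fin N) R := S.submatrix (Fin.natAdd N) (Fin.castAdd M)
  have hS : S = (Matrix.fromBlocks (subI S) 0 L (subLast S)).submatrix finSumFinEquiv.symm
      finSumFinEquiv.symm := by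
    ext i j
    induction i using Fin.addCases <;> induction j using Fin.addCases <;>
      simp [subI, subLast, L, h0]
  refine ⟨(Matrix.fromBlocks A 0 (-(D * L * A)) D).submatrix finSumFinEquiv.symm
    finSumFinEquiv.symm, ?_, ?_⟩
  · conv_lhs => rw [hS]
    rw [Matrix.submatrix_mul_equiv, Matrix.fromBlocks_multiply, hA, hD,
      Matrix.mul_neg (subLast S), Matrix.mul_assoc D, ← Matrix.mul_assoc (subLast S), hD]
    simp
  · conv_lhs => rw [hS]
    rw [Matrix.submatrix_mul_equiv, Matrix.fromBlocks_multiply, hA', hD', Matrix.neg_mul,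
      Matrix.mul_assoc, hA']
    simp

end Triangular

/-! ### Leading terms of the reflection relation and of the 2 × 2 determinant -/

section LeadingTerm

variable {A : Type*} [Ring A] [Algebra ℂ A] {q : ℂ} {N M : ℕ}

theorem Reflects.of_mul_param {K E : Type*} [CommRing K] [Algebra ℂ K] [Ring E] [Algebra K E]
    {a b : Fin N → Fin N → E} {t U V x : K} (ht : Function.Injective fun e : E => t • e)
    (h : Reflects q a b (t * U) (t * V) x) : Reflects q a b U V x := by
  intro i
  have h1 := h i
  rw [rop_mul_param, rop_mul_param] at h1
  exact ht h1

/-- The leading term of the reflection relation. -/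
theorem SeriesReflects.coeff_zero {S : Matrix (Fin N) (Fin N) A⟦X⟧} (hS : SeriesReflects q S) :
    Reflects (K := ℂ) q (fun i j => coeff 0 (S i j)) (fun i j => coeff 0 (S i j)) 1 0 0 := by
  -- Setting u⁻¹ = 0 leaves R with arguments v⁻¹ and 0. The common factor v⁻¹ has to be cancelled
  -- before setting v⁻¹ = 0.
  have h1 := Reflects.map hS (PowerSeries.map (constantCoeff (R := ℂ)))
    (PowerSeries.map (constantCoeff (R := A))) (fun c => ?_) fun k e => ?_
  · have h2 : ∀ i j, PowerSeries.map (constantCoeff (R := A)) (PowerSeries.map C (S i j)) = S i j := by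
      intro i j
      ext n
      simp
    simp only [h2, map_C, PowerSeries.map_X, constantCoeff_X, map_mul, map_zero, zero_mul] at h1
    have h3 : Reflects (K := ℂ⟦X⟧) q (fun i j => C (constantCoeff (S i j))) S (X * 1) (X * 0) 0 := by
      rw [mul_one, mul_zero]
      exact h1
    have h4 := Reflects.of_mul_param (fun f g hfg => ?_) h3
    · have h5 := Reflects.map h4 (constantCoeff (R := ℂ)) (constantCoeff (R := A))
        (fun c => constantCoeff_C c) fun k e => ?_
      · simpa using h5
      · rw [Algebra.smul_def, Algebra.smul_def, map_mul]
        congr 1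
    · rw [← sub_eq_zero]
      refine smul_series_eq_zero X _ X_ne_zero ?_
      rw [smul_sub]
      exact sub_eq_zero.2 hfg
  · rw [algebraMap_series, map_C, constantCoeff_C]
    rfl
  · rw [Algebra.smul_def, Algebra.smul_def, map_mul]
    congr 1

section Pair

variable {s : Fin N → Fin N → A} {i j : Fin N}

theorem Reflects.upper_mul_diag (hq : q ≠ 0) (h : Reflects (K := ℂ) q s s 1 0 0) (hij : i < j) :
    s i j * s i i = q ^ 2 • (s i i * s i j) := by
  have h1 := h (Sum.elim ![i, i] ![i, j])
  simp only [rop_apply, diagCoeff, swapCoeff, pairLeft, pairRight] at h1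
  simp [Equiv.swap_apply_def, hij, hij.ne'] at h1
  rw [smul_smul, smul_smul, sub_mul, inv_mul_cancel₀ hq] at h1
  rw [← sub_eq_zero] at h1 ⊢
  exact Eq.trans (by module) h1

/-- The diagonal entry at i ⊗ j of the leading relation. It converts the leading term of the 2 × 2
determinant into the expression of the symplectic relation. -/
theorem Reflects.diag_mul_diag (h : Reflects (K := ℂ) q s s 1 0 0) (hij : i < j) :
    s i i * s j j - (q⁻¹ - q) • (s i j * s i j) = 
      s j j * s i i + (q * (q⁻¹ - q)) • (s j i * s i j) := by
  have h1 := h (Sum.elim ![i, j] ![i, j])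
  simp only [rop_apply, diagCoeff, swapCoeff, pairLeft, pairRight] at h1
  simp [Equiv.swap_apply_def, hij, hij.ne, hij.ne', hij.not_gt] at h1
  rw [← sub_eq_zero] at h1 ⊢
  exact neg_eq_zero.1 (Eq.trans (by module) h1)

end Pair

theorem constantCoeff_sdet_two (hq : q ≠ 0) (S : Matrix (Fin 2) (Fin 2) A⟦X⟧) :
    coeff 0 (sdet q S) = coeff 0 (S 0 0) * coeff 0 (S 1 1) -
      (q⁻¹ - q) • (coeff 0 (S 0 1) * coeff 0 (S 0 1)) - coeff 0 (S 1 0) * coeff 0 (S 0 1) := by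
  let t : ℕ → Fin 2 := fun n => if n = 0 then 0 else 1
  have ht : ∀ a : Fin 2, t a = a := fun a => by fin_cases a <;> rfl
  rw [sdet_eq hq S ht ht, coeff_zero_eq_constantCoeff_apply,
    minor_map (constantCoeff (R := ℂ)) (constantCoeff (R := A)) (fun c => constantCoeff_C c)]
  · have hw : ∀ a b, constantCoeff (sklyaninInv q a b) = -1 := by
      intro a b
      have := congrArg constantCoeff (sklyaninInv_mul q a b)
      rw [map_mul, map_sub, sklyaninParam] at this
      simp at this
      linear_combination -this
    rw [minor_succ, expansion, Finset.sum_range_succ, Finset.sum_range_one]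
    have h1 : (Finset.range 2).filter (fun a => t 0 < t a) = {1} := rfl
    have h2 : (Finset.range 2).filter (fun a => t 1 < t a) = ∅ := rfl
    have h3 : ∀ a r c, constantCoeff (shifts q S a r c) = constantCoeff (S r c) := by
      intro a r c
      rw [← coeff_zero_eq_constantCoeff_apply, shifts, coeff_scaleVar, pow_zero, one_smul,
        coeff_zero_eq_constantCoeff_apply]
    simp only [colTrans, minor_one, hw, sklyaninParam, map_mul, map_pow, constantCoeff_X,
      expandCoeff, h1, h2, h3, LinearMap.coe_comp, Function.comp_apply, LinearMap.smul_apply,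
      Pi.smul_apply, LinearMap.id_apply]
    simp only [rop_apply]
    simp [t, diagCoeff, swapCoeff, removeAt, withAux]
    rw [smul_smul, inv_mul_cancel₀ hq, one_smul]
    abel
  · intro k e
    rw [Algebra.smul_def, Algebra.smul_def, map_mul]
    congr 1

end LeadingTerm
end TwistedYangian

namespace TwistedYangian

open Sum PowerSeries

/-! ### The defining relations for κ_M⁻¹ S̃(u) -/

section Relations

variable {A : Type*} [Ring A] [Algebra ℂ A] {q : ℂ} {N M : ℕ}

/-- The defining relations of `Y_q^tw(o_N)` for a matrix of series. -/
structure SatisfiesO (q : ℂ) (S : Matrix (Fin N) (Fin N) A⟦X⟧) : Prop where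
  reflects : SeriesReflects q S
  upper : ∀ i j, i < j → coeff 0 (S i j) = 0
  diag : ∀ i, coeff 0 (S i i) = 1

/-- The defining relations of `Y_q^tw(sp_N)` for a matrix of series. -/
structure SatisfiesSp (q : ℂ) (S : Matrix (Fin N) (Fin N) A⟦X⟧) : Prop where
  reflects : SeriesReflects q S
  upper : ∀ i j, i < j → ¬ IsPair i j → coeff 0 (S i j) = 0
  det : ∀ i j, IsPair i j → coeff 0 (S j j) * coeff 0 (S i i) -
    q ^ 2 • (coeff 0 (S j i) * coeff 0 (S i j)) = algebraMap ℂ A (q ^ 3)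
  isUnit : ∀ i j, IsPair i j → IsUnit (coeff 0 (S i j))

theorem isPair_castAdd {i j : Fin N} : IsPair (Fin.castAdd M i) (Fin.castAdd M j) ↔ IsPair i j :=
  Iff.rfl

theorem isPair_natAdd (hN : Even N) {i j : Fin M} :
    IsPair (Fin.natAdd N i) (Fin.natAdd N j) ↔ IsPair i j := by
  simp only [IsPair, Fin.val_natAdd, Nat.even_add, hN, true_iff]
  refine and_congr_right fun _ => ?_
  omega

theorem not_isPair_castAdd_natAdd (hN : Even N) (i : Fin N) (j : Fin M) :
    ¬ IsPair (Fin.castAdd M i) (Fin.natAdd N j) := by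
  rintro ⟨⟨k, hk⟩, h⟩
  obtain ⟨l, rfl⟩ := hN
  rw [Fin.val_castAdd] at h hk
  rw [Fin.val_natAdd] at h
  have := i.2
  omega

theorem SatisfiesO.submatrix {N' : ℕ} {S : Matrix (Fin N') (Fin N') A⟦X⟧} (hS : SatisfiesO q S)
    {e : Fin N → Fin N'} (he : StrictMono e) : SatisfiesO q (S.submatrix e e) :=
  ⟨hS.reflects.submatrix he, fun i j h => hS.upper _ _ (he h), fun _ => hS.diag _⟩

theorem SatisfiesSp.submatrix {N' : ℕ} {S : Matrix (Fin N') (Fin N') A⟦X⟧} (hS : SatisfiesSp q S)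
    {e : Fin N → Fin N'} (he : StrictMono e) (he' : ∀ i j, IsPair (e i) (e j) ↔ IsPair i j) :
    SatisfiesSp q (S.submatrix e e) :=
  ⟨hS.reflects.submatrix he, fun i j h h' => hS.upper _ _ (he h) ((he' i j).not.2 h'),
    fun i j h => hS.det _ _ ((he' i j).2 h), fun i j h => hS.isUnit _ _ ((he' i j).2 h)⟩

variable {S : Matrix (Fin (N + M)) (Fin (N + M)) A⟦X⟧}

theorem SatisfiesO.upper_block (hS : SatisfiesO q S) (i : Fin N) (j : Fin M) :
    coeff 0 (S (Fin.castAdd M i) (Fin.natAdd N j)) = 0 :=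
  hS.upper _ _ (castAdd_lt_natAdd i j)

theorem SatisfiesSp.upper_block (hN : Even N) (hS : SatisfiesSp q S) (i : Fin N) (j : Fin M) :
    coeff 0 (S (Fin.castAdd M i) (Fin.natAdd N j)) = 0 :=
  hS.upper _ _ (castAdd_lt_natAdd i j) (not_isPair_castAdd_natAdd hN i j)

theorem SatisfiesO.subI (hS : SatisfiesO q S) : SatisfiesO q (subI S) :=
  hS.submatrix (Fin.strictMono_castAdd M)

theorem SatisfiesO.subLast (hS : SatisfiesO q S) : SatisfiesO q (subLast S) :=
  hS.submatrix (Fin.strictMono_natAdd N)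

theorem SatisfiesSp.subI (hS : SatisfiesSp q S) : SatisfiesSp q (subI S) :=
  hS.submatrix (Fin.strictMono_castAdd M) fun _ _ => isPair_castAdd

theorem SatisfiesSp.subLast (hN : Even N) (hS : SatisfiesSp q S) : SatisfiesSp q (subLast S) :=
  hS.submatrix (Fin.strictMono_natAdd N) fun _ _ => isPair_natAdd hN

/-- By `h1` and `h2` the entry s₁₀ equals −qβ + s₁₁βs₀₀ with β the inverse of s₀₁. Then s is a
product of a matrix with zero corner and a unipotent lower triangular one, both explicitly
invertible. -/
theorem exists_inverse_two {R : Type*} [Ring R] [Algebra ℂ R] (hq : q ≠ 0)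
    (s : Matrix (Fin 2) (Fin 2) R) (h1 : s 0 1 * s 0 0 = q ^ 2 • (s 0 0 * s 0 1))
    (h2 : s 1 1 * s 0 0 - q ^ 2 • (s 1 0 * s 0 1) = algebraMap ℂ R (q ^ 3)) (h3 : IsUnit (s 0 1)) :
    ∃ T, s * T = 1 ∧ T * s = 1 := by
  obtain ⟨⟨b, β, hb, hb'⟩, hs⟩ := h3
  rw [Units.val_mk] at hs
  subst hs
  have hβ : β * s 0 0 = (q ^ 2)⁻¹ • (s 0 0 * β) := by
    have h4 := congrArg (fun z => (q ^ 2)⁻¹ • (β * z * β)) h1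
    simp only [mul_smul_comm, smul_mul_assoc, ← mul_assoc, hb', one_mul] at h4
    rw [mul_assoc _ _ β, hb, mul_one, smul_smul, inv_mul_cancel₀ (pow_ne_zero 2 hq), one_smul] at h4
    exact h4.symm
  have hc : s 1 0 = -(q • β) + s 1 1 * (β * s 0 0) := by
    rw [hβ, mul_smul_comm, ← mul_assoc, sub_eq_iff_eq_add.1 h2, add_mul, smul_mul_assoc, mul_assoc,
      hb, mul_one, smul_add, smul_smul, inv_mul_cancel₀ (pow_ne_zero 2 hq), one_smul,
      ← Algebra.smul_def, smul_smul, show (q ^ 2)⁻¹ * q ^ 3 = q by field_simp]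
    abel
  have hS : s = !![0, s 0 1; -(q • β), s 1 1] * !![1, 0; β * s 0 0, 1] := by
    ext i j
    fin_cases i <;> fin_cases j <;> simp [Matrix.mul_apply, hc, ← mul_assoc, hb]
  have hqq : ∀ x : R, q⁻¹ • q • x = x := fun x => by rw [smul_smul, inv_mul_cancel₀ hq, one_smul]
  have hU : !![0, s 0 1; -(q • β), s 1 1] * !![q⁻¹ • (s 0 1 * s 1 1 * β), -(q⁻¹ • s 0 1); β, 0] =
      1 := by
    simp [Matrix.one_fin_two, hb, hb', hqq, ← mul_assoc, smul_comm q]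
  have hU' : !![q⁻¹ • (s 0 1 * s 1 1 * β), -(q⁻¹ • s 0 1); β, 0] * !![0, s 0 1; -(q • β), s 1 1] =
      1 := by
    simp [Matrix.one_fin_two, hb, hb', hqq, mul_assoc]
  have hV : ∀ x : R, !![1, 0; x, 1] * !![1, 0; -x, 1] = 1 := fun x => by
    simp [Matrix.one_fin_two]
  rw [hS]
  refine ⟨!![1, 0; -(β * s 0 0), 1] * !![q⁻¹ • (s 0 1 * s 1 1 * β), -(q⁻¹ • s 0 1); β, 0], ?_, ?_⟩
  · rw [mul_assoc, ← mul_assoc _ _ !![q⁻¹ • _, _; _, _], hV, one_mul, hU]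
  · rw [mul_assoc, ← mul_assoc _ _ !![1, 0; _, _], hU', one_mul]
    simpa using hV (-(β * s 0 0))

theorem SatisfiesO.exists_inverse_zero {S : Matrix (Fin N) (Fin N) A⟦X⟧} (hS : SatisfiesO q S) :
    ∃ T, S.map (coeff 0) * T = 1 ∧ T * S.map (coeff 0) = 1 := by
  induction N with
  | zero => exact ⟨0, Subsingleton.elim _ _, Subsingleton.elim _ _⟩
  | succ N ih =>
    refine exists_inverse_of_blocks (hS.upper_block (N := N) (M := 1)) (ih hS.subI) ⟨1, ?_⟩
    have : TwistedYangian.subLast (N := N) (M := 1) (S.map (coeff 0)) = 1 := by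
      ext i j
      rw [Subsingleton.elim j i, Matrix.one_apply_eq]
      exact hS.diag _
    rw [this, mul_one]
    exact ⟨rfl, rfl⟩

/-- Splitting off the last pair of indices leaves a block lower triangular matrix with a 2 × 2
diagonal block, as pairs (i, i′) never straddle an even position. -/
theorem SatisfiesSp.exists_inverse_zero (hq : q ≠ 0) {S : Matrix (Fin N) (Fin N) A⟦X⟧} (hN : Even N)
    (hS : SatisfiesSp q S) : ∃ T, S.map (coeff 0) * T = 1 ∧ T * S.map (coeff 0) = 1 := by
  obtain ⟨n, rfl⟩ := hN.two_dvd
  induction n with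
  | zero => exact ⟨0, Matrix.ext fun i => Fin.elim0 i, Matrix.ext fun i => Fin.elim0 i⟩
  | succ n ih =>
    refine exists_inverse_of_blocks (hS.upper_block (N := 2 * n) (M := 2) (even_two_mul n))
      (ih (even_two_mul n) hS.subI) ?_
    have hS' : SatisfiesSp q (TwistedYangian.subLast (N := 2 * n) (M := 2) S) :=
      hS.subLast (even_two_mul n)
    have hp : IsPair (0 : Fin 2) 1 := ⟨Even.zero, rfl⟩
    exact exists_inverse_two hq _ (hS'.reflects.coeff_zero.upper_mul_diag hq one_pos)
      (hS'.det 0 1 hp) (hS'.isUnit 0 1 hp)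

theorem SatisfiesO.exists_inverse {S : Matrix (Fin N) (Fin N) A⟦X⟧} (hS : SatisfiesO q S) :
    ∃ T, S * T = 1 ∧ T * S = 1 :=
  let ⟨T, h, h'⟩ := hS.exists_inverse_zero
  exists_matrix_inverse S T h h'

theorem SatisfiesSp.exists_inverse (hq : q ≠ 0) {S : Matrix (Fin N) (Fin N) A⟦X⟧} (hN : Even N)
    (hS : SatisfiesSp q S) : ∃ T, S * T = 1 ∧ T * S = 1 :=
  let ⟨T, h, h'⟩ := hS.exists_inverse_zero hq hN
  exists_matrix_inverse S T h h'

theorem coeff_zero_mul (f g : A⟦X⟧) : coeff 0 (f * g) = coeff 0 f * coeff 0 g :=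
  by simp only [coeff_zero_eq_constantCoeff_apply, map_mul]

theorem coeff_zero_scaleVar (c : ℂ) (f : A⟦X⟧) : coeff 0 (scaleVar c f) = coeff 0 f := by
  rw [coeff_scaleVar, pow_zero, one_smul]

variable {G : Matrix (Fin M) (Fin M) A⟦X⟧}

/-- The correction in the Schur complement contains the factor S_IJ, which has no constant term. -/
theorem coeff_zero_scaledSchur
    (h0 : ∀ (i : Fin N) (j : Fin M), coeff 0 (S (Fin.castAdd M i) (Fin.natAdd N j)) = 0) (i j : Fin N) :
    coeff 0 (scaledSchur q S G i j) = coeff 0 (S (Fin.castAdd M i) (Fin.castAdd M j)) := by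
  rw [scaledSchur, Matrix.of_apply, coeff_zero_scaleVar]
  simp only [schur]
  rw [map_sub, map_sum, sub_eq_self]
  refine Finset.sum_eq_zero fun a _ => ?_
  rw [map_sum]
  refine Finset.sum_eq_zero fun b _ => ?_
  rw [coeff_zero_mul, coeff_zero_mul, h0, zero_mul, zero_mul]

theorem coeff_zero_sdet (hq0 : q ≠ 0) (hq : ∀ k : ℕ, 0 < k → q ^ k ≠ 1) (hN : 0 < N) (hM : 0 < M)
    (hS : SeriesReflects q S) (hG : TwistedYangian.subLast S * G = 1) :
    coeff 0 (sdet q S) = coeff 0 (sdet q (subJ S)) * coeff 0 (sdet q (scaledSchur q S G)) := by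
  have h := congrArg (coeff 0) (scaleVar_sdet hq0 hq hN hM hS hG)
  rw [coeff_zero_mul, sdetFactor, coeff_zero_scaleVar, coeff_zero_scaleVar] at h
  exact h

theorem sdet_one (hq : q ≠ 0) (S : Matrix (Fin 1) (Fin 1) A⟦X⟧) : sdet q S = S 0 0 := by
  have ht : ∀ a : Fin 1, (0 : Fin 1) = a := fun a => Subsingleton.elim _ _
  rw [sdet_eq hq S (R := fun _ => 0) (C := fun _ => 0) ht ht, minor_one, shifts]
  simp [scaleVar_one]

theorem SatisfiesO.coeff_zero_sdet (hq0 : q ≠ 0) (hq : ∀ k : ℕ, 0 < k → q ^ k ≠ 1)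
    {S : Matrix (Fin N) (Fin N) A⟦X⟧} (hS : SatisfiesO q S) (hN : 0 < N) :
    coeff 0 (sdet q S) = 1 := by
  induction N using Nat.strong_induction_on with
  | _ N ih =>
    obtain ⟨M, rfl⟩ : ∃ M, N = 1 + M := ⟨N - 1, by omega⟩
    rcases M.eq_zero_or_pos with rfl | hM
    · rw [sdet_one hq0]
      exact hS.diag _
    · obtain ⟨G, hG, -⟩ := hS.subLast.exists_inverse
      rw [TwistedYangian.coeff_zero_sdet hq0 hq one_pos hM hS.reflects hG, sdet_one hq0,
        coeff_zero_scaledSchur hS.upper_block, hS.diag, mul_one]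
      exact ih M (by omega) hS.subLast hM

/-- By the leading exchange relation the constant term equals s_jj s_ii − q² s_ji s_ij, which is q³
by definition. -/
theorem coeff_zero_sdet_pair (hq0 : q ≠ 0) {S : Matrix (Fin N) (Fin N) A⟦X⟧} (hS : SatisfiesSp q S)
    {i j : Fin N} (hij : IsPair i j) {T : Matrix (Fin 2) (Fin 2) A⟦X⟧}
    (h : ∀ a b, coeff 0 (T a b) = coeff 0 (S (![i, j] a) (![i, j] b))) :
    coeff 0 (sdet q T) = algebraMap ℂ A (q ^ 3) := by
  have h1 := hS.reflects.coeff_zero.diag_mul_diag (i := i) (j := j) (by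
    rw [Fin.lt_def, hij.2]
    omega)
  rw [constantCoeff_sdet_two hq0, h, h, h, h]
  simp only [Matrix.cons_val_zero, Matrix.cons_val_one]
  rw [h1, ← hS.det i j hij, mul_sub, mul_inv_cancel₀ hq0]
  module

/-- Leading terms multiply along the factorization into a 2 × 2 Schur complement and the rest, and
each pair contributes q³. This is the origin of κ_M. -/
theorem SatisfiesSp.coeff_zero_sdet (hq0 : q ≠ 0) (hq : ∀ k : ℕ, 0 < k → q ^ k ≠ 1)
    {S : Matrix (Fin N) (Fin N) A⟦X⟧} (hS : SatisfiesSp q S) (hN : 0 < N) (hN' : Even N) :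
    coeff 0 (sdet q S) = algebraMap ℂ A (q ^ (3 * (N / 2))) := by
  induction N using Nat.strong_induction_on with
  | _ N ih =>
    obtain ⟨M, rfl⟩ : ∃ M, N = 2 + M := ⟨N - 2, by obtain ⟨k, rfl⟩ := hN'; omega⟩
    have hM' : Even M := (Nat.even_add.1 hN').1 even_two
    have hp : IsPair (Fin.castAdd M (0 : Fin 2)) (Fin.castAdd M 1) := ⟨Even.zero, rfl⟩
    rcases M.eq_zero_or_pos with rfl | hM
    · refine coeff_zero_sdet_pair hq0 hS hp fun a b => ?_
      fin_cases a <;> fin_cases b <;> rfl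
    · obtain ⟨G, hG, -⟩ := (hS.subLast even_two).exists_inverse hq0 hM'
      rw [TwistedYangian.coeff_zero_sdet hq0 hq two_pos hM hS.reflects hG,
        coeff_zero_sdet_pair hq0 hS hp (T := scaledSchur q S G)]
      · rw [show sdet q (subJ S) = sdet q (TwistedYangian.subLast S) from rfl,
          ih M (by omega) (hS.subLast even_two) hM hM', ← map_mul, ← pow_add]
        congr 2
        omega
      · intro a b
        rw [coeff_zero_scaledSchur (hS.upper_block even_two)]
        fin_cases a <;> fin_cases b <;> rfl

theorem coeff_zero_smul_tildeS (hq0 : q ≠ 0) (hq : ∀ k : ℕ, 0 < k → q ^ k ≠ 1) (hM : 0 < M)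
    (hS : SeriesReflects q S) (hG : TwistedYangian.subLast S * G = 1)
    (h0 : ∀ (i : Fin N) (j : Fin M), coeff 0 (S (Fin.castAdd M i) (Fin.natAdd N j)) = 0) {κ : ℂ}
    (hκ : κ ≠ 0) (h : coeff 0 (sdet q (subJ S)) = algebraMap ℂ A κ) (i j : Fin N) :
    coeff 0 ((κ⁻¹ • tildeS q S) i j) = coeff 0 (S (Fin.castAdd M i) (Fin.castAdd M j)) := by
  have h1 : coeff 0 ((κ⁻¹ • tildeS q S) i j) = κ⁻¹ • coeff 0 (tildeS q S i j) := rfl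
  rw [h1, tildeS_eq hq0 hq hM hS hG, coeff_zero_mul, coeff_zero_scaledSchur h0, sdetFactor,
    coeff_zero_scaleVar, h, ← Algebra.smul_def, smul_smul, inv_mul_cancel₀ hκ, one_smul]

theorem SatisfiesO.tildeS (hq0 : q ≠ 0) (hq : ∀ k : ℕ, 0 < k → q ^ k ≠ 1) (hM : 0 < M)
    (hS : SatisfiesO q S) : SatisfiesO q (tildeS q S) := by
  obtain ⟨T, hST, hTS⟩ := hS.exists_inverse
  obtain ⟨G, hG, hG'⟩ := hS.subLast.exists_inverse
  have h1 := seriesReflects_tildeS hq0 hq hM hS.reflects hST hTS hG hG' 1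
  have h2 := coeff_zero_smul_tildeS hq0 hq hM hS.reflects hG hS.upper_block one_ne_zero
    ((hS.subLast.coeff_zero_sdet hq0 hq hM).trans (map_one _).symm)
  rw [one_smul] at h1
  rw [inv_one, one_smul] at h2
  exact ⟨h1, fun i j h => (h2 i j).trans (hS.upper _ _ h), fun i => (h2 i i).trans (hS.diag _)⟩

theorem SatisfiesSp.smul_tildeS (hq0 : q ≠ 0) (hq : ∀ k : ℕ, 0 < k → q ^ k ≠ 1) (hM : 0 < M)
    (hN' : Even N) (hM' : Even M) (hS : SatisfiesSp q S) :
    SatisfiesSp q ((q ^ (3 * (M / 2)))⁻¹ • TwistedYangian.tildeS q S) := by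
  obtain ⟨T, hST, hTS⟩ := hS.exists_inverse hq0 (hN'.add hM')
  obtain ⟨G, hG, hG'⟩ := (hS.subLast hN').exists_inverse hq0 hM'
  have h2 := coeff_zero_smul_tildeS hq0 hq hM hS.reflects hG (hS.upper_block hN')
    (pow_ne_zero _ hq0) ((hS.subLast hN').coeff_zero_sdet hq0 hq hM hM')
  refine ⟨seriesReflects_tildeS hq0 hq hM hS.reflects hST hTS hG hG' _, fun i j h h' => ?_,
    fun i j h => ?_, fun i j h => ?_⟩
  · rw [h2]
    exact hS.upper _ _ h h'
  · rw [h2, h2, h2, h2]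
    exact hS.det _ _ h
  · rw [h2]
    exact hS.isUnit _ _ h

end Relations
end TwistedYangian

namespace TwistedYangian

open Sum PowerSeries

/-! ### Universal properties of the twisted q-Yangians -/

section Universal

variable {B : Type*} [Ring B] [Algebra ℂ B] {q : ℂ} {N M : ℕ}

theorem coeff_mapSeries {A : Type*} [Ring A] [Algebra ℂ A] (f : A →ₐ[ℂ] B) (e : A⟦X⟧⟦X⟧) (m n : ℕ) :
    coeff m (coeff n (mapSeries f e)) = f (coeff m (coeff n e)) := by
  simp [mapSeries]

theorem seriesReflects_map_iff {A : Type*} [Ring A] [Algebra ℂ A] (f : A →ₐ[ℂ] B)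
    (S : Matrix (Fin N) (Fin N) A⟦X⟧) :
    SeriesReflects q (S.map (PowerSeries.map (f : A →+* B))) ↔ ∀ i j a b,
      f (coeff a (coeff b (reflLeft q S i j))) = f (coeff a (coeff b (reflRight q S i j))) := by
  rw [seriesReflects_iff]
  constructor
  · intro h i j a b
    rw [← coeff_mapSeries, ← coeff_mapSeries, ← reflLeft_map, ← reflRight_map, h]
  · intro h
    ext i j b a
    rw [reflLeft_map, reflRight_map, coeff_mapSeries, coeff_mapSeries, h]

theorem SO_eq_map : SO q N = (freeO N).map
    (PowerSeries.map (RingQuot.mkAlgHom ℂ (ORel q N) : FreeAlgebra ℂ (OGen N) →+* YO q N)) := by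
  ext i j n
  simp only [SO, freeO, Matrix.map_apply, coeff_map, coeff_mk]
  rfl

theorem SSp_eq_map : SSp q N = (freeSp N).map
    (PowerSeries.map (RingQuot.mkAlgHom ℂ (SpRel q N) : FreeAlgebra ℂ (SpGen N) →+* YSp q N)) := by
  ext i j n
  simp only [SSp, freeSp, Matrix.map_apply, coeff_map, coeff_mk]
  rfl

theorem satisfiesO_SO : SatisfiesO q (SO q N) where
  reflects := by
    rw [SO_eq_map, seriesReflects_map_iff]
    exact fun i j a b => RingQuot.mkAlgHom_rel ℂ (ORel.reflection i j a b)
  upper i j h := by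
    rw [SO, coeff_mk, RingQuot.mkAlgHom_rel ℂ (ORel.upper i j h), map_zero]
  diag i := by
    rw [SO, coeff_mk, RingQuot.mkAlgHom_rel ℂ (ORel.diag i), map_one]

theorem satisfiesSp_SSp : SatisfiesSp q (SSp q N) where
  reflects := by
    rw [SSp_eq_map, seriesReflects_map_iff]
    exact fun i j a b => RingQuot.mkAlgHom_rel ℂ (SpRel.reflection i j a b)
  upper i j h h' := by
    rw [SSp, coeff_mk]
    exact (RingQuot.mkAlgHom_rel ℂ (SpRel.upper i j h h')).trans (map_zero _)
  det i j h := by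
    have h1 := RingQuot.mkAlgHom_rel ℂ (SpRel.det (q := q) i j h)
    rw [map_sub, map_smul, map_mul, map_mul, AlgHom.commutes] at h1
    simp only [SSp, coeff_mk]
    exact h1
  isUnit i j h := by
    have h1 := RingQuot.mkAlgHom_rel ℂ (SpRel.mul_inv (q := q) i j h)
    have h2 := RingQuot.mkAlgHom_rel ℂ (SpRel.inv_mul (q := q) i j h)
    rw [map_mul, map_one] at h1 h2
    rw [SSp, coeff_mk]
    exact ⟨⟨_, _, h1, h2⟩, rfl⟩

/-- The universal property of `Y_q^tw(o_N)`. -/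
theorem SatisfiesO.existsUnique {Q : Matrix (Fin N) (Fin N) B⟦X⟧} (hQ : SatisfiesO q Q) :
    ∃! φ : YO q N →ₐ[ℂ] B, ∀ i j, PowerSeries.map (φ : YO q N →+* B) (SO q N i j) = Q i j := by
  let f : FreeAlgebra ℂ (OGen N) →ₐ[ℂ] B := FreeAlgebra.lift ℂ fun g => coeff g.2.2 (Q g.1 g.2.1)
  have hf : ∀ i j n, f (FreeAlgebra.ι ℂ (i, j, n)) = coeff n (Q i j) := fun i j n =>
    FreeAlgebra.lift_ι_apply _ _
  have hQ' : Q = (freeO N).map (PowerSeries.map (f : FreeAlgebra ℂ (OGen N) →+* B)) := by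
    ext i j n
    simp [freeO, hf]
  have hrel : ∀ ⦃x y⦄, ORel q N x y → f x = f y := by
    intro x y h
    induction h with
    | upper i j h => rw [hf, map_zero, hQ.upper i j h]
    | diag i => rw [hf, map_one, hQ.diag]
    | reflection i j a b =>
      have h := hQ.reflects
      rw [hQ', seriesReflects_map_iff] at h
      exact h i j a b
  refine ⟨RingQuot.liftAlgHom ℂ ⟨f, hrel⟩, fun i j => ?_, fun ψ hψ => ?_⟩
  · ext n
    simp only [coeff_map, SO, coeff_mk]
    exact (RingQuot.liftAlgHom_mkAlgHom_apply ℂ f hrel _).trans (hf i j n)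
  · refine RingQuot.ringQuot_ext' ℂ _ _ (FreeAlgebra.hom_ext (funext fun ⟨i, j, n⟩ => ?_))
    have h1 := congrArg (coeff n) (hψ i j)
    simp only [coeff_map, SO, coeff_mk] at h1
    exact h1.trans (((RingQuot.liftAlgHom_mkAlgHom_apply ℂ f hrel _).trans (hf i j n)).symm)

theorem exists_isPair (hN : Even N) (i : {i : Fin N // Even i.val}) : ∃ j, IsPair i.1 j := by
  have hi : i.1.val + 1 < N := by
    obtain ⟨k, hk⟩ := hN
    obtain ⟨l, hl⟩ := i.2
    have := i.1.2
    omega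
  exact ⟨⟨i.1.val + 1, hi⟩, i.2, rfl⟩

theorem IsPair.eq {i j k : Fin N} (h : IsPair i j) (h' : IsPair i k) : j = k :=
  Fin.ext (h.2.trans h'.2.symm)

/-- The universal property of `Y_q^tw(sp_N)`. -/
theorem SatisfiesSp.existsUnique (hN : Even N) {Q : Matrix (Fin N) (Fin N) B⟦X⟧}
    (hQ : SatisfiesSp q Q) :
    ∃! φ : YSp q N →ₐ[ℂ] B, ∀ i j, PowerSeries.map (φ : YSp q N →+* B) (SSp q N i j) = Q i j := by
  choose p hp using exists_isPair hN
  let f : FreeAlgebra ℂ (SpGen N) →ₐ[ℂ] B := FreeAlgebra.lift ℂ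
    (Sum.elim (fun g => coeff g.2.2 (Q g.1 g.2.1)) fun i => Ring.inverse (coeff 0 (Q i.1 (p i))))
  have hf : ∀ i j n, f (FreeAlgebra.ι ℂ (inl (i, j, n))) = coeff n (Q i j) := fun i j n =>
    FreeAlgebra.lift_ι_apply _ _
  have hf0 : ∀ i j, f (freeSp₀ i j) = coeff 0 (Q i j) := fun i j => hf i j 0
  have hfi : ∀ {i j} (h : IsPair i j), f (FreeAlgebra.ι ℂ (inr ⟨i, h.1⟩)) =
      Ring.inverse (coeff 0 (Q i j)) := by
    intro i j h
    refine (FreeAlgebra.lift_ι_apply _ _).trans ?_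
    exact congrArg (fun k => Ring.inverse (coeff 0 (Q i k))) ((hp ⟨i, h.1⟩).eq h)
  have hQ' : Q = (freeSp N).map (PowerSeries.map (f : FreeAlgebra ℂ (SpGen N) →+* B)) := by
    ext i j n
    simp [freeSp, hf]
  have hrel : ∀ ⦃x y⦄, SpRel q N x y → f x = f y := by
    intro x y h
    induction h with
    | upper i j h h' => rw [hf0, map_zero, hQ.upper i j h h']
    | det i j h =>
      rw [map_sub, map_smul, map_mul, map_mul, hf0, hf0, hf0, hf0, AlgHom.commutes, hQ.det i j h]
    | mul_inv i j h =>
      rw [map_mul, map_one, hf0, hfi h, Ring.mul_inverse_cancel _ (hQ.isUnit i j h)]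
    | inv_mul i j h =>
      rw [map_mul, map_one, hf0, hfi h, Ring.inverse_mul_cancel _ (hQ.isUnit i j h)]
    | reflection i j a b =>
      have h := hQ.reflects
      rw [hQ', seriesReflects_map_iff] at h
      exact h i j a b
  have hgen : ∀ (ψ : YSp q N →ₐ[ℂ] B), (∀ i j, PowerSeries.map (ψ : YSp q N →+* B) (SSp q N i j) =
      Q i j) → ∀ i j n, ψ (RingQuot.mkAlgHom ℂ (SpRel q N) (FreeAlgebra.ι ℂ (inl (i, j, n)))) =
        coeff n (Q i j) := by
    intro ψ hψ i j n
    have h1 := congrArg (coeff n) (hψ i j)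
    simp only [coeff_map, SSp, coeff_mk] at h1
    exact h1
  -- The images of the inverse generators are forced, since inverses are unique; they need not be
  -- prescribed for uniqueness.
  have hinv : ∀ (ψ : YSp q N →ₐ[ℂ] B), (∀ i j, PowerSeries.map (ψ : YSp q N →+* B) (SSp q N i j) =
      Q i j) → ∀ i, ψ (RingQuot.mkAlgHom ℂ (SpRel q N) (FreeAlgebra.ι ℂ (inr i))) =
        Ring.inverse (coeff 0 (Q i.1 (p i))) := by
    intro ψ hψ i
    have h1 := congrArg ψ (RingQuot.mkAlgHom_rel ℂ (SpRel.inv_mul (q := q) _ _ (hp i)))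
    rw [map_mul, map_mul, map_one, map_one, freeSp₀, hgen ψ hψ] at h1
    rw [← mul_one (ψ _), ← Ring.mul_inverse_cancel _ (hQ.isUnit _ _ (hp i)), ← mul_assoc, h1, one_mul]
  have hφ : ∀ i j, PowerSeries.map ((RingQuot.liftAlgHom ℂ ⟨f, hrel⟩ : YSp q N →ₐ[ℂ] B) :
      YSp q N →+* B) (SSp q N i j) = Q i j := by
    intro i j
    ext n
    simp only [coeff_map, SSp, coeff_mk]
    exact (RingQuot.liftAlgHom_mkAlgHom_apply ℂ f hrel _).trans (hf i j n)
  refine ⟨RingQuot.liftAlgHom ℂ ⟨f, hrel⟩, hφ, fun ψ hψ => ?_⟩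
  refine RingQuot.ringQuot_ext' ℂ _ _ (FreeAlgebra.hom_ext (funext fun g => ?_))
  rcases g with ⟨i, j, n⟩ | i
  · exact (hgen ψ hψ i j n).trans (hgen _ hφ i j n).symm
  · exact (hinv ψ hψ i).trans (hinv _ hφ i).symm

end Universal
end TwistedYangian

theorem mainTheorem5 (q : ℂ) (hq0 : q ≠ 0) (hq : ∀ k : ℕ, 0 < k → q ^ k ≠ 1)
    (N M : ℕ) (hN : 0 < N) (hM : 0 < M) :
    ((∃! φ : TwistedYangian.YO q N →ₐ[ℂ] TwistedYangian.YO q (N + M),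
        ∀ i j, PowerSeries.map (φ : TwistedYangian.YO q N →+* TwistedYangian.YO q (N + M))
            (TwistedYangian.SO q N i j)
          = TwistedYangian.tildeS q (TwistedYangian.SO q (N + M)) i j) ∧
      TwistedYangian.sdet q (TwistedYangian.tildeS q (TwistedYangian.SO q (N + M)))
        = TwistedYangian.sylvesterProduct q (TwistedYangian.SO q (N + M))) ∧
    (Even N → Even M →
      (∃! φ : TwistedYangian.YSp q N →ₐ[ℂ] TwistedYangian.YSp q (N + M),
        ∀ i j, PowerSeries.map (φ : TwistedYangian.YSp q N →+* TwistedYangian.YSp q (N + M))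
            (TwistedYangian.SSp q N i j)
          = (q ^ (3 * (M / 2)))⁻¹ •
              TwistedYangian.tildeS q (TwistedYangian.SSp q (N + M)) i j) ∧
      TwistedYangian.sdet q (TwistedYangian.tildeS q (TwistedYangian.SSp q (N + M)))
        = TwistedYangian.sylvesterProduct q (TwistedYangian.SSp q (N + M))) := by
  have hO := TwistedYangian.satisfiesO_SO (q := q) (N := N + M)
  have hSp := TwistedYangian.satisfiesSp_SSp (q := q) (N := N + M)
  refine ⟨⟨(hO.tildeS hq0 hq hM).existsUnique, ?_⟩, fun hN' hM' =>
    ⟨(hSp.smul_tildeS hq0 hq hM hN' hM').existsUnique hN', ?_⟩⟩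
  · obtain ⟨T, hST, hTS⟩ := hO.exists_inverse
    obtain ⟨G, hG, hG'⟩ := hO.subLast.exists_inverse
    exact TwistedYangian.sdet_tildeS hq0 hq hN hM hO.reflects hST hTS hG hG'
  · obtain ⟨T, hST, hTS⟩ := hSp.exists_inverse hq0 (hN'.add hM')
    obtain ⟨G, hG, hG'⟩ := (hSp.subLast hN').exists_inverse hq0 hM'
    exact TwistedYangian.sdet_tildeS hq0 hq hN hM hSp.reflects hST hTS hG hG'
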